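/- **CountSketch derandomized with FastPRG.** *Generator.* Let $b\ge 2$, $k\ge 0$, $n\ge 0$. For $a,c\in\{0,\dots,2^{2n}-1\}$ let $h_{a,c}:\{0,1\}^n\to\{0,1\}^n$ map $x$ to the upper $n$ bits of $(ax+c)\bmod 2^{2n}$ (Dietzfelbinger's 2-wise independent family). FastPRG with block size $n$, branching factor $b$ and depth $k$ has as seed a uniformly random $x\in\{0,1\}^n$ and $bk$ independent functions $h_i^{(j)}$ ($0\le i<k$, $0\le j<b$) from this family. It outputs $b^k$ blocks of $n$ bits; block number $J=\sum_i j_i b^i$ (digits $0\le j_i<b$) is $h_0^{(j_0)}(h_1^{(j_1)}(\cdots h_{k-1}^{(j_{k-1})}(x)))$. *Sketch.* Let $d\ge 2$, $M\ge 1$, let $t\ge 2$ be a power of two and $r$ odd. For $0\le i<r$ and $0\le\rho<d$ let $s_i(\rho)\in\{\pm1\}$ be given by the first bit ($1\mapsto +1$, $0\mapsto -1$), and $g_i(\rho)\in\{0,\dots,t-1\}$ by the last $\log_2 t$ bits, of block number $id+\rho$ of FastPRG with depth $k=\lceil\log_b(rd)\rceil$. The sketch of $x\in\mathbb Z^d$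 is the linear map $\mathrm{CS}(x)_{i,j}=\sum_\rho s_i(\rho)\,x_\rho\,[g_i(\rho)=j]$, and the estimator of $x_\ell$ is $\hat x_\ell=\mathrm{median}\{s_i(\ell)\,\mathrm{CS}(x)_{i,g_i(\ell)} : 0\le i<r\}$. Let $\Delta=\|\mathrm{tail}_t(x)\|_2/\sqrt t$, where $\mathrm{tail}_t(x)$ is $x$ with its $t$ entries of largest absolute value set to zero. **Theorem.** There is an absolute constant $c>0$ such that for all constants $C>0$ and $K\in\mathbb N$ there are constants $N,c_0,A\in\mathbb N$ and two word RAM programs (for updates and for queries), depending only on $C$ and $K$, such that the following holds for all $d\ge2$, $M\ge1$, $b\ge2$, all $t\ge2$ that are powers of two, all odd $r\le d^K$, and every word size $w$ with $w\ge c_0(\log_2 d+\log_2 M)$, $w\ge c_0\log_2 t$ and $w\ge c_0\log_2 b$, when FastPRG has block size $n=Nw$. 1. *Space.* The seed together with the numbers $w,d,t,r,b,k$ is stored in at most $A\,b\lceil\log_b d\rceil$ words. For $x\in\{-M,\dots,M\}^d$ each entry of $\mathrm{CS}(x)$ has absolute value less than $2^{w-1}$, and $\mathrm{CS}(x)$ is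 stored in $rt$ words. Everything fits into the $2^w$ memory cells of the word RAM. 2. *Updates.* For every seed, given $\mathrm{CS}(x)$, $\ell$ and $u_\ell$, where $x$ and $x+u_\ell e_\ell$ lie in $\{-M,\dots,M\}^d$, the update program replaces $\mathrm{CS}(x)$ by $\mathrm{CS}(x+u_\ell e_\ell)$ in at most $A\,r\lceil\log_b d\rceil$ steps on the word RAM with word size $w$. 3. *Queries.* For every seed, given $\mathrm{CS}(x)$ with $x\in\{-M,\dots,M\}^d$ and $\ell$, the query program computes $\hat x_\ell$ in at most $A\,r\lceil\log_b d\rceil$ steps and leaves the data structure unchanged. 4. *Error.* For every $x\in\{-M,\dots,M\}^d$, $\alpha\in[0,1]$ and $\ell\in\{0,\dots,d-1\}$, over the uniformly random seed, $$\Pr\big[|\hat x_\ell-x_\ell|>\alpha\Delta\big]<2\exp(-c\,\alpha^2 r)+2^{-Cw}.$$ For $b\le d$ the condition $w\ge c_0\log_2 b$ is implied and $\lceil\log_b d\rceil\le 2\log_b d$, so the bounds are $O(b\log_b d)$ words and $O(r\log_b d)$ time. -/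

import Mathlib

namespace FastCS

/-! ## The word RAM

A program of the word RAM with word size `w` works on registers and on a memory of `2 ^ w` cells;
registers and cells hold words of `w` bits, and words serve as addresses.  Programs do not depend
on `w`.  Each elementary instruction and each evaluation of a branching condition costs one step. -/

/-- The binary operations on words.  Arithmetic is unsigned and modulo `2 ^ w`, `mulHi` is the upper
word of the two-word product, and a comparison returns the word `1` (true) or `0` (false). -/
inductive Op
  | add | sub | mul | mulHi | div | mod | band | bor | bxor | shl | shr | eq | lt

/-- The meaning of the operations on words. -/
def Op.eval {w : ℕ} : Op → BitVec w → BitVec w → BitVec w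
  | .add, x, y => x + y
  | .sub, x, y => x - y
  | .mul, x, y => x * y
  | .mulHi, x, y => BitVec.ofNat w (x.toNat * y.toNat / 2 ^ w)
  | .div, x, y => x / y
  | .mod, x, y => x % y
  | .band, x, y => x &&& y
  | .bor, x, y => x ||| y
  | .bxor, x, y => x ^^^ y
  | .shl, x, y => x <<< y.toNat
  | .shr, x, y => x >>> y.toNat
  | .eq, x, y => if x = y then 1 else 0
  | .lt, x, y => if x.toNat < y.toNat then 1 else 0

/-- Programs.  The numbers `x`, `y`, `z` are names of registers. -/
inductive Prog
  /-- `x := v` for a fixed number `v` (reduced modulo `2 ^ w`) -/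
  | const (x v : ℕ)
  /-- `z := o x y` -/
  | bin (o : Op) (z x y : ℕ)
  /-- `x := memory[y]` -/
  | load (x y : ℕ)
  /-- `memory[x] := y` -/
  | store (x y : ℕ)
  /-- `p`, then `q` -/
  | seq (p q : Prog)
  /-- if `x ≠ 0` then `p` else `q` -/
  | cond (x : ℕ) (p q : Prog)
  /-- while `x ≠ 0` do `p` -/
  | loop (x : ℕ) (p : Prog)

/-- The state of a machine with word size `w`. -/
structure State (w : ℕ) where
  reg : ℕ → BitVec w
  mem : BitVec w → BitVec w

/-- Write the word `v` into register `x`. -/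
def State.setReg {w : ℕ} (s : State w) (x : ℕ) (v : BitVec w) : State w :=
  { s with reg := Function.update s.reg x v }

/-- Write the word `v` into the memory cell with address `a`. -/
def State.setMem {w : ℕ} (s : State w) (a v : BitVec w) : State w :=
  { s with mem := Function.update s.mem a v }

/-- `Exec p s T s'`: started in state `s`, the program `p` halts after exactly `T` steps, in
state `s'`. -/
inductive Exec {w : ℕ} : Prog → State w → ℕ → State w → Prop
  | const (s : State w) (x v : ℕ) : Exec (.const x v) s 1 (s.setReg x (BitVec.ofNat w v))
  | bin (s : State w) (o : Op) (z x y : ℕ) :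
      Exec (.bin o z x y) s 1 (s.setReg z (o.eval (s.reg x) (s.reg y)))
  | load (s : State w) (x y : ℕ) : Exec (.load x y) s 1 (s.setReg x (s.mem (s.reg y)))
  | store (s : State w) (x y : ℕ) : Exec (.store x y) s 1 (s.setMem (s.reg x) (s.reg y))
  | seq {p q : Prog} {s s₁ s₂ : State w} {T₁ T₂ : ℕ} :
      Exec p s T₁ s₁ → Exec q s₁ T₂ s₂ → Exec (.seq p q) s (T₁ + T₂) s₂
  | condTrue {x : ℕ} {p q : Prog} {s s₁ : State w} {T : ℕ} :
      s.reg x ≠ 0 → Exec p s T s₁ → Exec (.cond x p q) s (T + 1) s₁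
  | condFalse {x : ℕ} {p q : Prog} {s s₁ : State w} {T : ℕ} :
      s.reg x = 0 → Exec q s T s₁ → Exec (.cond x p q) s (T + 1) s₁
  | loopStop {x : ℕ} {p : Prog} {s : State w} : s.reg x = 0 → Exec (.loop x p) s 1 s
  | loopStep {x : ℕ} {p : Prog} {s s₁ s₂ : State w} {T₁ T₂ : ℕ} :
      s.reg x ≠ 0 → Exec p s T₁ s₁ → Exec (.loop x p) s₁ T₂ s₂ →
        Exec (.loop x p) s (T₁ + T₂ + 1) s₂

/-! ## The generator -/

/-- Dietzfelbinger's multiply-shift hash function `{0,1}ⁿ → {0,1}ⁿ` with parameters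
`a, c ∈ {0, …, 2²ⁿ - 1}`: the upper `n` bits of `(a * x + c) mod 2²ⁿ`.  For uniform and independent
`a`, `c` this is a 2-wise independent family. -/
def multShift {n : ℕ} (a c : BitVec (2 * n)) (x : BitVec n) : BitVec n :=
  (a * x.setWidth (2 * n) + c).extractLsb' n n

/-- The generator `G_k(x, h₀, …, h_{k-1})`, which is the concatenation of
`G_{k-1}(h_{k-1}⁽ʲ⁾(x), h₀, …, h_{k-2})` over `j = 0, …, b - 1`.  Its output is a sequence of `b ^ k`
blocks of `n` bits; here a block is addressed by the base-`b` digits of its number, digit `0` being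
the least significant one, so that the value is `h₀⁽ʲ⁰⁾(h₁⁽ʲ¹⁾(⋯ h_{k-1}⁽ʲᵏ⁻¹⁾(x)))`. -/
def gen {b n : ℕ} : {k : ℕ} → (Fin k → Fin b → BitVec n → BitVec n) → BitVec n →
    (Fin k → Fin b) → BitVec n
  | 0, _, x, _ => x
  | k + 1, h, x, j =>
      gen (fun i => h i.castSucc) (h (Fin.last k) (j (Fin.last k)) x) (fun i => j i.castSucc)

/-- A seed of FastPRG with block size `n`, branching factor `b` and depth `k`: the start block `x`
and the parameters `(a, c)` of the `k * b` hash functions. -/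
abbrev Seed (n b k : ℕ) : Type :=
  BitVec n × (Fin k → Fin b → BitVec (2 * n) × BitVec (2 * n))

/-- Block number `J` of the output of FastPRG (which consists of `b ^ k` blocks). -/
def fastPRG {n b k : ℕ} (σ : Seed n b k) (J : ℕ) : BitVec n :=
  if hJ : J < b ^ k then
    gen (fun i j => multShift (σ.2 i j).1 (σ.2 i j).2) σ.1 (finFunctionFinEquiv.symm ⟨J, hJ⟩)
  else 0

/-! ## CountSketch -/

/-- The CountSketch matrix of hash functions `g₁, …, g_r` and sign functions `s₁, …, s_r`. -/
def csMatrix {d t r : ℕ} (g : Fin r → Fin d → Fin t) (s : Fin r → Fin d → ℤ) :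
    Matrix (Fin r × Fin t) (Fin d) ℤ :=
  Matrix.of fun ij ρ => if g ij.1 ρ = ij.2 then s ij.1 ρ else 0

/-- The median of `r` integers (`r` odd): the middle one in sorted order. -/
def median {r : ℕ} (f : Fin r → ℤ) : ℤ :=
  if hr : 0 < r then f (Tuple.sort f ⟨r / 2, Nat.div_lt_self hr one_lt_two⟩) else 0

/-- The CountSketch estimator of coordinate `ℓ`, computed from the table `y`. -/
def csEstimate {d t r : ℕ} (g : Fin r → Fin d → Fin t) (s : Fin r → Fin d → ℤ)
    (y : Fin r × Fin t → ℤ) (ℓ : Fin d) : ℤ :=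
  median fun i => s i ℓ * y (i, g i ℓ)

/-- `tail_t(x)`: the `t` entries of `x` of largest absolute value are set to zero. -/
def tail {d : ℕ} (t : ℕ) (x : Fin d → ℤ) : Fin d → ℤ :=
  fun i => if ((Tuple.sort fun j => -|x j|).symm i : ℕ) < t then 0 else x i

/-- `Δ = ‖tail_t(x)‖₂ / √t`. -/
noncomputable def errScale {d : ℕ} (t : ℕ) (x : Fin d → ℤ) : ℝ :=
  ‖(WithLp.toLp 2 fun i => (tail t x i : ℝ) : EuclideanSpace ℝ (Fin d))‖ / √(t : ℝ)

/-! ## CountSketch with FastPRG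

The table size is `t = 2 ^ τ`.  Repetition `i` and coordinate `ρ` (both counted from `0`) use block
number `i * d + ρ` of FastPRG. -/

section
variable {n b k : ℕ} (d τ r : ℕ) (σ : Seed n b k)

/-- The hash value is given by the last `τ` bits of the block. -/
def prgHash (i : Fin r) (ρ : Fin d) : Fin (2 ^ τ) :=
  ((fastPRG σ (i * d + ρ)).setWidth τ).toFin

/-- The sign is given by the first bit of the block. -/
def prgSign (i : Fin r) (ρ : Fin d) : ℤ :=
  if (fastPRG σ (i * d + ρ)).msb then 1 else -1

/-- The linear sketch. -/
def prgSketch (x : Fin d → ℤ) : Fin r × Fin (2 ^ τ) → ℤ :=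
  (csMatrix (prgHash d τ r σ) (prgSign d r σ)).mulVec x

/-- The estimator of `x_ℓ`, computed from the sketch of `x`. -/
def prgEstimate (x : Fin d → ℤ) (ℓ : Fin d) : ℤ :=
  csEstimate (prgHash d τ r σ) (prgSign d r σ) (prgSketch d τ r σ x) ℓ

end

/-- The depth of FastPRG: the least `k` with `b ^ k ≥ r * d`. -/
def depth (d r b : ℕ) : ℕ := Nat.clog b (r * d)

/-- The number of words that hold the parameters of the sketch: six numbers and the seed, for block
size `n = N * w`. -/
def descrWords (N b k : ℕ) : ℕ := 6 + N + k * b * (4 * N)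

/-- The `l` words (least significant first) of `v` are stored from address `a` on. -/
def StoredAt {w m : ℕ} (s : State w) (a l : ℕ) (v : BitVec m) : Prop :=
  ∀ q < l, s.mem (BitVec.ofNat w (a + q)) = v.extractLsb' (q * w) w

/-- The memory holds the data structure: the numbers `w`, `d`, `t = 2 ^ τ`, `r`, `b`, `k`, then the
seed `σ`, then the table `y`, row by row and in two's complement, one word per entry.  Nothing is
said about registers and about the other memory cells. -/
def Holds {N b k w : ℕ} (s : State w) (d τ r : ℕ) (σ : Seed (N * w) b k)
    (y : Fin r × Fin (2 ^ τ) → ℤ) : Prop :=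
  s.mem 0 = BitVec.ofNat w w ∧
  s.mem 1 = BitVec.ofNat w d ∧
  s.mem 2 = BitVec.ofNat w (2 ^ τ) ∧
  s.mem 3 = BitVec.ofNat w r ∧
  s.mem 4 = BitVec.ofNat w b ∧
  s.mem 5 = BitVec.ofNat w k ∧
  StoredAt s 6 N σ.1 ∧
  (∀ (i : Fin k) (j : Fin b),
    StoredAt s (6 + N + (i * b + j) * (4 * N)) (2 * N) (σ.2 i j).1 ∧
    StoredAt s (6 + N + (i * b + j) * (4 * N) + 2 * N) (2 * N) (σ.2 i j).2) ∧
  ∀ (i : Fin r) (j : Fin (2 ^ τ)),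
    s.mem (BitVec.ofNat w (descrWords N b k + i * 2 ^ τ + j)) = BitVec.ofInt w (y (i, j))

/-- The probability of the event `E` for a uniformly distributed element of the finite type `Ω`. -/
noncomputable def prob {Ω : Type} (E : Set Ω) : ℝ := (Nat.card E : ℝ) / (Nat.card Ω : ℝ)

end FastCS

open FastCS

/-!
The theorem has two parts: the error bound for the estimator, and the two programs.

**The error with independent blocks.** If the blocks are independent and uniform, then the estimate of
one row is the true value `x ℓ` plus a lazy random walk, whose steps are the other entries of `x`, each
taken with probability `1 / t` and a random sign (`avg_noise_eq_lazyWalk`). With probability at least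
`1 / 4` none of the `t` largest entries takes part (`lazyWalk_ge_of_heads`). The remaining walk is the
difference of two independent copies of a random variable with standard deviation at most `Δ`, so it is
at most `α Δ` in absolute value with a probability of order `α`: two copies of a variable with small
variance are likely to fall into the same interval of length `α Δ` (`close_of_variance`,
`lazyWalk_small`). Since the walk is symmetric, the estimate exceeds `x ℓ + α Δ` with probability at
most `(1 - α / 80) / 2` (`row_error_le`), and Chernoff's bound shows that this happens in more than
half of the rows with probability at most `exp (-α² r / 25600)` (`majority_bound`). The same holds below
`x ℓ - α Δ`, whence the factor `2`.

**The generator.** The event "more than half of the row estimates lie in a given half-line" can be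
tested by reading the blocks from left to right with little memory, once the sign and the hash value of
coordinate `ℓ` in the row are guessed in advance; the guess is confirmed when the block of `ℓ` arrives,
so exactly one guess succeeds. `SmallSpace` is the property of such tests that is needed: at each cut,
two accepted words with the same one of `S` states can be recombined (`rowTest_smallSpace`). Hence the
event is a disjoint union of `S` products at each cut (`SmallSpace.exists_rectangles`). The hash family
is pairwise independent (`multShift_pairIndep`), and the variance of a sum of pairwise independent
variables shows that applying one hash function in each of `W` segments costs an error of at most
`W · S · 2 ^ (-n / 2)` (`PairIndep.variance_le`, `PairIndep.fools`). All levels together cost at most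
`b ^ k · S · 2 ^ (-n / 2)` (`forest_fools`, `fastPRG_fools`). Both `b ^ k` and `S` are polynomial in
`d`, `M`, `t` and `b`, so for a block size `n = N w` with a large constant `N` the error is less than
`2 ^ (-C w)` (`prg_error_lt`).

**The programs.** A hash function is evaluated by schoolbook multiplication of numbers with `2 N` words
(`mulShiftProg_run`), and a block by descending along the digits of its number (`genProg_run`); this
takes `O(k)` steps, with `k ≤ (K + 1) ⌈log_b d⌉` (`depth_le`). An update does so once for each row
(`updateProg_run`). A query writes the row estimates to the free memory and selects the median in linear
time by medians of medians, with a stack in memory in place of recursion (`selectRound_rounds`,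
`queryProg_run`).
-/

namespace FastCS

open scoped BigOperators
open Finset (expect_le_expect expect_nonneg abs_expect_le)

/-! ### Averages over finite types -/

open Classical in
/-- The indicator of a proposition, as a real number. -/
noncomputable def ind (p : Prop) : ℝ := if p then 1 else 0

lemma ind_nonneg (p : Prop) : 0 ≤ ind p := by
  unfold ind; split_ifs <;> norm_num

lemma ind_le_one (p : Prop) : ind p ≤ 1 := by
  unfold ind; split_ifs <;> norm_num

lemma ind_true {p : Prop} (h : p) : ind p = 1 := by simp [ind, h]

lemma ind_false {p : Prop} (h : ¬ p) : ind p = 0 := by simp [ind, h]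

lemma ind_and (p q : Prop) : ind (p ∧ q) = ind p * ind q := by
  unfold ind; split_ifs <;> simp_all

lemma ind_mono {p q : Prop} (h : p → q) : ind p ≤ ind q := by
  unfold ind; split_ifs <;> simp_all

lemma prob_eq_expect {Ω : Type} [Fintype Ω] (E : Set Ω) : prob E = 𝔼 ω, ind (ω ∈ E) := by
  classical
  have h : (∑ ω, ind (ω ∈ E)) = (Nat.card E : ℝ) := by
    simp only [ind, Finset.sum_boole, Nat.card_eq_fintype_card, ← Set.toFinset_card]
    congr 2
    ext; simp
  rw [prob, Fintype.expect_eq_sum_div_card, h, Nat.card_eq_fintype_card (α := Ω)]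

section Averages
variable {α β γ : Type*} [Fintype α] [Fintype β] [Fintype γ]

lemma avg_mono {f g : α → ℝ} (h : ∀ a, f a ≤ g a) : 𝔼 a, f a ≤ 𝔼 a, g a :=
  expect_le_expect fun a _ => h a

lemma avg_nonneg {f : α → ℝ} (h : ∀ a, 0 ≤ f a) : 0 ≤ 𝔼 a, f a :=
  expect_nonneg fun a _ => h a

lemma avg_le_of_le [Nonempty α] {f : α → ℝ} {c : ℝ} (h : ∀ a, f a ≤ c) : 𝔼 a, f a ≤ c :=
  Finset.expect_le Finset.univ_nonempty fun a _ => h a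

lemma avg_prod (f : α × β → ℝ) : 𝔼 p, f p = 𝔼 a, 𝔼 b, f (a, b) := by
  rw [← Finset.univ_product_univ, Finset.expect_product]

lemma avg_prod' (f : α → β → ℝ) : 𝔼 p : α × β, f p.1 p.2 = 𝔼 a, 𝔼 b, f a b :=
  avg_prod fun p => f p.1 p.2

lemma avg_comm (f : α → β → ℝ) : 𝔼 a, 𝔼 b, f a b = 𝔼 b, 𝔼 a, f a b :=
  Finset.expect_comm _ _ _

lemma avg_cons {W : ℕ} (f : (Fin (W + 1) → α) → ℝ) :
    𝔼 y, f y = 𝔼 a, 𝔼 y : Fin W → α, f (Fin.cons a y) := by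
  rw [← avg_prod fun p : α × (Fin W → α) => f (Fin.cons p.1 p.2)]
  exact (Fintype.expect_equiv (Fin.consEquiv fun _ => α) _ _ fun _ => rfl).symm

lemma avg_snoc {W : ℕ} (f : (Fin (W + 1) → α) → ℝ) :
    𝔼 y, f y = 𝔼 a, 𝔼 y : Fin W → α, f (Fin.snoc y a) := by
  rw [← avg_prod fun p : α × (Fin W → α) => f (Fin.snoc p.2 p.1)]
  refine (Fintype.expect_equiv (Fin.snocEquiv fun _ => α) _ _ fun p => ?_).symm
  rfl

lemma abs_avg_le (f : α → ℝ) : |𝔼 a, f a| ≤ 𝔼 a, |f a| := abs_expect_le _ _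

/-- The Cauchy-Schwarz inequality for averages. -/
lemma avg_sq_le (f : α → ℝ) : (𝔼 a, f a) ^ 2 ≤ 𝔼 a, f a ^ 2 := by
  rcases isEmpty_or_nonempty α with h | h
  · simp
  · have := Finset.expect_mul_sq_le_sq_mul_sq Finset.univ f (fun _ => (1 : ℝ))
    simpa using this

/-- The image of a uniformly distributed element under `G` is uniformly distributed, expressed by
means of test functions. -/
def UniformMap (G : α → β) : Prop := ∀ φ : β → ℝ, 𝔼 a, φ (G a) = 𝔼 b, φ b

lemma UniformMap.comp {G : α → β} {G' : β → γ} (h' : UniformMap G') (h : UniformMap G) :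
    UniformMap (G' ∘ G) := fun φ => by
  rw [← h' φ, ← h fun b => φ (G' b)]; rfl

lemma uniformMap_equiv (e : α ≃ β) : UniformMap e := fun _ =>
  Fintype.expect_equiv e _ _ fun _ => rfl

lemma uniformMap_fst [Nonempty β] : UniformMap (Prod.fst : α × β → α) := fun φ => by
  rw [avg_prod]; simp

/-- A map into a group is uniform if every translation of the group lifts to a permutation of the
domain. -/
lemma uniformMap_of_translations [AddGroup β] {G : α → β} [Nonempty α]
    (h : ∀ v : β, ∃ τ : Equiv.Perm α, ∀ a, G (τ a) = G a + v) : UniformMap G := fun φ => by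
  choose τ hτ using h
  calc 𝔼 a, φ (G a) = 𝔼 _v : β, 𝔼 a, φ (G a) := (Fintype.expect_const _).symm
    _ = 𝔼 v : β, 𝔼 a, φ (G a + v) := by
      refine Finset.expect_congr rfl fun v _ => ?_
      rw [← Fintype.expect_equiv (τ v) (fun a => φ (G (τ v a))) (fun a => φ (G a)) fun _ => rfl]
      simp [hτ]
    _ = 𝔼 a, 𝔼 v : β, φ (G a + v) := avg_comm _
    _ = 𝔼 _a : α, 𝔼 v : β, φ v := by
      refine Finset.expect_congr rfl fun a _ => ?_
      exact Fintype.expect_equiv (Equiv.addLeft (G a)) _ _ fun _ => rfl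
    _ = 𝔼 v : β, φ v := Fintype.expect_const _

lemma UniformMap.pi {G : α → β} (h : UniformMap G) (m : ℕ) :
    UniformMap fun (ω : Fin m → α) j => G (ω j) := by
  induction m with
  | zero =>
    intro φ
    rw [Fintype.expect_eq_sum_div_card, Fintype.expect_eq_sum_div_card]
    simp only [Finset.univ_unique, Finset.sum_singleton, Fintype.card_unique]
    congr 2
    exact Subsingleton.elim _ _
  | succ m ih =>
    intro φ
    rw [avg_cons, avg_cons, ← h fun b => 𝔼 y : Fin m → β, φ (Fin.cons b y)]
    refine Finset.expect_congr rfl fun a _ => ?_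
    rw [← ih fun y => φ (Fin.cons (G a) y)]
    refine Finset.expect_congr rfl fun y _ => ?_
    congr 1
    funext j
    refine Fin.cases ?_ (fun j => ?_) j <;> simp

/-- Restricting a uniform function along an injection gives a uniform function. -/
lemma uniformMap_restrict {ι κ : Type*} [Fintype ι] [Fintype κ] [DecidableEq ι] [DecidableEq κ]
    [Nonempty α] (e : ι → κ) (he : Function.Injective e) :
    UniformMap fun (z : κ → α) i => z (e i) := by
  classical
  let p : κ → Prop := fun j => j ∈ Set.range e
  let E₁ := Equiv.piEquivPiSubtypeProd p (fun _ => α)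
  let E₂ : ({j // p j} → α) ≃ (ι → α) := Equiv.arrowCongr (Equiv.ofInjective e he).symm (Equiv.refl α)
  exact ((uniformMap_equiv E₂).comp uniformMap_fst).comp (uniformMap_equiv E₁)

/-- The average over a power of the base type of a product of functions of the single coordinates. -/
lemma avg_pi_prod [Nonempty α] {ι : Type*} [Fintype ι] [DecidableEq ι] (f : ι → α → ℝ) :
    𝔼 z : ι → α, ∏ i, f i (z i) = ∏ i, 𝔼 a, f i a := by
  simp only [Fintype.expect_eq_sum_div_card]
  rw [Finset.prod_div_distrib, Finset.prod_const, Fintype.card_fun, Finset.card_univ, Nat.cast_pow,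
    Finset.prod_univ_sum, Fintype.piFinset_univ]

end Averages

/-! ### Dietzfelbinger's family is pairwise independent -/

/-- The upper half of a `2n`-bit word. -/
def upper {n : ℕ} (y : BitVec (2 * n)) : BitVec n := y.extractLsb' n n

lemma upper_toNat {n : ℕ} (y : BitVec (2 * n)) : (upper y).toNat = y.toNat / 2 ^ n := by
  rw [upper, BitVec.extractLsb'_toNat, Nat.shiftRight_eq_div_pow]
  apply Nat.mod_eq_of_lt
  rw [Nat.div_lt_iff_lt_mul (by positivity), ← pow_add, ← two_mul]
  exact y.isLt

lemma upper_add {n : ℕ} (y : BitVec (2 * n)) (v : BitVec n) :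
    upper (y + ((v.toNat * 2 ^ n : ℕ) : BitVec (2 * n))) = upper y + v := by
  apply BitVec.eq_of_toNat_eq
  rw [BitVec.toNat_add, upper_toNat, upper_toNat, BitVec.toNat_add, BitVec.natCast_eq_ofNat,
    BitVec.toNat_ofNat, Nat.add_mod_mod, (by rw [two_mul, pow_add] : 2 ^ (2 * n) = 2 ^ n * 2 ^ n),
    Nat.mod_mul_right_div_self, Nat.add_mul_div_right _ _ (by positivity)]

/-- The difference of two distinct `n`-bit words divides `2 ^ n` modulo `2 ^ (2 * n)`: it is an odd
number times `2 ^ s` for some `s < n`. -/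
lemma exists_mul_eq_two_pow {n : ℕ} {x x' : BitVec n} (h : x ≠ x') :
    ∃ a : BitVec (2 * n),
      (x'.setWidth (2 * n) - x.setWidth (2 * n)) * a = ((2 ^ n : ℕ) : BitVec (2 * n)) := by
  set D : ℤ := (x'.toNat : ℤ) - x.toNat with hD
  have hD0 : D ≠ 0 := by
    intro h0
    exact h (BitVec.eq_of_toNat_eq (by omega))
  have hlt : D.natAbs < 2 ^ n := by
    have := x.isLt
    have := x'.isLt
    omega
  obtain ⟨s, hs, hgs⟩ := (Nat.dvd_prime_pow Nat.prime_two).1 (Nat.gcd_dvd_right D.natAbs (2 ^ (2 * n)))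
  have hsn : s ≤ n := by
    have h1 : 2 ^ s ∣ D.natAbs := hgs ▸ Nat.gcd_dvd_left _ _
    have h2 := Nat.le_of_dvd (Int.natAbs_pos.2 hD0) h1
    exact ((Nat.pow_lt_pow_iff_right (by norm_num)).1 (h2.trans_lt hlt)).le
  have hbez := Int.gcd_eq_gcd_ab D ((2 ^ (2 * n) : ℕ) : ℤ)
  have hg : Int.gcd D ((2 ^ (2 * n) : ℕ) : ℤ) = 2 ^ s := by
    rw [← hgs, Int.gcd_eq_natAbs]; rfl
  rw [hg] at hbez
  refine ⟨((Int.gcdA D ((2 ^ (2 * n) : ℕ) : ℤ) * 2 ^ (n - s) : ℤ) : BitVec (2 * n)), ?_⟩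
  have hc : ∀ y : BitVec n, y.setWidth (2 * n) = ((y.toNat : ℤ) : BitVec (2 * n)) := by
    intro y
    apply BitVec.eq_of_toNat_eq
    simp
  have h0 : ((2 ^ (2 * n) : ℕ) : BitVec (2 * n)) = 0 := by
    rw [BitVec.natCast_eq_ofNat]
    apply BitVec.eq_of_toNat_eq
    rw [BitVec.toNat_ofNat, Nat.mod_self]
    simp
  have key : ((2 : ℤ) ^ n) = D * (Int.gcdA D ((2 ^ (2 * n) : ℕ) : ℤ) * 2 ^ (n - s)) +
      ((2 ^ (2 * n) : ℕ) : ℤ) * (Int.gcdB D ((2 ^ (2 * n) : ℕ) : ℤ) * 2 ^ (n - s)) := by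
    have : (2 : ℤ) ^ n = ((2 ^ s : ℕ) : ℤ) * 2 ^ (n - s) := by
      push_cast
      rw [← pow_add]; congr 1; omega
    rw [this, hbez]; ring
  have := congrArg (fun z : ℤ => (z : BitVec (2 * n))) key
  rw [Int.cast_add, Int.cast_mul _ (Int.gcdB _ _ * _), Int.cast_natCast, h0, zero_mul, add_zero,
    Int.cast_mul, hD, Int.cast_sub, ← hc, ← hc] at this
  rw [← this]
  push_cast
  rfl

lemma uniformMap_upper_affine {n : ℕ} {x x' : BitVec n} (h : x ≠ x') (c : BitVec (2 * n)) :
    UniformMap fun a : BitVec (2 * n) =>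
      upper (c + (x'.setWidth (2 * n) - x.setWidth (2 * n)) * a) := by
  obtain ⟨a₁, ha₁⟩ := exists_mul_eq_two_pow h
  refine uniformMap_of_translations fun v => ⟨Equiv.addRight (a₁ * ((v.toNat : ℕ) : BitVec (2 * n))), fun a => ?_⟩
  rw [← upper_add]
  congr 1
  simp only [Equiv.coe_addRight]
  rw [mul_add, ← mul_assoc, ha₁, ← Nat.cast_mul, mul_comm (2 ^ n), add_assoc]

lemma uniformMap_upper {n : ℕ} : UniformMap (upper : BitVec (2 * n) → BitVec n) :=
  uniformMap_of_translations fun v =>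
    ⟨Equiv.addRight ((v.toNat * 2 ^ n : ℕ) : BitVec (2 * n)), fun a => upper_add a v⟩

/-- The values of a random multiply-shift function at two distinct points are independent and
uniformly distributed. -/
lemma multShift_pair {n : ℕ} {x x' : BitVec n} (h : x ≠ x') :
    UniformMap fun p : BitVec (2 * n) × BitVec (2 * n) =>
      (multShift p.1 p.2 x, multShift p.1 p.2 x') := by
  intro φ
  set X := x.setWidth (2 * n)
  set X' := x'.setWidth (2 * n)
  have e : ∀ a : BitVec (2 * n), 𝔼 c, φ (multShift a c x, multShift a c x') =
      𝔼 c, φ (upper c, upper (c + (X' - X) * a)) := by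
    intro a
    refine Fintype.expect_equiv (Equiv.addLeft (a * X)) _ _ fun c => ?_
    simp only [multShift, upper, Equiv.coe_addLeft]
    have : a * X + c + (X' - X) * a = a * X' + c := by ring
    rw [this]
  rw [avg_prod]
  simp only [e]
  rw [avg_comm, avg_prod fun p => φ p]
  rw [← uniformMap_upper fun u => 𝔼 v, φ (u, v)]
  refine Finset.expect_congr rfl fun c _ => ?_
  exact uniformMap_upper_affine h c fun v => φ (upper c, v)

lemma multShift_single {n : ℕ} (x : BitVec n) :
    UniformMap fun p : BitVec (2 * n) × BitVec (2 * n) => multShift p.1 p.2 x := by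
  intro φ
  rw [avg_prod]
  have : ∀ a : BitVec (2 * n), 𝔼 c, φ (multShift a c x) = 𝔼 v, φ v := by
    intro a
    rw [← uniformMap_upper φ]
    exact Fintype.expect_equiv (Equiv.addLeft (a * x.setWidth (2 * n))) _ _ fun c => rfl
  simp only [this]
  exact Fintype.expect_const _

set_option linter.unusedSectionVars false

/-! ### The generator fools tests of small space -/

/-- `z` before position `L`, and `z'` from position `L` on. -/
def splice {ι X : Type*} (pos : ι → ℕ) (L : ℕ) (z z' : ι → X) : ι → X :=
  fun i => if pos i < L then z i else z' i

/-- A set of strings that is recognized with `S` states: at each cut `L` there is a state function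
with at most `S` values such that two strings of the set that have the same state can be
recombined at `L`, and the recombination is in the set and has the same state.  This covers the
unambiguous nondeterministic automata with `S` states, since the state at `L` may depend on the
symbols behind `L`. -/
def SmallSpace {ι X : Type*} (pos : ι → ℕ) (S : ℕ) (E : Set (ι → X)) : Prop :=
  ∀ L : ℕ, ∃ st : (ι → X) → Fin S, ∀ z ∈ E, ∀ z' ∈ E, st z = st z' →
    splice pos L z z' ∈ E ∧ st (splice pos L z z') = st z

/-- Preimages under maps that carry cuts to cuts need no more states. -/
lemma SmallSpace.preimage {ι κ X Y : Type*} {pos : ι → ℕ} {pos' : κ → ℕ} {S : ℕ}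
    {E : Set (κ → Y)} (h : SmallSpace pos' S E) (f : (ι → X) → (κ → Y)) (cut : ℕ → ℕ)
    (hf : ∀ L z z', f (splice pos L z z') = splice pos' (cut L) (f z) (f z')) :
    SmallSpace pos S (f ⁻¹' E) := by
  intro L
  obtain ⟨st, hst⟩ := h (cut L)
  refine ⟨st ∘ f, fun z hz z' hz' hzz' => ?_⟩
  simp only [Set.mem_preimage, Function.comp, hf] at *
  exact hst _ hz _ hz' hzz'

section SingleLevel
variable {Ω β X : Type*} [Fintype Ω] [Fintype β] [Fintype X] [Nonempty Ω] [Nonempty β] [Nonempty X]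

/-- A random function with pairwise independent and uniformly distributed values. -/
structure PairIndep (H : Ω → β → X) : Prop where
  single : ∀ u, UniformMap fun ω => H ω u
  pair : ∀ u u', u ≠ u' → UniformMap fun ω => (H ω u, H ω u')

/-- The sample mean of a bounded function over the points `H ω u` has variance at most
`1 / |β|`, since different sample points are uncorrelated. -/
lemma PairIndep.variance_le {H : Ω → β → X} (hH : PairIndep H) {f : X → ℝ}
    (hf0 : 𝔼 x, f x = 0) (hf1 : ∀ x, |f x| ≤ 1) :
    𝔼 ω, (𝔼 u, f (H ω u)) ^ 2 ≤ 1 / (Fintype.card β : ℝ) := by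
  classical
  have e : ∀ ω, (𝔼 u, f (H ω u)) ^ 2 = 𝔼 u, 𝔼 u', f (H ω u) * f (H ω u') := by
    intro ω
    rw [sq, Fintype.expect_mul_expect]
  have hpair : ∀ u u', 𝔼 ω, f (H ω u) * f (H ω u') ≤ if u = u' then 1 else 0 := by
    intro u u'
    split_ifs with h
    · subst h
      refine avg_le_of_le fun ω => ?_
      rw [← sq, ← sq_abs]
      exact pow_le_one₀ (abs_nonneg _) (hf1 _)
    · have := hH.pair u u' h fun p => f p.1 * f p.2
      rw [this, avg_prod' fun a b => f a * f b, ← Fintype.expect_mul_expect, hf0, zero_mul]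
  calc 𝔼 ω, (𝔼 u, f (H ω u)) ^ 2 = 𝔼 u, 𝔼 u', 𝔼 ω, f (H ω u) * f (H ω u') := by
        simp only [e]
        rw [avg_comm]
        refine Finset.expect_congr rfl fun u _ => ?_
        rw [avg_comm]
    _ ≤ 𝔼 u : β, 𝔼 u', if u = u' then (1 : ℝ) else 0 :=
        avg_mono fun u => avg_mono fun u' => hpair u u'
    _ = 1 / (Fintype.card β : ℝ) := by
        simp

lemma PairIndep.abs_sub_le {H : Ω → β → X} (hH : PairIndep H) {B : X → ℝ}
    (h0 : ∀ x, 0 ≤ B x) (h1 : ∀ x, B x ≤ 1) :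
    𝔼 ω, |(𝔼 u, B (H ω u)) - 𝔼 x, B x| ≤ √(1 / (Fintype.card β : ℝ)) := by
  set μ := 𝔼 x, B x with hμ
  have hμ0 : 0 ≤ μ := avg_nonneg h0
  have hμ1 : μ ≤ 1 := avg_le_of_le h1
  have hv := hH.variance_le (f := fun x => B x - μ)
    (by rw [Finset.expect_sub_distrib, Fintype.expect_const, ← hμ, sub_self])
    (fun x => abs_le.2 ⟨by linarith [h0 x], by linarith [h1 x]⟩)
  refine Real.le_sqrt_of_sq_le ((avg_sq_le _).trans ?_)
  refine le_trans (le_of_eq (Finset.expect_congr rfl fun ω _ => ?_)) hv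
  rw [sq_abs, Finset.expect_sub_distrib, Fintype.expect_const]

/-- A set recognized with `S` states is, for a cut behind the first symbol, a disjoint union of `S`
combinatorial rectangles. -/
lemma SmallSpace.exists_rectangles {W S : ℕ} {E : Set (Fin (W + 1) → X)}
    (h : SmallSpace Fin.val S E) :
    ∃ (A : Fin S → Set X) (C : Fin S → Set (Fin W → X)), ∀ a y,
      ind (Fin.cons a y ∈ E) = ∑ q, ind (a ∈ A q) * ind (y ∈ C q) := by
  obtain ⟨st, hst⟩ := h 1
  have hsp : ∀ (a a' : X) (y y' : Fin W → X),
      splice Fin.val 1 (Fin.cons a y : Fin (W + 1) → X) (Fin.cons a' y') = Fin.cons a y' := by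
    intro a a' y y'
    funext i
    refine Fin.cases ?_ (fun j => ?_) i <;> simp [splice]
  refine ⟨fun q => {a | ∃ y, (Fin.cons a y : Fin (W + 1) → X) ∈ E ∧ st (Fin.cons a y) = q},
    fun q => {y | ∃ a, (Fin.cons a y : Fin (W + 1) → X) ∈ E ∧ st (Fin.cons a y) = q}, fun a y => ?_⟩
  have key : ∀ q, ((∃ y', (Fin.cons a y' : Fin (W + 1) → X) ∈ E ∧ st (Fin.cons a y') = q) ∧
      ∃ a', (Fin.cons a' y : Fin (W + 1) → X) ∈ E ∧ st (Fin.cons a' y) = q) ↔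
      ((Fin.cons a y : Fin (W + 1) → X) ∈ E ∧ st (Fin.cons a y) = q) := by
    intro q
    constructor
    · rintro ⟨⟨y', hy', hq⟩, a', ha', hq'⟩
      have := hst _ hy' _ ha' (hq.trans hq'.symm)
      rw [hsp] at this
      exact ⟨this.1, this.2.trans hq⟩
    · rintro ⟨h1, h2⟩
      exact ⟨⟨y, h1, h2⟩, a, h1, h2⟩
  simp only [← ind_and, Set.mem_ofPred_eq, key]
  rw [Finset.sum_eq_single (st (Fin.cons a y))]
  · simp
  · intro q _ hq
    exact ind_false fun h => hq h.2.symm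
  · simp

/-- One level of the generator: the start points of the `W` segments are replaced by the values of
one random function at `W` independent points. -/
lemma PairIndep.fools {H : Ω → β → X} (hH : PairIndep H) {S : ℕ} :
    ∀ {W : ℕ} {E : Set (Fin W → X)}, SmallSpace Fin.val S E →
      |(𝔼 ω, 𝔼 u : Fin W → β, ind ((fun s => H ω (u s)) ∈ E)) - 𝔼 y, ind (y ∈ E)|
        ≤ W * S * √(1 / (Fintype.card β : ℝ))
  | 0, E, _ => by
    have : ∀ ω (u : Fin 0 → β), (fun s => H ω (u s)) = (Fin.elim0 : Fin 0 → X) :=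
      fun ω u => Subsingleton.elim _ _
    have h2 : ∀ y : Fin 0 → X, y = Fin.elim0 := fun u => Subsingleton.elim _ _
    simp only [this]
    rw [Finset.expect_congr (f := fun y : Fin 0 → X => ind (y ∈ E))
      (g := fun y : Fin 0 → X => ind ((Fin.elim0 : Fin 0 → X) ∈ E)) rfl fun y _ => by rw [h2 y]]
    simp
  | W + 1, E, hE => by
    obtain ⟨A, C, hAC⟩ := hE.exists_rectangles
    set η := √(1 / (Fintype.card β : ℝ))
    have hrec : ∀ a : X, |(𝔼 ω, 𝔼 u : Fin W → β, ind (Fin.cons a (fun s => H ω (u s)) ∈ E)) -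
        𝔼 y : Fin W → X, ind (Fin.cons a y ∈ E)| ≤ W * S * η := by
      intro a
      refine PairIndep.fools (W := W) (E := {y | (Fin.cons a y : Fin (W + 1) → X) ∈ E}) hH ?_
      refine hE.preimage (fun y => (Fin.cons a y : Fin (W + 1) → X)) (fun L => L + 1)
        fun L z z' => ?_
      funext i
      refine Fin.cases ?_ (fun j => ?_) i <;> simp [splice]
    have e1 : (𝔼 ω, 𝔼 u : Fin (W + 1) → β, ind ((fun s => H ω (u s)) ∈ E)) =
        𝔼 ω, ∑ q, (𝔼 u, ind (H ω u ∈ A q)) * 𝔼 u : Fin W → β, ind ((fun s => H ω (u s)) ∈ C q) := by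
      refine Finset.expect_congr rfl fun ω _ => ?_
      rw [avg_cons]
      have : ∀ (u₀ : β) (u : Fin W → β), (fun s : Fin (W + 1) =>
          H ω ((Fin.cons u₀ u : Fin (W + 1) → β) s)) = Fin.cons (H ω u₀) (fun s => H ω (u s)) := by
        intro u₀ u
        funext i
        refine Fin.cases ?_ (fun j => ?_) i <;> simp
      simp only [this, hAC, Finset.expect_sum_comm]
      refine Finset.sum_congr rfl fun q _ => ?_
      rw [Fintype.expect_mul_expect]
    have e2 : (𝔼 a, 𝔼 ω, 𝔼 u : Fin W → β, ind (Fin.cons a (fun s => H ω (u s)) ∈ E)) =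
        𝔼 ω, ∑ q, (𝔼 a, ind (a ∈ A q)) * 𝔼 u : Fin W → β, ind ((fun s => H ω (u s)) ∈ C q) := by
      rw [avg_comm]
      refine Finset.expect_congr rfl fun ω _ => ?_
      simp only [hAC, Finset.expect_sum_comm]
      refine Finset.sum_congr rfl fun q _ => ?_
      rw [Fintype.expect_mul_expect]
    have hfirst : |(𝔼 ω, 𝔼 u : Fin (W + 1) → β, ind ((fun s => H ω (u s)) ∈ E)) -
        𝔼 a, 𝔼 ω, 𝔼 u : Fin W → β, ind (Fin.cons a (fun s => H ω (u s)) ∈ E)| ≤ S * η := by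
      rw [e1, e2, ← Finset.expect_sub_distrib]
      refine (abs_avg_le _).trans ?_
      calc 𝔼 ω, |(∑ q, (𝔼 u, ind (H ω u ∈ A q)) * 𝔼 u : Fin W → β, ind ((fun s => H ω (u s)) ∈ C q))
              - ∑ q, (𝔼 a, ind (a ∈ A q)) * 𝔼 u : Fin W → β, ind ((fun s => H ω (u s)) ∈ C q)|
          ≤ 𝔼 ω, ∑ q, |(𝔼 u, ind (H ω u ∈ A q)) - 𝔼 a, ind (a ∈ A q)| := by
            refine avg_mono fun ω => ?_
            rw [← Finset.sum_sub_distrib]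
            refine (Finset.abs_sum_le_sum_abs _ _).trans (Finset.sum_le_sum fun q _ => ?_)
            rw [← sub_mul, abs_mul]
            refine mul_le_of_le_one_right (abs_nonneg _) ?_
            rw [abs_of_nonneg (avg_nonneg fun _ => ind_nonneg _)]
            exact avg_le_of_le fun _ => ind_le_one _
        _ = ∑ q, 𝔼 ω, |(𝔼 u, ind (H ω u ∈ A q)) - 𝔼 a, ind (a ∈ A q)| := Finset.expect_sum_comm _ _ _
        _ ≤ ∑ _q : Fin S, η := Finset.sum_le_sum fun q _ =>
            hH.abs_sub_le (B := fun x => ind (x ∈ A q)) (fun _ => ind_nonneg _) fun _ => ind_le_one _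
        _ = S * η := by simp
    have hsecond : |(𝔼 a, 𝔼 ω, 𝔼 u : Fin W → β, ind (Fin.cons a (fun s => H ω (u s)) ∈ E)) -
        𝔼 y, ind (y ∈ E)| ≤ W * S * η := by
      rw [avg_cons, ← Finset.expect_sub_distrib]
      exact (abs_avg_le _).trans (avg_le_of_le hrec)
    calc _ ≤ S * η + W * S * η := (_root_.abs_sub_le _ _ _).trans (add_le_add hfirst hsecond)
      _ = ((W + 1 : ℕ) : ℝ) * S * η := by push_cast; ring

/-- Independent copies of a pairwise independent random function form one with values in the power
of its codomain. -/
lemma PairIndep.pi {H : Ω → β → X} (hH : PairIndep H) (b : ℕ) :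
    PairIndep fun (ω : Fin b → Ω) u (j : Fin b) => H (ω j) u where
  single u := (hH.single u).pi b
  pair u u' h := by
    have := (uniformMap_equiv (Equiv.arrowProdEquivProdArrow (Fin b) (fun _ => X) (fun _ => X))).comp
      ((hH.pair u u' h).pi b)
    exact this

end SingleLevel

section Tree
variable {P β : Type*} [Fintype P] [Fintype β] [Nonempty P] [Nonempty β]

/-- The lowest `k` base-`b` digits of `J`. -/
def digits {b : ℕ} (hb : 0 < b) (k J : ℕ) : Fin k → Fin b :=
  fun i => ⟨J / b ^ (i : ℕ) % b, Nat.mod_lt _ hb⟩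

/-- The function that the generator iterates, for an arbitrary family of hash functions. -/
def genTree {b : ℕ} : {k : ℕ} → (Fin k → Fin b → β → β) → β → (Fin k → Fin b) → β
  | 0, _, x, _ => x
  | k + 1, h, x, j =>
      genTree (fun i => h i.castSucc) (h (Fin.last k) (j (Fin.last k)) x) (fun i => j i.castSucc)

lemma gen_eq_genTree {b n : ℕ} : ∀ {k : ℕ} (h : Fin k → Fin b → BitVec n → BitVec n) (x : BitVec n)
    (j : Fin k → Fin b), gen h x j = genTree h x j
  | 0, _, _, _ => rfl
  | k + 1, h, _, j => gen_eq_genTree (k := k) (fun i => h i.castSucc) _ (fun i => j i.castSucc)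

/-- The string that consists of `W` segments of `b ^ k` blocks; all segments use the hash functions
`h`, and segment `s` has the start block `u s`.  Behind the last segment the string is constant. -/
noncomputable def forest {b : ℕ} (hb : 0 < b) (k W : ℕ) (h : Fin k → Fin b → β → β)
    (u : Fin W → β) : ℕ → β :=
  fun J => if hJ : J / b ^ k < W then genTree h (u ⟨J / b ^ k, hJ⟩) (digits hb k J)
    else Classical.arbitrary β

lemma forest_zero {b : ℕ} (hb : 0 < b) (W : ℕ) (h : Fin 0 → Fin b → β → β) (u : Fin W → β) :
    forest hb 0 W h u = fun J => if hJ : J < W then u ⟨J, hJ⟩ else Classical.arbitrary β := by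
  funext J
  simp [forest, genTree]

/-- The topmost level splits each segment into `b` segments. -/
lemma forest_succ {b : ℕ} (hb : 0 < b) (k W : ℕ) (h : Fin (k + 1) → Fin b → β → β)
    (u : Fin W → β) :
    forest hb (k + 1) W h u = forest hb k (W * b) (fun i => h i.castSucc)
      (fun s => h (Fin.last k) (finProdFinEquiv.symm s).2 (u (finProdFinEquiv.symm s).1)) := by
  funext J
  have hd : J / b ^ (k + 1) = J / b ^ k / b := by rw [pow_succ, Nat.div_div_eq_div_mul]
  have hlt : J / b ^ (k + 1) < W ↔ J / b ^ k < W * b := by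
    rw [hd, Nat.div_lt_iff_lt_mul hb]
  unfold forest
  by_cases hJ : J / b ^ (k + 1) < W
  · rw [dif_pos hJ, dif_pos (hlt.1 hJ)]
    have e1 : (finProdFinEquiv.symm (⟨J / b ^ k, hlt.1 hJ⟩ : Fin (W * b))).1 = ⟨J / b ^ (k + 1), hJ⟩ :=
      Fin.ext (by simp [finProdFinEquiv, Fin.divNat, hd])
    have e2 : (finProdFinEquiv.symm (⟨J / b ^ k, hlt.1 hJ⟩ : Fin (W * b))).2 =
        digits hb (k + 1) J (Fin.last k) :=
      Fin.ext (by simp [finProdFinEquiv, Fin.modNat, digits])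
    simp only [e1, e2]
    rfl
  · rw [dif_neg hJ, dif_neg (fun h => hJ (hlt.2 h))]

/-- The forest carries cuts between start blocks to cuts between segments. -/
lemma forest_splice {b : ℕ} (hb : 0 < b) (k W : ℕ) (h : Fin k → Fin b → β → β) (L : ℕ)
    (u u' : Fin W → β) :
    forest hb k W h (splice Fin.val L u u') =
      splice id (L * b ^ k) (forest hb k W h u) (forest hb k W h u') := by
  funext J
  simp only [forest, splice, id, ← Nat.div_lt_iff_lt_mul (pow_pos hb k)]
  split_ifs <;> rfl

/-- The generator fools every set that is recognized with `S` states. -/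
theorem forest_fools {b : ℕ} (hb : 0 < b) {H : P → β → β} (hH : PairIndep H) {S : ℕ}
    {E : Set (ℕ → β)} (hE : SmallSpace id S E) : ∀ (k W : ℕ),
      |(𝔼 ω : Fin k → Fin b → P, 𝔼 u, ind (forest hb k W (fun i j => H (ω i j)) u ∈ E)) -
        𝔼 u, ind (forest hb 0 (W * b ^ k) (fun i => i.elim0) u ∈ E)|
        ≤ (∑ m ∈ Finset.range k, W * b ^ m : ℕ) * S * √(1 / (Fintype.card β : ℝ))
  | 0, W => by
    have h1 : (𝔼 ω : Fin 0 → Fin b → P, 𝔼 u, ind (forest hb 0 W (fun i j => H (ω i j)) u ∈ E)) =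
        𝔼 u, ind (forest hb 0 W (fun i => i.elim0) u ∈ E) := by
      simp only [forest_zero]
      exact Fintype.expect_const _
    have h2 : ∀ V, V = W → (𝔼 u, ind (forest hb 0 W (fun i => i.elim0) u ∈ E)) =
        𝔼 u, ind (forest (β := β) hb 0 V (fun i => i.elim0) u ∈ E) := by
      rintro V rfl; rfl
    rw [h1, h2 (W * b ^ 0) (by simp)]
    simp
  | k + 1, W => by
    set η := √(1 / (Fintype.card β : ℝ))
    have ih := forest_fools hb hH hE k (W * b)
    have hfin : (𝔼 u, ind (forest hb 0 (W * b * b ^ k) (fun i => i.elim0) u ∈ E)) =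
        𝔼 u, ind (forest hb 0 (W * b ^ (k + 1)) (fun i => i.elim0) u ∈ E) := by
      rw [show W * b * b ^ k = W * b ^ (k + 1) by ring]
    rw [hfin] at ih
    -- the regrouping of the start blocks into `W` groups of `b`
    let e : (Fin W → Fin b → β) ≃ (Fin (W * b) → β) :=
      (Equiv.curry (Fin W) (Fin b) β).symm.trans (Equiv.arrowCongr finProdFinEquiv (Equiv.refl β))
    have he : ∀ y s, e y s = y (finProdFinEquiv.symm s).1 (finProdFinEquiv.symm s).2 := fun _ _ => rfl
    have hstep : ∀ ω : Fin k → Fin b → P,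
        |(𝔼 ω' : Fin b → P, 𝔼 u : Fin W → β, ind (e (fun s j => H (ω' j) (u s)) ∈
            {v | forest hb k (W * b) (fun i j => H (ω i j)) v ∈ E})) -
          𝔼 v, ind (forest hb k (W * b) (fun i j => H (ω i j)) v ∈ E)| ≤ W * S * η := by
      intro ω
      have hsm : SmallSpace Fin.val S
          {y : Fin W → Fin b → β | forest hb k (W * b) (fun i j => H (ω i j)) (e y) ∈ E} := by
        refine hE.preimage (fun y => forest hb k (W * b) (fun i j => H (ω i j)) (e y))
          (fun L => L * b * b ^ k) fun L y y' => ?_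
        rw [← forest_splice]
        congr 1
        funext s
        have hs : ((finProdFinEquiv.symm s).1 : ℕ) < L ↔ (s : ℕ) < L * b := by
          rw [← Nat.div_lt_iff_lt_mul hb]; rfl
        simp only [he, splice, hs]
        split_ifs <;> rfl
      have := (hH.pi b).fools hsm
      rw [← Fintype.expect_equiv e (fun y => ind (forest hb k (W * b) (fun i j => H (ω i j)) (e y) ∈ E))
        (fun v => ind (forest hb k (W * b) (fun i j => H (ω i j)) v ∈ E)) fun _ => rfl]
      exact this
    have hsplit : (𝔼 ω : Fin (k + 1) → Fin b → P, 𝔼 u,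
          ind (forest hb (k + 1) W (fun i j => H (ω i j)) u ∈ E)) =
        𝔼 ω : Fin k → Fin b → P, 𝔼 ω' : Fin b → P, 𝔼 u : Fin W → β,
          ind (e (fun s j => H (ω' j) (u s)) ∈
            {v | forest hb k (W * b) (fun i j => H (ω i j)) v ∈ E}) := by
      rw [avg_snoc, avg_comm]
      refine Finset.expect_congr rfl fun ω _ => ?_
      refine Finset.expect_congr rfl fun ω' _ => ?_
      refine Finset.expect_congr rfl fun u _ => ?_
      rw [forest_succ]
      simp only [Fin.snoc_castSucc, Fin.snoc_last, Set.mem_ofPred_eq]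
      rfl
    have hfirst : |(𝔼 ω : Fin (k + 1) → Fin b → P, 𝔼 u,
          ind (forest hb (k + 1) W (fun i j => H (ω i j)) u ∈ E)) -
        𝔼 ω : Fin k → Fin b → P, 𝔼 v, ind (forest hb k (W * b) (fun i j => H (ω i j)) v ∈ E)|
        ≤ W * S * η := by
      rw [hsplit, ← Finset.expect_sub_distrib]
      exact (abs_avg_le _).trans (avg_le_of_le hstep)
    refine (abs_sub_le _ _ _).trans ((add_le_add hfirst ih).trans (le_of_eq ?_))
    rw [Finset.sum_range_succ']
    simp only [pow_succ', ← mul_assoc]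
    push_cast
    ring

end Tree

lemma sum_range_pow_le {b : ℕ} (hb : 2 ≤ b) (k : ℕ) : ∑ m ∈ Finset.range k, b ^ m ≤ b ^ k := by
  induction k with
  | zero => simp
  | succ k ih =>
    rw [Finset.sum_range_succ, pow_succ]
    nlinarith [pow_pos (by omega : 0 < b) k]

lemma multShift_pairIndep (n : ℕ) :
    PairIndep fun (p : BitVec (2 * n) × BitVec (2 * n)) (x : BitVec n) => multShift p.1 p.2 x where
  single := multShift_single
  pair _ _ := multShift_pair

/-- A finite string, extended by a constant. -/
noncomputable def extend {β : Type*} [Nonempty β] {D : ℕ} (u : Fin D → β) : ℕ → β :=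
  fun J => if hJ : J < D then u ⟨J, hJ⟩ else Classical.arbitrary β

/-- FastPRG fools every set of strings that is recognized with `S` states. -/
theorem fastPRG_fools {n b : ℕ} (hb : 2 ≤ b) (k : ℕ) {S : ℕ} {E : Set (ℕ → BitVec n)}
    (hE : SmallSpace id S E)
    (hdep : ∀ z z' : ℕ → BitVec n, (∀ J < b ^ k, z J = z' J) → z ∈ E → z' ∈ E) :
    prob {σ : Seed n b k | fastPRG σ ∈ E} ≤
      (𝔼 u : Fin (b ^ k) → BitVec n, ind (extend u ∈ E)) +
        (b ^ k : ℕ) * S * √(1 / ((2 : ℝ) ^ n)) := by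
  have hb0 : 0 < b := by omega
  have hmain := forest_fools hb0 (multShift_pairIndep n) hE k 1
  have hcard : (Fintype.card (BitVec n) : ℝ) = 2 ^ n := by
    rw [← Nat.card_eq_fintype_card, Nat.card_congr (BitVec.equivFin (m := n)).toEquiv]
    simp
  have hdig : ∀ J (hJ : J < b ^ k), finFunctionFinEquiv.symm ⟨J, hJ⟩ = digits hb0 k J := by
    intro J hJ
    funext i
    rfl
  have hprg : ∀ σ : Seed n b k, fastPRG σ ∈ E ↔
      forest hb0 k 1 (fun i j => fun x => multShift (σ.2 i j).1 (σ.2 i j).2 x) (fun _ => σ.1) ∈ E := by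
    intro σ
    have heq : ∀ J < b ^ k, fastPRG σ J =
        forest hb0 k 1 (fun i j => fun x => multShift (σ.2 i j).1 (σ.2 i j).2 x) (fun _ => σ.1) J := by
      intro J hJ
      have h0 : J / b ^ k < 1 := by rw [Nat.div_eq_of_lt hJ]; norm_num
      rw [fastPRG, dif_pos hJ, forest, dif_pos h0, gen_eq_genTree, hdig]
    exact ⟨hdep _ _ heq, hdep _ _ fun J hJ => (heq J hJ).symm⟩
  have e1 : prob {σ : Seed n b k | fastPRG σ ∈ E} =
      𝔼 ω : Fin k → Fin b → BitVec (2 * n) × BitVec (2 * n), 𝔼 u : Fin 1 → BitVec n,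
        ind (forest hb0 k 1 (fun i j => (fun x => multShift (ω i j).1 (ω i j).2 x)) u ∈ E) := by
    rw [prob_eq_expect, avg_prod, avg_comm]
    refine Finset.expect_congr rfl fun ω _ => ?_
    refine Fintype.expect_equiv (Equiv.funUnique (Fin 1) (BitVec n)).symm _ _ fun x => ?_
    rw [Set.mem_ofPred_eq, hprg]
    rfl
  have e2 : (𝔼 u, ind (forest hb0 0 (1 * b ^ k) (fun i => i.elim0) u ∈ E)) =
      𝔼 u : Fin (b ^ k) → BitVec n, ind (extend u ∈ E) := by
    rw [one_mul]
    simp only [forest_zero]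
    rfl
  rw [← e1, e2, hcard] at hmain
  have h3 := (abs_le.1 hmain).2
  have h4 : ((∑ m ∈ Finset.range k, 1 * b ^ m : ℕ) : ℝ) * S * √(1 / ((2 : ℝ) ^ n)) ≤
      (b ^ k : ℕ) * S * √(1 / ((2 : ℝ) ^ n)) := by
    gcongr
    simpa using sum_range_pow_le hb k
  linarith

/-! ### The test for a wrong estimate needs little space -/

lemma SmallSpace.of_finset {ι X Q : Type*} {pos : ι → ℕ} {S : ℕ} {E : Set (ι → X)}
    (h : ∀ L, ∃ (F : Finset Q) (st : (ι → X) → Q), F.card ≤ S ∧ (∀ z, st z ∈ F) ∧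
      ∀ z ∈ E, ∀ z' ∈ E, st z = st z' → splice pos L z z' ∈ E ∧ st (splice pos L z z') = st z) :
    SmallSpace pos S E := by
  intro L
  obtain ⟨F, st, hF, hmem, hst⟩ := h L
  have hinj : ∀ z z', Fin.castLE hF (F.equivFin ⟨st z, hmem z⟩) =
      Fin.castLE hF (F.equivFin ⟨st z', hmem z'⟩) ↔ st z = st z' := by
    intro z z'
    rw [Fin.castLE_inj, F.equivFin.apply_eq_iff_eq, Subtype.mk.injEq]
  refine ⟨fun z => Fin.castLE hF (F.equivFin ⟨st z, hmem z⟩), fun z hz z' hz' h => ?_⟩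
  have := hst z hz z' hz' ((hinj _ _).1 h)
  exact ⟨this.1, (hinj _ _).2 this.2⟩

section RowTest
variable {β Γ : Type*} (ty : β → Γ) (κ : Γ → Γ → ℤ) (x : ℕ → ℤ) (d ℓ : ℕ)

/-- The contribution of the first `m` coordinates to the estimate of coordinate `ℓ` by row `i`.
A block `v` is used through its type `ty v` only, and `κ` is the interaction of the types of two
coordinates. -/
def rowPartial (z : ℕ → β) (i m : ℕ) : ℤ :=
  ∑ ρ ∈ Finset.range m, κ (ty (z (i * d + ℓ))) (ty (z (i * d + ρ))) * x ρ

open Classical in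
/-- The number of rows among the first `m` whose estimate of coordinate `ℓ` is in `B`. -/
noncomputable def rowCount (B : Set ℤ) (z : ℕ → β) (m : ℕ) : ℕ :=
  Nat.count (fun i => rowPartial ty κ x d ℓ z i d ∈ B) m

variable {ty κ x d ℓ}

lemma abs_rowPartial_le {M : ℕ} (hκ : ∀ γ γ', |κ γ γ'| ≤ 1) (hx : ∀ ρ, |x ρ| ≤ M)
    (z : ℕ → β) (i m : ℕ) : |rowPartial ty κ x d ℓ z i m| ≤ m * M := by
  refine (Finset.abs_sum_le_sum_abs _ _).trans ?_
  calc _ ≤ ∑ _ρ ∈ Finset.range m, (M : ℤ) := Finset.sum_le_sum fun ρ _ => by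
        rw [abs_mul]
        exact (mul_le_of_le_one_left (abs_nonneg _) (hκ _ _)).trans (hx ρ)
    _ = m * M := by simp

lemma rowCount_congr (B : Set ℤ) {z z' : ℕ → β} {m : ℕ}
    (h : ∀ i < m, rowPartial ty κ x d ℓ z i d = rowPartial ty κ x d ℓ z' i d) :
    rowCount ty κ x d ℓ B z m = rowCount ty κ x d ℓ B z' m := by
  classical
  have : ∀ a, a ≤ m → rowCount ty κ x d ℓ B z a = rowCount ty κ x d ℓ B z' a := by
    intro a
    induction a with
    | zero => simp [rowCount]
    | succ a ih =>
      intro ha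
      have := ih (by omega)
      simp only [rowCount, Nat.count_succ] at this ⊢
      rw [this, h a (by omega)]
  exact this m le_rfl

lemma rowPartial_congr {z z' : ℕ → β} {i m : ℕ}
    (hℓ : ty (z (i * d + ℓ)) = ty (z' (i * d + ℓ)))
    (h : ∀ ρ < m, z (i * d + ρ) = z' (i * d + ρ)) :
    rowPartial ty κ x d ℓ z i m = rowPartial ty κ x d ℓ z' i m :=
  Finset.sum_congr rfl fun ρ hρ => by rw [hℓ, h ρ (Finset.mem_range.1 hρ)]

/-- Whether at least `θ` of `r` rows have an estimate in `B` is recognized in small space.  In the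
middle of a row the state consists of the number of finished rows with an estimate in `B`, of the
type of coordinate `ℓ` in the current row (which has to be guessed if coordinate `ℓ` is still to
come), and of the current partial sum. -/
theorem rowTest_smallSpace [Fintype Γ] {M : ℕ} (hκ : ∀ γ γ', |κ γ γ'| ≤ 1) (hx : ∀ ρ, |x ρ| ≤ M)
    (hℓ : ℓ < d) (B : Set ℤ) (r θ : ℕ) :
    SmallSpace id ((r + 1) * Fintype.card Γ * (2 * (d * M) + 1))
      {z : ℕ → β | θ ≤ rowCount ty κ x d ℓ B z r} := by
  classical
  refine SmallSpace.of_finset (Q := ℕ × Γ × ℤ) fun L => ?_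
  by_cases hr : r * d ≤ L
  · by_cases hne : Nonempty Γ
    · obtain ⟨γ⟩ := hne
      refine ⟨{(0, γ, 0)}, fun _ => (0, γ, 0), ?_, by simp, fun z hz z' _ _ => ⟨?_, rfl⟩⟩
      · rw [Finset.card_singleton]
        have : 0 < Fintype.card Γ := Fintype.card_pos_iff.2 ⟨γ⟩
        exact Nat.succ_le_of_lt (by positivity)
      · simp only [Set.mem_ofPred_eq] at hz ⊢
        refine hz.trans (le_of_eq (rowCount_congr B fun i hi => ?_))
        have hlt : ∀ ρ < d, i * d + ρ < L := fun ρ hρ => by nlinarith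
        have hs : ∀ ρ < d, z (i * d + ρ) = splice id L z z' (i * d + ρ) := fun ρ hρ => by
          simp [splice, hlt ρ hρ]
        exact rowPartial_congr (by rw [hs ℓ hℓ]) hs
    · have : IsEmpty β := ⟨fun v => hne ⟨ty v⟩⟩
      exact ⟨∅, fun z => isEmptyElim (z 0), by simp, fun z => isEmptyElim (z 0),
        fun z => isEmptyElim (z 0)⟩
  · have hd : 0 < d := by omega
    set i₀ := L / d with hi₀
    set m₀ := L % d with hm₀
    have hL : i₀ * d + m₀ = L := by rw [mul_comm]; exact Nat.div_add_mod L d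
    have hm₀d : m₀ < d := Nat.mod_lt _ hd
    have hi₀r : i₀ < r := Nat.div_lt_of_lt_mul (by rw [mul_comm]; omega)
    refine ⟨Finset.range (r + 1) ×ˢ Finset.univ ×ˢ Finset.Icc (-((d * M : ℕ) : ℤ)) ((d * M : ℕ) : ℤ),
      fun z => (rowCount ty κ x d ℓ B z i₀, ty (z (i₀ * d + ℓ)), rowPartial ty κ x d ℓ z i₀ m₀),
      ?_, ?_, ?_⟩
    · simp only [Finset.card_product, Finset.card_range, Finset.card_univ, Int.card_Icc]
      rw [mul_assoc]
      gcongr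
      omega
    · intro z
      simp only [Finset.mem_product, Finset.mem_range, Finset.mem_univ, Finset.mem_Icc, true_and]
      refine ⟨?_, ?_⟩
      · have : rowCount ty κ x d ℓ B z i₀ ≤ i₀ := Nat.count_le _
        omega
      · rw [← abs_le]
        refine (abs_rowPartial_le hκ hx z i₀ m₀).trans ?_
        push_cast
        gcongr
    · intro z _ z' hz' hst
      simp only [Prod.mk.injEq] at hst
      obtain ⟨hst1, hst2, hst3⟩ := hst
      set y := splice id L z z' with hy
      have hyz : ∀ J < L, y J = z J := fun J hJ => by simp [hy, splice, hJ]
      have hyz' : ∀ J, L ≤ J → y J = z' J := fun J hJ => by simp [hy, splice, not_lt.2 hJ]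
      have hty : ty (y (i₀ * d + ℓ)) = ty (z (i₀ * d + ℓ)) := by
        rcases lt_or_ge (i₀ * d + ℓ) L with h | h
        · rw [hyz _ h]
        · rw [hyz' _ h, hst2]
      have hbefore : rowCount ty κ x d ℓ B y i₀ = rowCount ty κ x d ℓ B z i₀ := by
        refine rowCount_congr B fun i hi => ?_
        have hs : ∀ ρ < d, y (i * d + ρ) = z (i * d + ρ) := fun ρ hρ => hyz _ (by nlinarith)
        exact rowPartial_congr (by rw [hs ℓ hℓ]) hs
      have hpart : rowPartial ty κ x d ℓ y i₀ m₀ = rowPartial ty κ x d ℓ z i₀ m₀ :=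
        rowPartial_congr hty fun ρ hρ => hyz _ (by omega)
      refine ⟨?_, by simp only [hbefore, hty, hpart]⟩
      have hcur : rowPartial ty κ x d ℓ y i₀ d = rowPartial ty κ x d ℓ z' i₀ d := by
        have hsplit : ∀ v : ℕ → β, rowPartial ty κ x d ℓ v i₀ d = rowPartial ty κ x d ℓ v i₀ m₀ +
            ∑ ρ ∈ Finset.Ico m₀ d, κ (ty (v (i₀ * d + ℓ))) (ty (v (i₀ * d + ρ))) * x ρ := fun v =>
          (Finset.sum_range_add_sum_Ico _ hm₀d.le).symm
        rw [hsplit, hsplit, hpart, hst3]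
        congr 1
        refine Finset.sum_congr rfl fun ρ hρ => ?_
        rw [hty, hst2, hyz' _ (by have := (Finset.mem_Ico.1 hρ).1; omega)]
      have hall : ∀ i, i₀ ≤ i → rowPartial ty κ x d ℓ y i d = rowPartial ty κ x d ℓ z' i d := by
        intro i hi
        rcases hi.eq_or_lt with rfl | hi
        · exact hcur
        · have hs : ∀ ρ < d, y (i * d + ρ) = z' (i * d + ρ) := fun ρ _ => hyz' _ (by nlinarith)
          exact rowPartial_congr (by rw [hs ℓ hℓ]) hs
      have hcount : rowCount ty κ x d ℓ B y r = rowCount ty κ x d ℓ B z' r := by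
        obtain ⟨e, rfl⟩ := Nat.exists_eq_add_of_le hi₀r.le
        have h1 := hbefore.trans hst1
        simp only [rowCount] at h1 ⊢
        rw [Nat.count_add, Nat.count_add, h1]
        congr 1
        simp only [hall _ (Nat.le_add_right _ _)]
      simp only [Set.mem_ofPred_eq] at hz' ⊢
      rwa [hcount]

end RowTest

/-! ### Lazy random walks -/

/-- `lazyWalk p x φ v` is the expectation of `φ (v + ∑ j, ξ j * x j)` for independent `ξ j` that are
`1` and `-1` with probability `p` each, and `0` otherwise. -/
noncomputable def lazyWalk (p : ℝ) : {m : ℕ} → (Fin m → ℝ) → (ℝ → ℝ) → ℝ → ℝ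
  | 0, _, φ, v => φ v
  | _ + 1, x, φ, v => (1 - 2 * p) * lazyWalk p (fun j => x j.succ) φ v +
      p * lazyWalk p (fun j => x j.succ) φ (v + x 0) +
      p * lazyWalk p (fun j => x j.succ) φ (v - x 0)

lemma lazyWalk_const (p c : ℝ) : ∀ {m : ℕ} (x : Fin m → ℝ) (v : ℝ), lazyWalk p x (fun _ => c) v = c
  | 0, _, _ => rfl
  | m + 1, x, v => by
    simp only [lazyWalk, lazyWalk_const p c (m := m)]; ring

lemma lazyWalk_add (p : ℝ) (φ ψ : ℝ → ℝ) : ∀ {m : ℕ} (x : Fin m → ℝ) (v : ℝ),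
    lazyWalk p x (fun u => φ u + ψ u) v = lazyWalk p x φ v + lazyWalk p x ψ v
  | 0, _, _ => rfl
  | m + 1, x, v => by
    simp only [lazyWalk, lazyWalk_add p φ ψ (m := m)]; ring

lemma lazyWalk_neg (p : ℝ) (φ : ℝ → ℝ) : ∀ {m : ℕ} (x : Fin m → ℝ) (v : ℝ),
    lazyWalk p x (fun u => φ (-u)) v = lazyWalk p x φ (-v)
  | 0, _, _ => rfl
  | m + 1, x, v => by
    simp only [lazyWalk, lazyWalk_neg p φ (m := m)]
    rw [show -(v + x 0) = -v - x 0 by ring, show -(v - x 0) = -v + x 0 by ring]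
    ring

lemma lazyWalk_nonneg {p : ℝ} (hp : 0 ≤ p) (hp' : 2 * p ≤ 1) {φ : ℝ → ℝ} (hφ : ∀ u, 0 ≤ φ u) :
    ∀ {m : ℕ} (x : Fin m → ℝ) (v : ℝ), 0 ≤ lazyWalk p x φ v
  | 0, _, v => hφ v
  | m + 1, x, v => by
    have h := lazyWalk_nonneg hp hp' hφ (fun j : Fin m => x j.succ)
    have := h v
    have := h (v + x 0)
    have := h (v - x 0)
    have : 0 ≤ 1 - 2 * p := by linarith
    simp only [lazyWalk]
    positivity

lemma lazyWalk_sq (p : ℝ) : ∀ {m : ℕ} (x : Fin m → ℝ) (v : ℝ),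
    lazyWalk p x (fun u => u ^ 2) v = v ^ 2 + 2 * p * ∑ j, x j ^ 2
  | 0, _, v => by simp [lazyWalk]
  | m + 1, x, v => by
    simp only [lazyWalk, lazyWalk_sq p (m := m), Fin.sum_univ_succ]; ring

/-- With probability `(1 - 2 * p) ^ h`, the steps with the `h` indices in `H` are all zero. -/
lemma lazyWalk_ge_of_heads {p : ℝ} (hp : 0 ≤ p) (hp' : 2 * p ≤ 1) {φ : ℝ → ℝ} (hφ : ∀ u, 0 ≤ φ u) :
    ∀ {m : ℕ} (x : Fin m → ℝ) (H : Fin m → Prop) [DecidablePred H] (v : ℝ),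
      (∏ j, if H j then (1 - 2 * p) else 1) * lazyWalk p (fun j => if H j then 0 else x j) φ v
        ≤ lazyWalk p x φ v
  | 0, _, _, _, v => by simp [lazyWalk]
  | m + 1, x, H, _, v => by
    have ih := lazyWalk_ge_of_heads hp hp' hφ (fun j : Fin m => x j.succ) (fun j => H j.succ)
    have h0 := lazyWalk_nonneg hp hp' hφ (fun j : Fin m => x j.succ)
    have hq : 0 ≤ 1 - 2 * p := by linarith
    simp only [lazyWalk, Fin.prod_univ_succ]
    set F := ∏ j : Fin m, if H j.succ then (1 - 2 * p) else 1
    by_cases hH : H 0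
    · simp only [hH, if_true, add_zero, sub_zero]
      have := mul_le_mul_of_nonneg_left (ih v) hq
      have h1 := mul_nonneg hp (h0 (v + x 0))
      have h2 := mul_nonneg hp (h0 (v - x 0))
      linarith
    · simp only [hH, if_false, one_mul]
      have := mul_le_mul_of_nonneg_left (ih v) hq
      have h1 := mul_le_mul_of_nonneg_left (ih (v + x 0)) hp
      have h2 := mul_le_mul_of_nonneg_left (ih (v - x 0)) hp
      linarith

/-- The lazy walk is the difference of two independent copies of a random variable: a step `ξ` is
the difference of two Bernoulli variables with parameter `q`, where `q * (1 - q) = p`. -/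
lemma lazyWalk_eq_difference {p q : ℝ} (hq0 : 0 ≤ q) (hq1 : q ≤ 1) (hpq : q * (1 - q) = p) :
    ∀ {m : ℕ} (x : Fin m → ℝ), ∃ (ι : Type) (_ : Fintype ι) (μ z : ι → ℝ), (∀ i, 0 ≤ μ i) ∧
      ∀ φ v, lazyWalk p x φ v = ∑ i, ∑ j, μ i * μ j * φ (v + z i - z j)
  | 0, _ => ⟨Unit, inferInstance, fun _ => 1, fun _ => 0, by simp, by simp [lazyWalk]⟩
  | m + 1, x => by
    obtain ⟨ι, _, μ, z, hμ, h⟩ := lazyWalk_eq_difference hq0 hq1 hpq (fun j : Fin m => x j.succ)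
    refine ⟨ι ⊕ ι, inferInstance, Sum.elim (fun i => (1 - q) * μ i) (fun i => q * μ i),
      Sum.elim z (fun i => z i + x 0), ?_, fun φ v => ?_⟩
    · rintro (i | i)
      · exact mul_nonneg (by linarith) (hμ i)
      · exact mul_nonneg hq0 (hμ i)
    · simp only [lazyWalk, h, Fintype.sum_sum_type, Sum.elim_inl, Sum.elim_inr, ← Finset.sum_add_distrib,
        Finset.mul_sum]
      refine Finset.sum_congr rfl fun i _ => Finset.sum_congr rfl fun j _ => ?_
      rw [show v + (z i + x 0) - (z j + x 0) = v + z i - z j by ring,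
        show v + z i - (z j + x 0) = v - x 0 + z i - z j by ring,
        show v + (z i + x 0) - z j = v + x 0 + z i - z j by ring, ← hpq]
      ring

/-- Two independent copies of a random variable are close with good probability: by the Chebyshev
inequality both lie in an interval of length `2 * Δ` around the mean, and of the at most `5 / α`
cells of length `α * Δ` that cover it, they lie in the same one with probability at least
`α / 20`. -/
lemma close_of_variance {ι : Type} [Fintype ι] {μ z : ι → ℝ} (hμ : ∀ i, 0 ≤ μ i)
    (hμ1 : ∑ i, μ i = 1) {Δ α : ℝ} (hΔ : 0 < Δ) (hα : 0 < α) (hα1 : α ≤ 1)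
    (hvar : ∑ i, ∑ j, μ i * μ j * (z i - z j) ^ 2 ≤ Δ ^ 2) :
    α / 20 ≤ ∑ i, ∑ j, μ i * μ j * ind (|z i - z j| ≤ α * Δ) := by
  classical
  set c := ∑ i, μ i * z i with hc
  have hvar' : ∑ i, μ i * (z i - c) ^ 2 ≤ Δ ^ 2 / 2 := by
    have e1 : ∑ i, ∑ j, μ i * μ j * (z i - z j) ^ 2 = 2 * (∑ i, μ i * z i ^ 2) - 2 * c ^ 2 := by
      have : ∀ i j, μ i * μ j * (z i - z j) ^ 2 =
          (μ i * z i ^ 2) * μ j + μ i * (μ j * z j ^ 2) - 2 * ((μ i * z i) * (μ j * z j)) := by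
        intro i j; ring
      simp only [this, Finset.sum_sub_distrib, Finset.sum_add_distrib, ← Finset.mul_sum,
        ← Finset.sum_mul, hμ1, ← hc]
      ring
    have e2 : ∑ i, μ i * (z i - c) ^ 2 = (∑ i, μ i * z i ^ 2) - c ^ 2 := by
      have : ∀ i, μ i * (z i - c) ^ 2 = μ i * z i ^ 2 - 2 * c * (μ i * z i) + c ^ 2 * μ i := by
        intro i; ring
      simp only [this, Finset.sum_sub_distrib, Finset.sum_add_distrib, ← Finset.mul_sum,
        hμ1, ← hc]
      ring
    linarith
  set G := Finset.univ.filter fun i => |z i - c| ≤ Δ with hG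
  have hmass : 1 / 2 ≤ ∑ i ∈ G, μ i := by
    have hcheb : (∑ i ∈ Finset.univ.filter (fun i => ¬ |z i - c| ≤ Δ), μ i) * Δ ^ 2 ≤ Δ ^ 2 / 2 := by
      refine le_trans ?_ hvar'
      rw [Finset.sum_mul]
      refine (Finset.sum_le_sum fun i hi => ?_).trans
        (Finset.sum_le_univ_sum_of_nonneg fun i => mul_nonneg (hμ i) (sq_nonneg _))
      have : Δ < |z i - c| := not_le.1 (Finset.mem_filter.1 hi).2
      refine mul_le_mul_of_nonneg_left ?_ (hμ i)
      rw [← sq_abs (z i - c)]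
      exact pow_le_pow_left₀ hΔ.le this.le 2
    have hsplit := Finset.sum_filter_add_sum_filter_not Finset.univ (fun i => |z i - c| ≤ Δ) μ
    have : (∑ i ∈ Finset.univ.filter (fun i => ¬ |z i - c| ≤ Δ), μ i) ≤ 1 / 2 := by
      have h2 : 0 < Δ ^ 2 := by positivity
      nlinarith
    rw [hG]
    linarith
  set cell : ι → ℤ := fun i => ⌊(z i - c) / (α * Δ)⌋ with hcell
  have haΔ : 0 < α * Δ := by positivity
  set T : Finset ℤ := Finset.Icc (-⌈1 / α⌉) ⌈1 / α⌉ with hT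
  have hcT : ∀ i ∈ G, cell i ∈ T := by
    intro i hi
    have h1 : |(z i - c) / (α * Δ)| ≤ 1 / α := by
      rw [abs_div, abs_of_pos haΔ, div_le_div_iff₀ haΔ hα]
      have := (Finset.mem_filter.1 hi).2
      nlinarith
    obtain ⟨h2, h3⟩ := abs_le.1 h1
    have h4 := Int.le_ceil (1 / α)
    rw [hT, Finset.mem_Icc]
    constructor
    · rw [hcell]
      refine Int.le_floor.2 ?_
      push_cast
      linarith
    · have := Int.floor_le ((z i - c) / (α * Δ))
      have h5 : ((cell i : ℤ) : ℝ) ≤ (⌈1 / α⌉ : ℝ) := by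
        simp only [hcell]; linarith
      exact_mod_cast h5
  have hTcard : (T.card : ℝ) ≤ 5 / α := by
    have h0 : 0 ≤ ⌈1 / α⌉ := Int.ceil_nonneg (by positivity)
    rw [hT, Int.card_Icc]
    have h1 : (((⌈1 / α⌉ + 1 - -⌈1 / α⌉).toNat : ℤ) : ℝ) = 2 * (⌈1 / α⌉ : ℝ) + 1 := by
      rw [Int.toNat_of_nonneg (by omega)]; push_cast; ring
    have h1' : (((⌈1 / α⌉ + 1 - -⌈1 / α⌉).toNat : ℕ) : ℝ) = 2 * (⌈1 / α⌉ : ℝ) + 1 := by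
      rw [← h1]; norm_cast
    rw [h1']
    have h2 := (Int.ceil_lt_add_one (1 / α)).le
    have h3 : 1 ≤ 1 / α := by rw [le_div_iff₀ hα]; linarith
    have h4 : 5 / α = 5 * (1 / α) := by ring
    linarith
  set P : ℤ → ℝ := fun a => ∑ i ∈ G with cell i = a, μ i with hP
  have hPsum : ∑ a ∈ T, P a = ∑ i ∈ G, μ i := Finset.sum_fiberwise_of_maps_to hcT μ
  have hsq : (1 / 2) ^ 2 ≤ (5 / α) * ∑ a ∈ T, P a ^ 2 := by
    calc ((1 : ℝ) / 2) ^ 2 ≤ (∑ a ∈ T, P a) ^ 2 := by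
          rw [hPsum]; exact pow_le_pow_left₀ (by norm_num) hmass 2
      _ ≤ T.card * ∑ a ∈ T, P a ^ 2 := sq_sum_le_card_mul_sum_sq
      _ ≤ (5 / α) * ∑ a ∈ T, P a ^ 2 := by
          gcongr
  have hPle : ∑ a ∈ T, P a ^ 2 ≤ ∑ i, ∑ j, μ i * μ j * ind (|z i - z j| ≤ α * Δ) := by
    have e1 : ∀ a, P a ^ 2 = ∑ i ∈ G, ∑ j ∈ G, if cell i = a ∧ cell j = a then μ i * μ j else 0 := by
      intro a
      simp only [hP]
      rw [sq, Finset.sum_filter (fun i => cell i = a) μ, Finset.sum_mul_sum]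
      refine Finset.sum_congr rfl fun i _ => Finset.sum_congr rfl fun j _ => ?_
      by_cases h1 : cell i = a <;> by_cases h2 : cell j = a <;> simp [h1, h2]
    have e2 : ∑ a ∈ T, P a ^ 2 ≤ ∑ i ∈ G, ∑ j ∈ G, if cell i = cell j then μ i * μ j else 0 := by
      simp only [e1]
      rw [Finset.sum_comm]
      refine Finset.sum_le_sum fun i hi => ?_
      rw [Finset.sum_comm]
      refine Finset.sum_le_sum fun j hj => ?_
      rw [Finset.sum_eq_single_of_mem (cell i) (hcT i hi)]
      · split_ifs with h1 h2 h2
        · rfl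
        · exact absurd h1.2.symm h2
        · exact mul_nonneg (hμ i) (hμ j)
        · rfl
      · intro a _ ha
        rw [if_neg fun h => ha h.1.symm]
    refine e2.trans ?_
    have hterm : ∀ i j, 0 ≤ μ i * μ j * ind (|z i - z j| ≤ α * Δ) := fun i j =>
      mul_nonneg (mul_nonneg (hμ i) (hμ j)) (ind_nonneg _)
    refine le_trans (Finset.sum_le_sum fun i _ => ?_)
      (Finset.sum_le_univ_sum_of_nonneg fun i => Finset.sum_nonneg fun j _ => hterm i j)
    refine le_trans (Finset.sum_le_sum fun j _ => ?_)
      (Finset.sum_le_univ_sum_of_nonneg fun j => hterm i j)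
    split_ifs with h
    · rw [ind_true, mul_one]
      have := (Int.abs_sub_lt_one_of_floor_eq_floor h).le
      rw [← sub_div, abs_div, abs_of_pos haΔ, div_le_one haΔ] at this
      simpa using this
    · exact hterm i j
  have h6 : (1 / 2) ^ 2 ≤ (5 / α) * ∑ i, ∑ j, μ i * μ j * ind (|z i - z j| ≤ α * Δ) :=
    hsq.trans (by gcongr)
  rw [div_mul_eq_mul_div, le_div_iff₀ hα] at h6
  linarith

/-- Anti-concentration of a lazy walk around its start point. -/
lemma lazyWalk_small {p : ℝ} (hp : 0 ≤ p) (hp' : 4 * p ≤ 1) {m : ℕ} (x : Fin m → ℝ) {Δ α : ℝ}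
    (hΔ : 0 ≤ Δ) (hα : 0 ≤ α) (hα1 : α ≤ 1) (hvar : 2 * p * ∑ j, x j ^ 2 ≤ Δ ^ 2) :
    α / 20 ≤ lazyWalk p x (fun u => ind (|u| ≤ α * Δ)) 0 := by
  have hroot : (√(1 - 4 * p)) ^ 2 = 1 - 4 * p := Real.sq_sqrt (by linarith)
  have hs0 := Real.sqrt_nonneg (1 - 4 * p)
  have hs1 : √(1 - 4 * p) ≤ 1 := Real.sqrt_le_one.2 (by linarith)
  obtain ⟨ι, _, μ, z, hμ, h⟩ := lazyWalk_eq_difference (p := p) (q := (1 - √(1 - 4 * p)) / 2)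
    (by linarith) (by linarith) (by nlinarith) x
  have hμ1 : ∑ i, μ i = 1 := by
    have h1 := h (fun _ => 1) 0
    rw [lazyWalk_const] at h1
    simp only [mul_one, ← Finset.mul_sum, ← Finset.sum_mul] at h1
    have h2 : 0 ≤ ∑ i, μ i := Finset.sum_nonneg fun i _ => hμ i
    nlinarith
  have hv : ∑ i, ∑ j, μ i * μ j * (z i - z j) ^ 2 ≤ Δ ^ 2 := by
    have h1 := h (fun u => u ^ 2) 0
    simp only [lazyWalk_sq, zero_add] at h1
    rw [← h1]
    linarith
  rw [h]
  simp only [zero_add]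
  rcases hα.eq_or_lt with rfl | hα
  · simp only [zero_div]
    exact Finset.sum_nonneg fun i _ => Finset.sum_nonneg fun j _ =>
      mul_nonneg (mul_nonneg (hμ i) (hμ j)) (ind_nonneg _)
  · rcases hΔ.eq_or_lt with rfl | hΔ
    · -- the variance vanishes, and any interval length serves in the place of `Δ`
      have hz : ∀ i j, μ i * μ j * (z i - z j) ^ 2 = 0 := by
        have hnn : ∀ i j, 0 ≤ μ i * μ j * (z i - z j) ^ 2 := fun i j =>
          mul_nonneg (mul_nonneg (hμ i) (hμ j)) (sq_nonneg _)
        intro i j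
        refine le_antisymm ?_ (hnn i j)
        have h1 := Finset.single_le_sum (f := fun j => μ i * μ j * (z i - z j) ^ 2)
          (fun j _ => hnn i j) (Finset.mem_univ j)
        have h2 := Finset.single_le_sum (f := fun i => ∑ j, μ i * μ j * (z i - z j) ^ 2)
          (fun i _ => Finset.sum_nonneg fun j _ => hnn i j) (Finset.mem_univ i)
        linarith
      have heq : ∀ i j, μ i * μ j * ind (|z i - z j| ≤ α * 0) = μ i * μ j := by
        intro i j
        rcases mul_eq_zero.1 (hz i j) with h0 | h0
        · simp [h0]
        · rw [ind_true, mul_one]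
          simp [pow_eq_zero_iff (two_ne_zero)] at h0
          simp [h0]
      simp only [heq, ← Finset.mul_sum, ← Finset.sum_mul, hμ1]
      linarith
    · exact close_of_variance hμ hμ1 hΔ hα hα1 hv

/-! ### Estimates of single rows -/

/-- The interaction of two coordinates with given signs and hash values: the product of the signs
if the hash values agree, and `0` otherwise. -/
def interaction {Λ : Type*} [DecidableEq Λ] (γ γ' : Bool × Λ) : ℤ :=
  if γ.2 = γ'.2 then (if γ.1 then 1 else -1) * (if γ'.1 then 1 else -1) else 0

lemma abs_interaction_le {Λ : Type*} [DecidableEq Λ] (γ γ' : Bool × Λ) : |interaction γ γ'| ≤ 1 := by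
  unfold interaction
  split_ifs <;> simp

section Row
variable {Λ : Type*} [DecidableEq Λ] [Fintype Λ] [Nonempty Λ]

/-- Given one coordinate, its interaction with a uniformly random one is a step of a lazy walk. -/
lemma avg_interaction (γ : Bool × Λ) (ψ : ℤ → ℝ) :
    𝔼 γ', ψ (interaction γ γ') = (1 - 2 * (1 / (2 * Fintype.card Λ))) * ψ 0 +
      1 / (2 * Fintype.card Λ) * ψ 1 + 1 / (2 * Fintype.card Λ) * ψ (-1) := by
  obtain ⟨b, l⟩ := γ
  have hb : ∀ l', 𝔼 b' : Bool, ψ (interaction (b, l) (b', l')) =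
      ψ 0 + if l = l' then (ψ 1 + ψ (-1)) / 2 - ψ 0 else 0 := by
    intro l'
    rw [Fintype.expect_eq_sum_div_card]
    by_cases h : l = l'
    · cases b
      · simp [interaction, h]; ring
      · simp [interaction, h]
    · simp [interaction, h]
  rw [avg_prod, avg_comm]
  simp only [hb]
  rw [Finset.expect_add_distrib, Fintype.expect_const, Fintype.expect_eq_sum_div_card,
    Finset.sum_ite_eq, if_pos (Finset.mem_univ l)]
  have : (Fintype.card Λ : ℝ) ≠ 0 := by exact_mod_cast Fintype.card_ne_zero
  field_simp
  ring

/-- The noise that the other coordinates add to an estimate is a lazy random walk. -/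
lemma avg_noise_eq_lazyWalk (γ : Bool × Λ) (φ : ℝ → ℝ) : ∀ {m : ℕ} (x : Fin m → ℝ) (v : ℝ),
    𝔼 y : Fin m → Bool × Λ, φ (v + ∑ j, (interaction γ (y j) : ℝ) * x j) =
      lazyWalk (1 / (2 * Fintype.card Λ)) x φ v
  | 0, x, v => by
    rw [Fintype.expect_eq_sum_div_card]
    simp [lazyWalk]
  | m + 1, x, v => by
    rw [avg_cons]
    simp only [Fin.sum_univ_succ, Fin.cons_zero, Fin.cons_succ, ← add_assoc]
    have := fun γ' : Bool × Λ => avg_noise_eq_lazyWalk γ φ (fun j : Fin m => x j.succ)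
      (v + interaction γ γ' * x 0)
    simp only [this]
    rw [avg_interaction γ fun a => lazyWalk _ (fun j : Fin m => x j.succ) φ (v + a * x 0)]
    simp [lazyWalk, sub_eq_add_neg]

end Row

/-- Bernoulli's inequality gives `1 / 2` for the exponent `t / 2`; this is squared. -/
lemma quarter_le_pow {t : ℕ} (ht : 2 ≤ t) (heven : Even t) : 1 / 4 ≤ (1 - 1 / (t : ℝ)) ^ t := by
  obtain ⟨h, rfl⟩ := heven
  have hh : 1 ≤ h := by omega
  have hpos : (0 : ℝ) < h := by exact_mod_cast hh
  have hb := one_add_mul_le_pow (a := -(1 / ((h + h : ℕ) : ℝ))) (by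
    have : 1 / ((h + h : ℕ) : ℝ) ≤ 1 := by
      rw [div_le_one (by positivity)]; exact_mod_cast (by omega : 1 ≤ h + h)
    linarith) h
  have e : 1 + (h : ℝ) * -(1 / ((h + h : ℕ) : ℝ)) = 1 / 2 := by
    push_cast; field_simp; ring
  rw [e] at hb
  rw [pow_add, sub_eq_add_neg]
  nlinarith

lemma errScale_nonneg {d : ℕ} (t : ℕ) (x : Fin d → ℤ) : 0 ≤ errScale t x :=
  div_nonneg (norm_nonneg _) (Real.sqrt_nonneg _)

lemma errScale_sq {d : ℕ} (t : ℕ) (x : Fin d → ℤ) :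
    errScale t x ^ 2 = (∑ i, (tail t x i : ℝ) ^ 2) / t := by
  rw [errScale, div_pow, Real.sq_sqrt (Nat.cast_nonneg _), EuclideanSpace.real_norm_sq_eq]

/-- The noise of a row is at most `α * Δ` with probability at least `α / 80`: with probability at
least `1 / 4` the `t` largest entries do not contribute, and the standard deviation of the
contribution of the other entries is at most `Δ`. -/
lemma noise_small {t m : ℕ} (ht : 2 ≤ t) (heven : Even t) (x : Fin (m + 1) → ℤ) (ℓ : Fin (m + 1))
    {α : ℝ} (hα : 0 ≤ α) (hα1 : α ≤ 1) :
    α / 80 ≤ lazyWalk (1 / (2 * (t : ℝ))) (fun j => (x (ℓ.succAbove j) : ℝ))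
      (fun u => ind (|u| ≤ α * errScale t x)) 0 := by
  have htpos : (0 : ℝ) < t := by exact_mod_cast (by omega : 0 < t)
  have ht2 : (2 : ℝ) ≤ t := by exact_mod_cast ht
  have hp : 0 ≤ 1 / (2 * (t : ℝ)) := by positivity
  have hp4 : 4 * (1 / (2 * (t : ℝ))) ≤ 1 := by
    rw [mul_one_div, div_le_one (by positivity)]; linarith
  set H : Fin m → Prop := fun j => ((Tuple.sort fun j => -|x j|).symm (ℓ.succAbove j) : ℕ) < t with hH
  have hheads := lazyWalk_ge_of_heads hp (by linarith) (φ := fun u => ind (|u| ≤ α * errScale t x))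
    (fun _ => ind_nonneg _) (fun j => (x (ℓ.succAbove j) : ℝ)) H 0
  have htail : (fun j => if H j then (0 : ℝ) else x (ℓ.succAbove j)) =
      fun j => (tail t x (ℓ.succAbove j) : ℝ) := by
    funext j
    simp only [tail, hH]
    split_ifs <;> simp
  rw [htail] at hheads
  have hsmall := lazyWalk_small hp hp4 (fun j => (tail t x (ℓ.succAbove j) : ℝ))
    (errScale_nonneg t x) hα hα1 (by
      rw [errScale_sq, Fin.sum_univ_succAbove _ ℓ]
      have h0 : 0 ≤ (tail t x ℓ : ℝ) ^ 2 := sq_nonneg _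
      rw [show 2 * (1 / (2 * (t : ℝ))) = 1 / t by field_simp, one_div_mul_eq_div]
      gcongr
      linarith)
  have hq1 : 1 - 2 * (1 / (2 * (t : ℝ))) = 1 - 1 / t := by field_simp
  have hq0 : 0 ≤ 1 - 1 / (t : ℝ) := by
    rw [sub_nonneg, div_le_one htpos]; linarith
  have hq2 : 1 - 1 / (t : ℝ) ≤ 1 := by
    have : 0 ≤ 1 / (t : ℝ) := by positivity
    linarith
  have hcard : (Finset.univ.filter H).card ≤ t := by
    calc (Finset.univ.filter H).card ≤ (Finset.range t).card := by
          refine Finset.card_le_card_of_injOn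
            (fun j => ((Tuple.sort fun j => -|x j|).symm (ℓ.succAbove j) : ℕ)) ?_ ?_
          · intro j hj
            simpa [hH] using hj
          · intro j _ j' _ h
            have h1 := (Tuple.sort fun j => -|x j|).symm.injective (Fin.ext h)
            exact Fin.succAbove_right_injective h1
      _ = t := Finset.card_range t
  have hprod : 1 / 4 ≤ ∏ j, if H j then (1 - 2 * (1 / (2 * (t : ℝ)))) else 1 := by
    rw [hq1, Finset.prod_ite, Finset.prod_const, Finset.prod_const_one, mul_one]
    exact (quarter_le_pow ht heven).trans (pow_le_pow_of_le_one hq0 hq2 hcard)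
  refine le_trans ?_ hheads
  calc α / 80 = 1 / 4 * (α / 20) := by ring
    _ ≤ _ := mul_le_mul hprod hsmall (by positivity) (by linarith)

section Row
variable {Λ : Type*} [DecidableEq Λ] [Fintype Λ] [Nonempty Λ]

/-- The two error probabilities of a row. -/
lemma row_error_le {d : ℕ} (ht : 2 ≤ Fintype.card Λ) (heven : Even (Fintype.card Λ))
    (x : Fin d → ℤ) (ℓ : Fin d) {α : ℝ} (hα : 0 ≤ α) (hα1 : α ≤ 1) :
    (𝔼 y : Fin d → Bool × Λ, ind (x ℓ + α * errScale (Fintype.card Λ) x <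
      ((∑ ρ, interaction (y ℓ) (y ρ) * x ρ : ℤ) : ℝ))) ≤ (1 - α / 80) / 2 ∧
    (𝔼 y : Fin d → Bool × Λ, ind (((∑ ρ, interaction (y ℓ) (y ρ) * x ρ : ℤ) : ℝ) <
      x ℓ - α * errScale (Fintype.card Λ) x)) ≤ (1 - α / 80) / 2 := by
  obtain ⟨m, rfl⟩ : ∃ m, d = m + 1 := ⟨d - 1, by have := ℓ.isLt; omega⟩
  set a := α * errScale (Fintype.card Λ) x with ha
  have ha0 : 0 ≤ a := mul_nonneg hα (errScale_nonneg _ _)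
  set p : ℝ := 1 / (2 * Fintype.card Λ) with hp
  have hself : ∀ γ : Bool × Λ, interaction γ γ = 1 := by
    rintro ⟨b, l⟩; cases b <;> simp [interaction]
  -- the estimate is the true value plus the noise of the other coordinates
  have hsplit : ∀ φ : ℝ → ℝ, (𝔼 y : Fin (m + 1) → Bool × Λ,
      φ (((∑ ρ, interaction (y ℓ) (y ρ) * x ρ : ℤ) : ℝ) - x ℓ)) =
      lazyWalk p (fun j => (x (ℓ.succAbove j) : ℝ)) φ 0 := by
    intro φ
    rw [← Fintype.expect_equiv (Fin.insertNthEquiv (fun _ => Bool × Λ) ℓ)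
      (fun q => φ (((∑ ρ, interaction ((ℓ.insertNth q.1 q.2 : Fin (m + 1) → Bool × Λ) ℓ)
        ((ℓ.insertNth q.1 q.2 : Fin (m + 1) → Bool × Λ) ρ) * x ρ : ℤ) : ℝ) - x ℓ)) _ fun _ => rfl,
      avg_prod]
    have : ∀ γ : Bool × Λ, (𝔼 y : Fin m → Bool × Λ,
        φ (((∑ ρ, interaction ((ℓ.insertNth γ y : Fin (m + 1) → Bool × Λ) ℓ)
        ((ℓ.insertNth γ y : Fin (m + 1) → Bool × Λ) ρ) * x ρ : ℤ) : ℝ) - x ℓ)) =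
        lazyWalk p (fun j => (x (ℓ.succAbove j) : ℝ)) φ 0 := by
      intro γ
      rw [hp, ← avg_noise_eq_lazyWalk γ]
      refine Finset.expect_congr rfl fun y _ => ?_
      congr 1
      rw [Fin.sum_univ_succAbove _ ℓ]
      simp [hself]
    simp only [this]
    exact Fintype.expect_const _
  have hplus := hsplit fun u => ind (a < u)
  have hminus := hsplit fun u => ind (u < -a)
  have hsym : lazyWalk p (fun j => (x (ℓ.succAbove j) : ℝ)) (fun u => ind (u < -a)) 0 =
      lazyWalk p (fun j => (x (ℓ.succAbove j) : ℝ)) (fun u => ind (a < u)) 0 := by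
    have := lazyWalk_neg p (fun u => ind (a < u)) (fun j => (x (ℓ.succAbove j) : ℝ)) 0
    simp only [neg_zero] at this
    rw [← this]
    congr 1
    funext u
    rw [show (u < -a) = (a < -u) from propext lt_neg]
  have hsmall := noise_small ht heven x ℓ hα hα1
  rw [← hp, ← ha] at hsmall
  have hone : lazyWalk p (fun j => (x (ℓ.succAbove j) : ℝ)) (fun u => ind (a < u)) 0 +
      lazyWalk p (fun j => (x (ℓ.succAbove j) : ℝ)) (fun u => ind (u < -a)) 0 +
      lazyWalk p (fun j => (x (ℓ.succAbove j) : ℝ)) (fun u => ind (|u| ≤ a)) 0 = 1 := by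
    rw [← lazyWalk_add, ← lazyWalk_add, ← lazyWalk_const p 1 (fun j => (x (ℓ.succAbove j) : ℝ)) 0]
    congr 1
    funext u
    by_cases h1 : a < u
    · rw [ind_true h1, ind_false (not_lt.2 (by linarith)),
        ind_false fun h => by have := (abs_le.1 h).2; linarith]
      norm_num
    · by_cases h2 : u < -a
      · rw [ind_false h1, ind_true h2, ind_false fun h => by have := (abs_le.1 h).1; linarith]
        norm_num
      · rw [ind_false h1, ind_false h2, ind_true (abs_le.2 ⟨not_lt.1 h2, not_lt.1 h1⟩)]
        norm_num
  constructor
  · simp only [lt_sub_iff_add_lt'] at hplus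
    rw [hplus]
    linarith
  · have e : ∀ v : ℝ, (v - x ℓ < -a) = (v < x ℓ - a) := fun v => by
      rw [sub_lt_iff_lt_add', ← sub_eq_add_neg]
    simp only [e] at hminus
    rw [hminus]
    linarith

end Row

/-! ### The majority of the rows -/

lemma exp_half_sq_sub_le {δ : ℝ} (h0 : 0 ≤ δ) (h1 : δ ≤ 1) :
    Real.exp (δ ^ 2 / 2) - δ ^ 2 ≤ Real.exp (-(δ ^ 2 / 4)) := by
  have hu : δ ^ 2 ≤ 1 := pow_le_one₀ h0 h1
  have hu0 : 0 ≤ δ ^ 2 := sq_nonneg _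
  have h2 := (abs_le.1 (Real.abs_exp_sub_one_sub_id_le (x := δ ^ 2 / 2)
    (by rw [abs_of_nonneg (by positivity)]; linarith))).2
  have h3 := Real.add_one_le_exp (-(δ ^ 2 / 4))
  nlinarith

/-- A Chernoff bound: if single rows are bad with probability at most `(1 - δ) / 2`, then it is
exponentially unlikely that most of `r` independent rows are bad. -/
lemma majority_bound {Λ : Type*} [Fintype Λ] [Nonempty Λ] (bad : Λ → Prop) {δ : ℝ} (h0 : 0 ≤ δ)
    (h1 : δ ≤ 1) (h : 𝔼 y, ind (bad y) ≤ (1 - δ) / 2) (r : ℕ) :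
    (𝔼 y : Fin r → Λ, ind (0 < ∑ i, (2 * ind (bad (y i)) - 1))) ≤ Real.exp (-(δ ^ 2 / 4 * r)) := by
  have hrow : 𝔼 y, Real.exp (δ * (2 * ind (bad y) - 1)) ≤ Real.exp (-(δ ^ 2 / 4)) := by
    have e : ∀ y, Real.exp (δ * (2 * ind (bad y) - 1)) =
        ind (bad y) * (2 * Real.sinh δ) + (Real.cosh δ - Real.sinh δ) := by
      intro y
      by_cases hy : bad y
      · rw [ind_true hy, Real.sinh_eq, Real.cosh_eq]; ring_nf
      · rw [ind_false hy, Real.sinh_eq, Real.cosh_eq]; ring_nf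
    simp only [e]
    rw [Finset.expect_add_distrib, ← Finset.expect_mul, Fintype.expect_const]
    have hs := Real.self_le_sinh_iff.2 h0
    have hc := Real.cosh_le_exp_half_sq δ
    have := exp_half_sq_sub_le h0 h1
    nlinarith
  calc (𝔼 y : Fin r → Λ, ind (0 < ∑ i, (2 * ind (bad (y i)) - 1)))
      ≤ 𝔼 y : Fin r → Λ, ∏ i, Real.exp (δ * (2 * ind (bad (y i)) - 1)) := by
        refine avg_mono fun y => ?_
        rw [← Real.exp_sum, ← Finset.mul_sum]
        by_cases hy : 0 < ∑ i, (2 * ind (bad (y i)) - 1)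
        · rw [ind_true hy]
          exact Real.one_le_exp (by positivity)
        · rw [ind_false hy]
          positivity
    _ = (𝔼 y, Real.exp (δ * (2 * ind (bad y) - 1))) ^ r := by
        rw [avg_pi_prod fun _ y => Real.exp (δ * (2 * ind (bad y) - 1)), Finset.prod_const,
          Finset.card_univ, Fintype.card_fin]
    _ ≤ Real.exp (-(δ ^ 2 / 4)) ^ r :=
        pow_le_pow_left₀ (avg_nonneg fun _ => (Real.exp_pos _).le) hrow r
    _ = Real.exp (-(δ ^ 2 / 4 * r)) := by
        rw [← Real.exp_nat_mul]; ring_nf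

lemma two_mul_count_sub (p : ℕ → Prop) [DecidablePred p] (r : ℕ) :
    2 * (Nat.count p r : ℝ) - r = ∑ i : Fin r, (2 * ind (p i) - 1) := by
  induction r with
  | zero => simp
  | succ r ih =>
    rw [Fin.sum_univ_castSucc, Nat.count_succ]
    simp only [Fin.val_castSucc, Fin.val_last]
    rw [← ih]
    by_cases h : p r
    · rw [ind_true h, if_pos h]; push_cast; ring
    · rw [ind_false h, if_neg h]; push_cast; ring

/-- With independent and uniformly distributed blocks, it is unlikely that most rows are bad. -/
lemma uniform_majority {β Γ : Type*} [Fintype β] [Nonempty β] [Fintype Γ] [Nonempty Γ] {ty : β → Γ}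
    (hty : UniformMap ty) (κ : Γ → Γ → ℤ) {d r D : ℕ} (hD : r * d ≤ D) (x : ℕ → ℤ) (ℓ : Fin d)
    (B : Set ℤ) {δ : ℝ} (h0 : 0 ≤ δ) (h1 : δ ≤ 1)
    (h : (𝔼 y : Fin d → Γ, ind (∑ ρ, κ (y ℓ) (y ρ) * x ρ ∈ B)) ≤ (1 - δ) / 2) :
    (𝔼 u : Fin D → β, ind (extend u ∈ {z : ℕ → β | r / 2 + 1 ≤ rowCount ty κ x d ℓ B z r})) ≤
      Real.exp (-(δ ^ 2 / 4 * r)) := by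
  classical
  have hlt : ∀ (i : Fin r) (ρ : Fin d), (i : ℕ) * d + ρ < D := by
    intro i ρ
    have : ((i : ℕ) + 1) * d ≤ r * d := Nat.mul_le_mul_right _ i.isLt
    have := ρ.isLt
    nlinarith
  let e : Fin r × Fin d → Fin D := fun p => ⟨p.1 * d + p.2, hlt p.1 p.2⟩
  have he : Function.Injective e := by
    intro p p' hpp
    have hd : 0 < d := (Nat.zero_le _).trans_lt ℓ.isLt
    have h2 : (p.1 : ℕ) * d + p.2 = p'.1 * d + p'.2 := congrArg Fin.val hpp
    have h3 : (p.1 : ℕ) = p'.1 := by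
      have hdiv : ∀ a b : ℕ, b < d → (a * d + b) / d = a := fun a b hb => by
        rw [Nat.add_comm, Nat.add_mul_div_right _ _ hd, Nat.div_eq_of_lt hb, zero_add]
      have := congrArg (· / d) h2
      simpa only [hdiv _ _ p.2.isLt, hdiv _ _ p'.2.isLt] using this
    refine Prod.ext (Fin.ext h3) (Fin.ext ?_)
    rw [h3] at h2
    omega
  have hrest := uniformMap_restrict (α := β) e he
  have hcurry : UniformMap fun (u : Fin D → β) (i : Fin r) (ρ : Fin d) => ty (u (e (i, ρ))) := by
    have h2 := (uniformMap_equiv (Equiv.curry (Fin r) (Fin d) β)).comp hrest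
    exact ((hty.pi d).pi r).comp h2
  refine le_trans (le_of_eq ?_)
    (majority_bound (fun y : Fin d → Γ => ∑ ρ, κ (y ℓ) (y ρ) * x ρ ∈ B) h0 h1 h r)
  rw [← hcurry]
  refine Finset.expect_congr rfl fun u _ => ?_
  congr 1
  have hrow : ∀ i : Fin r, rowPartial ty κ x d ℓ (extend u) i d =
      ∑ ρ, κ (ty (u (e (i, ℓ)))) (ty (u (e (i, ρ)))) * x ρ := by
    intro i
    rw [rowPartial, Finset.sum_range]
    simp only [extend, hlt, dif_pos, e]
  have hcount := two_mul_count_sub (fun i => rowPartial ty κ x d ℓ (extend u) i d ∈ B) r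
  simp only [hrow] at hcount
  rw [← hcount, Set.mem_ofPred_eq, rowCount, sub_pos]
  apply propext
  rw [show ((r : ℝ) < 2 * (Nat.count (fun i => rowPartial ty κ x d ℓ (extend u) i d ∈ B) r : ℝ)) ↔
    r < 2 * Nat.count (fun i => rowPartial ty κ x d ℓ (extend u) i d ∈ B) r by
      rw [← Nat.cast_two, ← Nat.cast_mul, Nat.cast_lt]]
  omega

/-! ### Signs and hash values from blocks -/

/-- Translation lemma for maps whose codomain is not given as a group: `op` is an operation with
bijective left translations. -/
lemma uniformMap_of_op {α β : Type*} [Fintype α] [Fintype β] [Nonempty α] {G : α → β}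
    (op : β → β → β) (hop : ∀ y, Function.Bijective (op y))
    (h : ∀ v : β, ∃ τ : Equiv.Perm α, ∀ a, G (τ a) = op (G a) v) : UniformMap G := fun φ => by
  have : Nonempty β := ⟨G (Classical.arbitrary α)⟩
  choose τ hτ using h
  calc 𝔼 a, φ (G a) = 𝔼 _v : β, 𝔼 a, φ (G a) := (Fintype.expect_const _).symm
    _ = 𝔼 v : β, 𝔼 a, φ (op (G a) v) := by
      refine Finset.expect_congr rfl fun v _ => ?_
      rw [← Fintype.expect_equiv (τ v) (fun a => φ (G (τ v a))) (fun a => φ (G a)) fun _ => rfl]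
      simp [hτ]
    _ = 𝔼 a, 𝔼 v : β, φ (op (G a) v) := avg_comm _
    _ = 𝔼 _a : α, 𝔼 v : β, φ v := by
      refine Finset.expect_congr rfl fun a _ => ?_
      exact Fintype.expect_bijective _ (hop (G a)) _ _ fun _ => rfl
    _ = 𝔼 v : β, φ v := Fintype.expect_const _

/-- The first bit and the last `τ` bits of a block. -/
def blockType (τ : ℕ) {n : ℕ} (v : BitVec n) : Bool × BitVec τ := (v.msb, v.setWidth τ)

lemma uniformMap_blockType {τ n : ℕ} (h : τ < n) : UniformMap (blockType τ (n := n)) := by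
  refine uniformMap_of_op (fun y y' => (y.1 ^^ y'.1, y.2 ^^^ y'.2)) (fun y => ?_) fun v => ?_
  · refine Function.Involutive.bijective fun y' => ?_
    refine Prod.ext (by simp) ?_
    simp only [← BitVec.xor_assoc, BitVec.xor_self, BitVec.zero_xor]
  · obtain ⟨s, l⟩ := v
    set c : BitVec n := l.setWidth n ^^^ (if s then BitVec.twoPow n (n - 1) else 0) with hc
    have hinv : Function.Involutive fun a : BitVec n => a ^^^ c := fun a => by
      simp only [BitVec.xor_assoc, BitVec.xor_self, BitVec.xor_zero]
    refine ⟨hinv.toPerm, fun a => ?_⟩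
    have hmsb : c.msb = s := by
      rw [hc, BitVec.msb_xor]
      have h1 : (l.setWidth n).msb = false := by
        rw [BitVec.msb_eq_getLsbD_last, BitVec.getLsbD_setWidth]
        simp [BitVec.getLsbD_of_ge l (n - 1) (by omega)]
      rw [h1]
      cases s
      · simp
      · simp [BitVec.msb_eq_getLsbD_last, BitVec.getLsbD_twoPow]
        omega
    have hlow : c.setWidth τ = l := by
      apply BitVec.eq_of_getLsbD_eq
      intro i hi
      have h2 : ¬ i = n - 1 := by omega
      cases s
      · simp [hc, hi, show i < n by omega]
      · simp [hc, hi, show i < n by omega, h2]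
    simp only [blockType, Function.Involutive.coe_toPerm, BitVec.msb_xor, BitVec.setWidth_xor, hmsb,
      hlow]

/-! ### The median -/

/-- If the median lies in a set that is closed upwards or downwards, then more than half of the
entries do. -/
lemma le_card_of_median_mem {r : ℕ} (hr : Odd r) (f : Fin r → ℤ) (B : Set ℤ) [DecidablePred (· ∈ B)]
    (hB : (∀ a b, a ≤ b → a ∈ B → b ∈ B) ∨ (∀ a b, b ≤ a → a ∈ B → b ∈ B))
    (hm : median f ∈ B) : r / 2 + 1 ≤ (Finset.univ.filter fun i => f i ∈ B).card := by
  have hr0 : 0 < r := hr.pos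
  have hhalf : r / 2 < r := Nat.div_lt_self hr0 one_lt_two
  rw [median, dif_pos hr0] at hm
  have hmono := Tuple.monotone_sort f
  have hodd : r = 2 * (r / 2) + 1 := by obtain ⟨k, hk⟩ := hr; omega
  rw [← Finset.card_map (Tuple.sort f).symm.toEmbedding]
  rcases hB with hB | hB
  · calc r / 2 + 1 = (Finset.Ici (⟨r / 2, hhalf⟩ : Fin r)).card := by rw [Fin.card_Ici]; simp; omega
      _ ≤ _ := Finset.card_le_card fun j hj => by
        rw [Finset.mem_map_equiv, Finset.mem_filter]
        refine ⟨Finset.mem_univ _, hB _ _ ?_ hm⟩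
        exact hmono (Finset.mem_Ici.1 hj)
  · calc r / 2 + 1 = (Finset.Iic (⟨r / 2, hhalf⟩ : Fin r)).card := by rw [Fin.card_Iic]
      _ ≤ _ := Finset.card_le_card fun j hj => by
        rw [Finset.mem_map_equiv, Finset.mem_filter]
        refine ⟨Finset.mem_univ _, hB _ _ ?_ hm⟩
        exact hmono (Finset.mem_Iic.1 hj)

/-! ### The error of the derandomized sketch -/

/-- The estimate of `x_ℓ` by a single row. -/
def rowEstimate {n b k d : ℕ} (τ r : ℕ) (σ : Seed n b k) (x : Fin d → ℤ) (ℓ : Fin d)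
    (i : Fin r) : ℤ :=
  prgSign d r σ i ℓ * prgSketch d τ r σ x (i, prgHash d τ r σ i ℓ)

lemma prgEstimate_eq {n b k d : ℕ} (τ r : ℕ) (σ : Seed n b k) (x : Fin d → ℤ) (ℓ : Fin d) :
    prgEstimate d τ r σ x ℓ = median (rowEstimate τ r σ x ℓ) := rfl

lemma prgSketch_apply {n b k d : ℕ} (τ r : ℕ) (σ : Seed n b k) (x : Fin d → ℤ) (i : Fin r)
    (j : Fin (2 ^ τ)) : prgSketch d τ r σ x (i, j) =
      ∑ ρ, (if prgHash d τ r σ i ρ = j then prgSign d r σ i ρ else 0) * x ρ := rfl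

/-- A vector, extended by zeros. -/
def extendVec {d : ℕ} (x : Fin d → ℤ) : ℕ → ℤ := fun ρ => if h : ρ < d then x ⟨ρ, h⟩ else 0

lemma extendVec_val {d : ℕ} (x : Fin d → ℤ) (ρ : Fin d) : extendVec x ρ = x ρ := by
  simp [extendVec]

lemma rowEstimate_eq {n b k d : ℕ} (τ r : ℕ) (σ : Seed n b k) (x : Fin d → ℤ) (ℓ : Fin d)
    (i : Fin r) : rowEstimate τ r σ x ℓ i =
      rowPartial (blockType τ) interaction (extendVec x) d ℓ (fastPRG σ) i d := by
  rw [rowEstimate, prgSketch_apply, rowPartial, Finset.sum_range, Finset.mul_sum]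
  refine Finset.sum_congr rfl fun ρ _ => ?_
  have hh : prgHash d τ r σ i ρ = prgHash d τ r σ i ℓ ↔
      (blockType τ (fastPRG σ (i * d + ℓ))).2 = (blockType τ (fastPRG σ (i * d + ρ))).2 :=
    ⟨fun e => (BitVec.eq_of_toFin_eq e).symm, fun e => congrArg BitVec.toFin e.symm⟩
  simp only [extendVec_val, interaction, hh]
  by_cases h : (blockType τ (fastPRG σ (i * d + ℓ))).2 = (blockType τ (fastPRG σ (i * d + ρ))).2
  · rw [if_pos h, if_pos h, ← mul_assoc]
    rfl
  · rw [if_neg h, if_neg h, zero_mul, mul_zero]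

lemma prob_mono {Ω : Type} [Fintype Ω] {E F : Set Ω} (h : E ⊆ F) : prob E ≤ prob F := by
  rw [prob_eq_expect, prob_eq_expect]
  exact avg_mono fun ω => ind_mono fun hω => h hω

lemma prob_union_le {Ω : Type} [Fintype Ω] (E F : Set Ω) : prob (E ∪ F) ≤ prob E + prob F := by
  rw [prob_eq_expect, prob_eq_expect, prob_eq_expect, ← Finset.expect_add_distrib]
  refine avg_mono fun ω => ?_
  by_cases h1 : ω ∈ E
  · rw [ind_true h1]
    exact (ind_le_one _).trans (by linarith [ind_nonneg (ω ∈ F)])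
  · refine (ind_mono fun h => h.resolve_left h1).trans ?_
    linarith [ind_nonneg (ω ∈ E)]

/-- One-sided error bound: if a row estimate from independent blocks is in `B` with probability at
most `(1 - δ) / 2`, then most row estimates of FastPRG are in `B` with small probability. -/
lemma prob_majority_le {n b k d τ r M : ℕ} (hb : 2 ≤ b) (hk : r * d ≤ b ^ k) (hτ : τ < n)
    (x : Fin d → ℤ) (hx : ∀ i, |x i| ≤ M) (ℓ : Fin d) (B : Set ℤ) {δ : ℝ} (h0 : 0 ≤ δ) (h1 : δ ≤ 1)
    (h : (𝔼 y : Fin d → Bool × BitVec τ, ind (∑ ρ, interaction (y ℓ) (y ρ) * x ρ ∈ B)) ≤ (1 - δ) / 2) :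
    prob {σ : Seed n b k | r / 2 + 1 ≤
        rowCount (blockType τ) interaction (extendVec x) d ℓ B (fastPRG σ) r} ≤
      Real.exp (-(δ ^ 2 / 4 * r)) +
        (b ^ k : ℕ) * ((r + 1) * (2 * 2 ^ τ) * (2 * (d * M) + 1) : ℕ) * √(1 / ((2 : ℝ) ^ n)) := by
  have hcard : Fintype.card (Bool × BitVec τ) = 2 * 2 ^ τ := by
    rw [Fintype.card_prod, Fintype.card_bool, ← Nat.card_eq_fintype_card (α := BitVec τ),
      Nat.card_congr (BitVec.equivFin (m := τ)).toEquiv]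
    simp
  have hxN : ∀ ρ, |extendVec x ρ| ≤ M := by
    intro ρ
    unfold extendVec
    split_ifs
    · exact hx _
    · simp
  have hsm := rowTest_smallSpace (ty := blockType τ (n := n)) (κ := interaction) (x := extendVec x)
    (M := M) abs_interaction_le hxN ℓ.isLt B r (r / 2 + 1)
  rw [hcard] at hsm
  refine (fastPRG_fools hb k hsm fun z z' hz hmem => ?_).trans ?_
  · rw [Set.mem_ofPred_eq] at hmem ⊢
    rwa [← rowCount_congr B fun i hi => ?_]
    have hlt : ∀ ρ < d, i * d + ρ < b ^ k := fun ρ hρ => by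
      have : (i + 1) * d ≤ r * d := Nat.mul_le_mul_right _ hi
      nlinarith
    exact rowPartial_congr (by rw [hz _ (hlt ℓ ℓ.isLt)]) fun ρ hρ => hz _ (hlt ρ hρ)
  · gcongr
    refine uniform_majority (uniformMap_blockType hτ) interaction hk (extendVec x) ℓ B h0 h1 ?_
    simpa only [extendVec_val] using h

/-- The error of the derandomized sketch: the bound for independent blocks, plus the error of the
generator for the two one-sided tests. -/
theorem prob_error_le {n b k d τ r M : ℕ} (hb : 2 ≤ b) (hk : r * d ≤ b ^ k) (hτ : τ < n)
    (hτ1 : 1 ≤ τ) (hr : Odd r) (x : Fin d → ℤ) (hx : ∀ i, |x i| ≤ M) (ℓ : Fin d) {α : ℝ}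
    (hα : 0 ≤ α) (hα1 : α ≤ 1) :
    prob {σ : Seed n b k |
        α * errScale (2 ^ τ) x < |(prgEstimate d τ r σ x ℓ : ℝ) - (x ℓ : ℝ)|} ≤
      2 * Real.exp (-(1 / 25600 * α ^ 2 * r)) + 2 * ((b ^ k : ℕ) *
        ((r + 1) * (2 * 2 ^ τ) * (2 * (d * M) + 1) : ℕ) * √(1 / ((2 : ℝ) ^ n))) := by
  classical
  have hcard : Fintype.card (BitVec τ) = 2 ^ τ := by
    rw [← Nat.card_eq_fintype_card, Nat.card_congr (BitVec.equivFin (m := τ)).toEquiv]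
    simp
  have hrow := row_error_le (Λ := BitVec τ)
    (by rw [hcard]; exact Nat.le_self_pow (by omega) 2)
    (by rw [hcard]; exact (Nat.even_pow' (by omega)).2 even_two) x ℓ hα hα1
  rw [hcard] at hrow
  set a := α * errScale (2 ^ τ) x
  let B₁ : Set ℤ := {v | (x ℓ : ℝ) + a < v}
  let B₂ : Set ℤ := {v | (v : ℝ) < x ℓ - a}
  have h1 := prob_majority_le (k := k) (n := n) hb hk hτ x hx ℓ B₁ (δ := α / 80) (by positivity)
    (by linarith) hrow.1
  have h2 := prob_majority_le (k := k) (n := n) hb hk hτ x hx ℓ B₂ (δ := α / 80) (by positivity)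
    (by linarith) hrow.2
  have hexp : (α / 80) ^ 2 / 4 * r = 1 / 25600 * α ^ 2 * r := by ring
  rw [hexp] at h1 h2
  have hcount : ∀ (σ : Seed n b k) (B : Set ℤ),
      (Finset.univ.filter fun i => rowEstimate τ r σ x ℓ i ∈ B).card =
        rowCount (blockType τ) interaction (extendVec x) d ℓ B (fastPRG σ) r := by
    intro σ B
    simp only [rowCount, rowEstimate_eq]
    rw [Nat.count_eq_card_filter_range, Finset.card_filter, Finset.card_filter, Finset.sum_range]
  have hsub : {σ : Seed n b k | a < |(prgEstimate d τ r σ x ℓ : ℝ) - (x ℓ : ℝ)|} ⊆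
      {σ | r / 2 + 1 ≤ rowCount (blockType τ) interaction (extendVec x) d ℓ B₁ (fastPRG σ) r} ∪
      {σ | r / 2 + 1 ≤ rowCount (blockType τ) interaction (extendVec x) d ℓ B₂ (fastPRG σ) r} := by
    intro σ hσ
    rw [Set.mem_ofPred_eq, lt_abs] at hσ
    rw [prgEstimate_eq] at hσ
    rcases hσ with hσ | hσ
    · left
      rw [Set.mem_ofPred_eq, ← hcount]
      refine le_card_of_median_mem hr _ B₁ (Or.inl fun u v huv hu => ?_) ?_
      · have : (u : ℝ) ≤ v := by exact_mod_cast huv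
        exact lt_of_lt_of_le hu this
      · show (x ℓ : ℝ) + a < _
        linarith
    · right
      rw [Set.mem_ofPred_eq, ← hcount]
      refine le_card_of_median_mem hr _ B₂ (Or.inr fun u v huv hu => ?_) ?_
      · have : (v : ℝ) ≤ u := by exact_mod_cast huv
        exact lt_of_le_of_lt this hu
      · show _ < (x ℓ : ℝ) - a
        linarith
  refine (prob_mono hsub).trans ((prob_union_le _ _).trans ?_)
  linarith

/-! ### Reasoning about word RAM programs -/

section Machine
variable {w : ℕ}

/-- The content of a register, as a natural number. -/
def State.R (s : State w) (i : ℕ) : ℕ := (s.reg i).toNat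

/-- The content of the memory cell with address `a` (modulo `2 ^ w`), as a natural number. -/
def State.M (s : State w) (a : ℕ) : ℕ := (s.mem (BitVec.ofNat w a)).toNat

lemma State.toNat_reg (s : State w) (i : ℕ) : (s.reg i).toNat = s.R i := rfl

lemma State.R_lt (s : State w) (i : ℕ) : s.R i < 2 ^ w := (s.reg i).isLt

lemma State.M_lt (s : State w) (a : ℕ) : s.M a < 2 ^ w := (s.mem _).isLt

lemma State.mem_reg (s : State w) (y : ℕ) : (s.mem (s.reg y)).toNat = s.M (s.R y) := by
  simp [State.M, State.R]

lemma State.R_setReg (s : State w) (x : ℕ) (v : BitVec w) (y : ℕ) :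
    (s.setReg x v).R y = if y = x then v.toNat else s.R y := by
  simp only [State.R, State.setReg, Function.update_apply]
  split_ifs <;> rfl

lemma State.M_setReg (s : State w) (x : ℕ) (v : BitVec w) (a : ℕ) : (s.setReg x v).M a = s.M a := rfl

lemma State.R_setMem (s : State w) (a v : BitVec w) (y : ℕ) : (s.setMem a v).R y = s.R y := rfl

lemma State.M_setMem (s : State w) (x : ℕ) (v : BitVec w) {b : ℕ} (hb : b < 2 ^ w) :
    (s.setMem (s.reg x) v).M b = if b = s.R x then v.toNat else s.M b := by
  have : BitVec.ofNat w b = s.reg x ↔ b = s.R x := by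
    rw [State.R, ← BitVec.toNat_inj, BitVec.toNat_ofNat, Nat.mod_eq_of_lt hb]
  simp only [State.M, State.setMem, Function.update_apply, this]
  split_ifs <;> rfl

/-- The operations on words, as operations on natural numbers. -/
def Op.nat (w : ℕ) : Op → ℕ → ℕ → ℕ
  | .add, x, y => (x + y) % 2 ^ w
  | .sub, x, y => (2 ^ w - y + x) % 2 ^ w
  | .mul, x, y => x * y % 2 ^ w
  | .mulHi, x, y => x * y / 2 ^ w
  | .div, x, y => x / y
  | .mod, x, y => x % y
  | .band, x, y => x &&& y
  | .bor, x, y => x ||| y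
  | .bxor, x, y => x ^^^ y
  | .shl, x, y => x <<< y % 2 ^ w
  | .shr, x, y => x / 2 ^ y
  | .eq, x, y => if x = y then 1 % 2 ^ w else 0
  | .lt, x, y => if x < y then 1 % 2 ^ w else 0

lemma Op.eval_toNat (o : Op) (x y : BitVec w) : (o.eval x y).toNat = o.nat w x.toNat y.toNat := by
  cases o
  case mulHi =>
    simp only [Op.eval, Op.nat, BitVec.toNat_ofNat]
    apply Nat.mod_eq_of_lt
    rw [Nat.div_lt_iff_lt_mul (by positivity)]
    exact Nat.mul_lt_mul'' x.isLt y.isLt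
  case eq =>
    simp only [Op.eval, Op.nat, BitVec.toNat_inj]
    split_ifs <;> simp
  case lt =>
    simp only [Op.eval, Op.nat]
    split_ifs <;> simp
  case shr => simp [Op.eval, Op.nat, Nat.shiftRight_eq_div_pow]
  all_goals simp [Op.eval, Op.nat]

/-- The program `p`, started in `s`, halts within `t` steps in `s'`. -/
def Run (p : Prog) (s : State w) (t : ℕ) (s' : State w) : Prop := ∃ T ≤ t, Exec p s T s'

lemma Run.mono {p : Prog} {s s' : State w} {t t' : ℕ} (h : Run p s t s') (ht : t ≤ t') :
    Run p s t' s' := by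
  obtain ⟨T, hT, hE⟩ := h
  exact ⟨T, hT.trans ht, hE⟩

lemma Run.seq {p q : Prog} {s s₁ s₂ : State w} {t₁ t₂ : ℕ} (h₁ : Run p s t₁ s₁)
    (h₂ : Run q s₁ t₂ s₂) : Run (p.seq q) s (t₁ + t₂) s₂ := by
  obtain ⟨T₁, hT₁, hE₁⟩ := h₁
  obtain ⟨T₂, hT₂, hE₂⟩ := h₂
  exact ⟨T₁ + T₂, add_le_add hT₁ hT₂, hE₁.seq hE₂⟩

lemma Run.cond_pos {p q : Prog} {s s₁ : State w} {x t : ℕ} (hx : s.R x ≠ 0) (h : Run p s t s₁) :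
    Run (.cond x p q) s (t + 1) s₁ := by
  obtain ⟨T, hT, hE⟩ := h
  exact ⟨T + 1, by omega, .condTrue (fun h0 => hx (by simp [State.R, h0])) hE⟩

lemma Run.cond_neg {p q : Prog} {s s₁ : State w} {x t : ℕ} (hx : s.R x = 0) (h : Run q s t s₁) :
    Run (.cond x p q) s (t + 1) s₁ := by
  obtain ⟨T, hT, hE⟩ := h
  exact ⟨T + 1, by omega, .condFalse (BitVec.eq_of_toNat_eq (by simpa [State.R] using hx)) hE⟩

lemma Run.loop_stop {p : Prog} {s : State w} {x : ℕ} (hx : s.R x = 0) : Run (.loop x p) s 1 s :=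
  ⟨1, le_rfl, .loopStop (BitVec.eq_of_toNat_eq (by simpa [State.R] using hx))⟩

lemma Run.loop_step {p : Prog} {s s₁ s₂ : State w} {x t₁ t₂ : ℕ} (hx : s.R x ≠ 0)
    (h₁ : Run p s t₁ s₁) (h₂ : Run (.loop x p) s₁ t₂ s₂) :
    Run (.loop x p) s (t₁ + t₂ + 1) s₂ := by
  obtain ⟨T₁, hT₁, hE₁⟩ := h₁
  obtain ⟨T₂, hT₂, hE₂⟩ := h₂
  exact ⟨T₁ + T₂ + 1, by omega, .loopStep (fun h0 => hx (by simp [State.R, h0])) hE₁ hE₂⟩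

/-- A loop that runs exactly `n` times; `I j` holds after `j` rounds. -/
lemma Run.loop {x : ℕ} {p : Prog} (I : ℕ → State w → Prop) (n t : ℕ)
    (hstep : ∀ j < n, ∀ s, I j s → s.R x ≠ 0 ∧ ∃ s', Run p s t s' ∧ I (j + 1) s')
    (hend : ∀ s, I n s → s.R x = 0) {s : State w} (h0 : I 0 s) :
    ∃ s', Run (.loop x p) s (n * (t + 1) + 1) s' ∧ I n s' := by
  have key : ∀ m j, j + m = n → ∀ s, I j s → ∃ s', Run (.loop x p) s (m * (t + 1) + 1) s' ∧ I n s' := by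
    intro m
    induction m with
    | zero =>
      rintro j rfl s hs
      exact ⟨s, (Run.loop_stop (hend s hs)).mono (by omega), hs⟩
    | succ m ih =>
      intro j hj s hs
      obtain ⟨hx, s₁, h₁, hI⟩ := hstep j (by omega) s hs
      obtain ⟨s₂, h₂, hI₂⟩ := ih (j + 1) (by omega) s₁ hI
      refine ⟨s₂, (Run.loop_step hx h₁ h₂).mono (le_of_eq ?_), hI₂⟩
      ring
  exact key n 0 (by omega) s h0

/-- The value of a loop-free program, as a function of the state. -/
def Prog.eval : Prog → State w → State w
  | .const x v, s => s.setReg x (BitVec.ofNat w v)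
  | .bin o z x y, s => s.setReg z (o.eval (s.reg x) (s.reg y))
  | .load x y, s => s.setReg x (s.mem (s.reg y))
  | .store x y, s => s.setMem (s.reg x) (s.reg y)
  | .seq p q, s => q.eval (p.eval s)
  | .cond x p q, s => if s.R x ≠ 0 then p.eval s else q.eval s
  | .loop _ _, s => s

/-- Whether a program has no loop. -/
def Prog.LoopFree : Prog → Prop
  | .seq p q => p.LoopFree ∧ q.LoopFree
  | .cond _ p q => p.LoopFree ∧ q.LoopFree
  | .loop _ _ => False
  | _ => True

/-- A bound for the running time of a loop-free program. -/
def Prog.size : Prog → ℕ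
  | .seq p q => p.size + q.size
  | .cond _ p q => p.size + q.size + 1
  | _ => 1

lemma run_eval : ∀ {p : Prog}, p.LoopFree → ∀ s : State w, Run p s p.size (p.eval s)
  | .const x v, _, s => ⟨1, le_rfl, .const s x v⟩
  | .bin o z x y, _, s => ⟨1, le_rfl, .bin s o z x y⟩
  | .load x y, _, s => ⟨1, le_rfl, .load s x y⟩
  | .store x y, _, s => ⟨1, le_rfl, .store s x y⟩
  | .seq _ _, h, s => (run_eval h.1 s).seq (run_eval h.2 _)
  | .cond x p q, h, s => by
    by_cases hx : s.R x = 0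
    · simp only [Prog.eval, hx, ne_eq, not_true_eq_false, if_false]
      exact (Run.cond_neg hx (run_eval h.2 s)).mono (by simp only [Prog.size]; omega)
    · simp only [Prog.eval, ne_eq, hx, not_false_eq_true, if_true]
      exact (Run.cond_pos hx (run_eval h.1 s)).mono (by simp only [Prog.size]; omega)
  | .loop _ _, h, _ => h.elim

/-- The program never changes register `i`. -/
def Prog.Keeps (i : ℕ) : Prog → Prop
  | .const x _ => i ≠ x
  | .bin _ z _ _ => i ≠ z
  | .load x _ => i ≠ x
  | .store _ _ => True
  | .seq p q => p.Keeps i ∧ q.Keeps i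
  | .cond _ p q => p.Keeps i ∧ q.Keeps i
  | .loop _ p => p.Keeps i

lemma Exec.reg_eq {i : ℕ} {p : Prog} {s s' : State w} {T : ℕ} (h : Exec p s T s') :
    p.Keeps i → s'.reg i = s.reg i := by
  induction h with
  | const s x v => intro hi; exact Function.update_of_ne hi _ _
  | bin s o z x y => intro hi; exact Function.update_of_ne hi _ _
  | load s x y => intro hi; exact Function.update_of_ne hi _ _
  | store s x y => intro _; rfl
  | seq _ _ ih₁ ih₂ => intro hi; rw [ih₂ hi.2, ih₁ hi.1]
  | condTrue _ _ ih => intro hi; exact ih hi.1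
  | condFalse _ _ ih => intro hi; exact ih hi.2
  | loopStop _ => intro _; rfl
  | loopStep _ _ _ ih₁ ih₂ => intro hi; rw [ih₂ hi, ih₁ hi]

lemma Run.R_eq {i : ℕ} {p : Prog} {s s' : State w} {t : ℕ} (h : Run p s t s') (hp : p.Keeps i) :
    s'.R i = s.R i := by
  obtain ⟨T, _, hE⟩ := h
  rw [State.R, State.R, hE.reg_eq hp]

lemma Run.reg_eq {i : ℕ} {p : Prog} {s s' : State w} {t : ℕ} (h : Run p s t s') (hp : p.Keeps i) :
    s'.reg i = s.reg i := by
  obtain ⟨T, _, hE⟩ := h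
  exact hE.reg_eq hp

/-- The program `f 0; f 1; …; f (n - 1)`, preceded by an instruction that clears the auxiliary
register `30`. -/
def rep : ℕ → (ℕ → Prog) → Prog
  | 0, _ => .const 30 0
  | n + 1, f => .seq (rep n f) (f n)

lemma rep_keeps {i n : ℕ} {f : ℕ → Prog} (hi : i ≠ 30) (h : ∀ q, (f q).Keeps i) :
    (rep n f).Keeps i := by
  induction n with
  | zero => exact hi
  | succ n ih => exact ⟨ih, h n⟩

/-- The rule for unrolled loops; the invariant must not depend on register `30`. -/
lemma Run.rep {f : ℕ → Prog} (I : ℕ → State w → Prop) (n t : ℕ)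
    (hclear : ∀ s v, I 0 s → I 0 (s.setReg 30 v))
    (hstep : ∀ q < n, ∀ s, I q s → ∃ s', Run (f q) s t s' ∧ I (q + 1) s') {s : State w}
    (h0 : I 0 s) : ∃ s', Run (rep n f) s (n * t + 1) s' ∧ I n s' := by
  induction n with
  | zero =>
    exact ⟨_, (run_eval (p := .const 30 0) trivial s).mono (by simp [Prog.size]), hclear _ _ h0⟩
  | succ n ih =>
    obtain ⟨s₁, h₁, hI₁⟩ := ih fun q hq => hstep q (by omega)
    obtain ⟨s₂, h₂, hI₂⟩ := hstep n (by omega) s₁ hI₁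
    exact ⟨s₂, (h₁.seq h₂).mono (le_of_eq (by ring)), hI₂⟩

end Machine

/-- Sequential composition of programs. -/
infixr:60 " ;; " => Prog.seq

/-! ### Numbers of several words -/

/-- The number with the digits `f 0, …, f (l - 1)` in base `W`, least significant digit first. -/
def num (W : ℕ) (f : ℕ → ℕ) (l : ℕ) : ℕ := ∑ q ∈ Finset.range l, f q * W ^ q

lemma num_succ (W : ℕ) (f : ℕ → ℕ) (l : ℕ) : num W f (l + 1) = num W f l + f l * W ^ l :=
  Finset.sum_range_succ _ _

lemma num_congr {W : ℕ} {f g : ℕ → ℕ} {l : ℕ} (h : ∀ q < l, f q = g q) : num W f l = num W g l :=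
  Finset.sum_congr rfl fun q hq => by rw [h q (Finset.mem_range.1 hq)]

lemma num_lt {W : ℕ} {f : ℕ → ℕ} {l : ℕ} (h : ∀ q < l, f q < W) : num W f l < W ^ l := by
  induction l with
  | zero => simp [num]
  | succ l ih =>
    rw [num_succ, pow_succ]
    have h1 := ih fun q hq => h q (by omega)
    have h2 := h l (by omega)
    nlinarith [Nat.mul_le_mul_right (W ^ l) (Nat.succ_le_of_lt h2)]

lemma num_update {W : ℕ} {f g : ℕ → ℕ} {l j : ℕ} (hj : j < l) (h : ∀ q < l, q ≠ j → g q = f q) :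
    num W g l + f j * W ^ j = num W f l + g j * W ^ j := by
  unfold num
  rw [← Finset.add_sum_erase _ _ (Finset.mem_range.2 hj),
    ← Finset.add_sum_erase (Finset.range l) (fun q => f q * W ^ q) (Finset.mem_range.2 hj)]
  have : ∑ q ∈ (Finset.range l).erase j, g q * W ^ q = ∑ q ∈ (Finset.range l).erase j, f q * W ^ q :=
    Finset.sum_congr rfl fun q hq => by
      rw [Finset.mem_erase, Finset.mem_range] at hq
      rw [h q hq.2 hq.1]
  rw [this]
  ring

lemma num_digit {W : ℕ} {f : ℕ → ℕ} {l j : ℕ} (hW : 0 < W) (h : ∀ q < l, f q < W) (hj : j < l) :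
    num W f l / W ^ j % W = f j := by
  induction l with
  | zero => omega
  | succ l ih =>
    rw [num_succ]
    rcases Nat.lt_succ_iff_lt_or_eq.1 hj with hj' | rfl
    · have e : f l * W ^ l = f l * W ^ (l - j - 1) * W * W ^ j := by
        rw [mul_assoc (f l), ← pow_succ, mul_assoc, ← pow_add]
        congr 2; omega
      rw [e, Nat.add_mul_div_right _ _ (by positivity), Nat.add_mul_mod_self_right]
      exact ih (fun q hq => h q (by omega)) hj'
    · rw [Nat.add_mul_div_right _ _ (by positivity),
        Nat.div_eq_of_lt (num_lt fun q hq => h q (by omega)), zero_add]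
      exact Nat.mod_eq_of_lt (h j hj)

lemma num_digits_of (W V : ℕ) (l : ℕ) : num W (fun q => V / W ^ q % W) l = V % W ^ l := by
  induction l with
  | zero => simp [num, Nat.mod_one]
  | succ l ih => rw [num_succ, ih, pow_succ, Nat.mod_mul, mul_comm (W ^ l)]

/-- One step of the schoolbook multiplication: the two-word number `acc + x * a + carry`, computed
with single words. -/
lemma mul_add_carry {W x a acc carry : ℕ} (hx : x < W) (ha : a < W) (hacc : acc < W)
    (hc : carry < W) :
    let s₁ := (acc + x * a % W) % W
    let s₂ := (s₁ + carry) % W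
    let hi := x * a / W + (if s₁ < x * a % W then 1 else 0) + if s₂ < carry then 1 else 0
    hi < W ∧ s₂ + hi * W = acc + x * a + carry := by
  intro s₁ s₂ hi
  have hW : 0 < W := by omega
  set lo := x * a % W with hlo
  have hlo' : lo < W := Nat.mod_lt _ hW
  have hxa : x * a = x * a / W * W + lo := by rw [hlo, mul_comm (x * a / W)]; exact (Nat.div_add_mod _ _).symm
  have wrap : ∀ u v : ℕ, u < W → v < W →
      (u + v) % W + (if (u + v) % W < v then 1 else 0) * W = u + v := by
    intro u v hu hv
    rcases lt_or_ge (u + v) W with h | h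
    · rw [Nat.mod_eq_of_lt h, if_neg (by omega)]; omega
    · have : (u + v) % W = u + v - W := by
        rw [Nat.mod_eq_sub_mod h, Nat.mod_eq_of_lt (by omega)]
      rw [this, if_pos (by omega)]; omega
  have h1 := wrap acc lo hacc hlo'
  have h2 := wrap s₁ carry (Nat.mod_lt _ hW) hc
  have heq : s₂ + hi * W = acc + x * a + carry := by
    simp only [hi]
    rw [add_mul, add_mul]
    simp only [s₁, s₂, ← hlo] at h1 h2 ⊢
    omega
  refine ⟨?_, heq⟩
  have hprod : x * a ≤ (W - 1) * (W - 1) := Nat.mul_le_mul (by omega) (by omega)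
  obtain ⟨V, rfl⟩ : ∃ V, W = V + 1 := ⟨W - 1, by omega⟩
  simp only [Nat.add_sub_cancel] at hprod
  by_contra hcon
  have h3 : (V + 1) * (V + 1) ≤ hi * (V + 1) := Nat.mul_le_mul_right _ (not_lt.1 hcon)
  nlinarith

section
variable {w : ℕ}

lemma storedAt_iff {m : ℕ} (s : State w) (a l : ℕ) (v : BitVec m) :
    StoredAt s a l v ↔ ∀ q < l, s.M (a + q) = v.toNat / (2 ^ w) ^ q % 2 ^ w := by
  unfold StoredAt
  refine forall₂_congr fun q _ => ?_
  rw [State.M, ← BitVec.toNat_inj, BitVec.extractLsb'_toNat, Nat.shiftRight_eq_div_pow, ← pow_mul,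
    mul_comm w]

lemma StoredAt.num_eq {m : ℕ} {s : State w} {a l : ℕ} {v : BitVec m} (h : StoredAt s a l v)
    (hm : m = l * w) : num (2 ^ w) (fun q => s.M (a + q)) l = v.toNat := by
  rw [num_congr ((storedAt_iff s a l v).1 h), num_digits_of, ← pow_mul, mul_comm w, ← hm]
  exact Nat.mod_eq_of_lt v.isLt

/-! ### The program for the hash functions -/

/-- Copy the additive parameter into the accumulator. -/
def copyParam (N : ℕ) : Prog := rep (2 * N) fun q =>
  .const 30 (2 * N + q) ;; .bin .add 31 46 30 ;; .load 32 31 ;;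
  .const 30 (N + q) ;; .bin .add 31 10 30 ;; .store 31 32

/-- One step of the schoolbook multiplication: digit `p` of the argument times digit `q` of the
multiplicative parameter. -/
def mulStep (N p q : ℕ) : Prog :=
  .const 30 q ;; .bin .add 31 46 30 ;; .load 32 31 ;;
  .bin .mul 35 33 32 ;; .bin .mulHi 36 33 32 ;;
  .const 30 (N + p + q) ;; .bin .add 31 10 30 ;; .load 37 31 ;;
  .bin .add 38 37 35 ;; .bin .lt 39 38 35 ;;
  .bin .add 40 38 34 ;; .bin .lt 41 40 34 ;;
  .bin .add 34 36 39 ;; .bin .add 34 34 41 ;; .store 31 40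

/-- Add digit `p` of the argument times the multiplicative parameter to the accumulator. -/
def mulRow (N p : ℕ) : Prog :=
  (.const 30 p ;; .bin .add 31 10 30 ;; .load 33 31 ;; .const 34 0) ;;
  rep (2 * N - p) (mulStep N p)

/-- Replace the argument by the upper half of the accumulator. -/
def copyUpper (N : ℕ) : Prog := rep N fun q =>
  .const 30 (2 * N + q) ;; .bin .add 31 10 30 ;; .load 32 31 ;;
  .const 30 q ;; .bin .add 31 10 30 ;; .store 31 32

/-- The program that replaces the `N`-word number `x` at the address in register `10` by the upper
half of `(a * x + c) mod 2 ^ (2 * N * w)`, where the `2 * N`-word numbers `a` and `c` are at the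
address in register `46`.  The accumulator is stored behind `x`. -/
def mulShiftProg (N : ℕ) : Prog := copyParam N ;; rep N (mulRow N) ;; copyUpper N

lemma mulShiftProg_keeps {N i : ℕ} (hi : i < 30 ∨ 41 < i) : (mulShiftProg N).Keeps i := by
  refine ⟨rep_keeps (by omega) fun q => ?_, rep_keeps (by omega) fun p => ⟨?_, rep_keeps (by omega) fun q => ?_⟩,
    rep_keeps (by omega) fun q => ?_⟩
  all_goals
    simp [mulStep, Prog.Keeps]
    omega

lemma copyParam_run {N A B : ℕ} {s : State w} (hA : s.R 46 = A) (hB : s.R 10 = B)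
    (hAB : A + 4 * N ≤ B) (hBw : B + 3 * N ≤ 2 ^ w) :
    ∃ s', Run (copyParam N) s (12 * N + 1) s' ∧ (∀ q < 2 * N, s'.M (B + N + q) = s.M (A + 2 * N + q)) ∧
      ∀ a < 2 ^ w, a < B + N ∨ B + 3 * N ≤ a → s'.M a = s.M a := by
  obtain ⟨s', h, -, -, h₁, h₂⟩ := Run.rep (w := w) (f := fun q =>
      .const 30 (2 * N + q) ;; .bin .add 31 46 30 ;; .load 32 31 ;;
      .const 30 (N + q) ;; .bin .add 31 10 30 ;; .store 31 32)
    (fun j s' => s'.R 46 = A ∧ s'.R 10 = B ∧ (∀ q < j, s'.M (B + N + q) = s.M (A + 2 * N + q)) ∧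
      ∀ a < 2 ^ w, a < B + N ∨ B + N + j ≤ a → s'.M a = s.M a) (2 * N) 6
    (fun s' v h => by simpa [State.R_setReg, State.M_setReg] using h)
    (fun j hj s' ⟨h1, h2, h3, h4⟩ => ⟨_, run_eval (by simp [Prog.LoopFree]) s', by
      have e1 : (2 * N + j) % 2 ^ w = 2 * N + j := Nat.mod_eq_of_lt (by omega)
      have e2 : (N + j) % 2 ^ w = N + j := Nat.mod_eq_of_lt (by omega)
      have e3 : (A + (2 * N + j)) % 2 ^ w = A + (2 * N + j) := Nat.mod_eq_of_lt (by omega)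
      have e4 : (B + (N + j)) % 2 ^ w = B + (N + j) := Nat.mod_eq_of_lt (by omega)
      have e5 : s'.M (A + (2 * N + j)) = s.M (A + 2 * N + j) := by
        rw [h4 _ (by omega) (by omega), add_assoc A]
      have hM : ∀ a < 2 ^ w, (Prog.eval (.const 30 (2 * N + j) ;; .bin .add 31 46 30 ;; .load 32 31 ;;
          .const 30 (N + j) ;; .bin .add 31 10 30 ;; .store 31 32) s').M a =
          if a = B + (N + j) then s.M (A + 2 * N + j) else s'.M a := by
        intro a ha
        simp only [Prog.eval]
        rw [State.M_setMem _ _ _ ha]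
        simp [State.M_setReg, State.R_setReg, State.mem_reg, Op.eval_toNat, Op.nat, State.toNat_reg, h1, h2,
          e1, e2, e3, e4, e5]
      refine ⟨by simp [Prog.eval, State.R_setReg, State.R_setMem, h1],
        by simp [Prog.eval, State.R_setReg, State.R_setMem, h2], fun q hq => ?_, fun a ha ha' => ?_⟩
      · rw [hM _ (by omega)]
        split_ifs with h
        · congr 1; omega
        · exact h3 q (by omega)
      · rw [hM _ ha, if_neg (by omega)]
        exact h4 a ha (by omega)⟩)
    (s := s) ⟨hA, hB, by simp, fun _ _ _ => rfl⟩
  exact ⟨s', h.mono (by omega), h₁, fun a ha ha' => h₂ a ha (by omega)⟩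

lemma mulStep_run {N p q A B : ℕ} {s : State w} (hA : s.R 46 = A) (hB : s.R 10 = B)
    (hAB : A + 4 * N ≤ B) (hBw : B + 3 * N ≤ 2 ^ w) (hpq : p + q < 2 * N) (hw : 1 < 2 ^ w) :
    ∃ s', Run (mulStep N p q) s 15 s' ∧
      s'.M (B + N + (p + q)) + s'.R 34 * 2 ^ w = s.M (B + N + (p + q)) + s.R 33 * s.M (A + q) + s.R 34 ∧
      ∀ a < 2 ^ w, a ≠ B + N + (p + q) → s'.M a = s.M a := by
  refine ⟨_, run_eval (by simp [mulStep, Prog.LoopFree]) s, ?_⟩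
  have e0 : 1 % 2 ^ w = 1 := Nat.mod_eq_of_lt hw
  have e1 : q % 2 ^ w = q := Nat.mod_eq_of_lt (by omega)
  have e2 : (N + p + q) % 2 ^ w = N + p + q := Nat.mod_eq_of_lt (by omega)
  have e3 : (A + q) % 2 ^ w = A + q := Nat.mod_eq_of_lt (by omega)
  have e4 : (B + (N + p + q)) % 2 ^ w = B + N + (p + q) := by
    rw [Nat.mod_eq_of_lt (by omega)]; ring
  obtain ⟨hlt, heq⟩ := mul_add_carry (s.R_lt 33) (s.M_lt (A + q)) (s.M_lt (B + N + (p + q))) (s.R_lt 34)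
  have hM : ∀ a < 2 ^ w, ((mulStep N p q).eval s).M a = if a = B + N + (p + q) then
      ((s.M (B + N + (p + q)) + s.R 33 * s.M (A + q) % 2 ^ w) % 2 ^ w + s.R 34) % 2 ^ w
      else s.M a := by
    intro a ha
    simp only [mulStep, Prog.eval]
    rw [State.M_setMem _ _ _ ha]
    simp [State.M_setReg, State.R_setReg, State.mem_reg, Op.eval_toNat, Op.nat, State.toNat_reg, hA, hB,
      e1, e2, e3, e4, -Nat.mod_add_mod, -Nat.add_mod_mod]
  refine ⟨?_, fun a ha hne => by rw [hM a ha, if_neg hne]⟩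
  rw [hM _ (by omega), if_pos rfl, ← heq]
  congr 2
  rw [← Nat.mod_eq_of_lt hlt]
  simp [mulStep, Prog.eval, State.M_setReg, State.R_setReg, State.R_setMem, State.mem_reg, Op.eval_toNat, Op.nat, State.toNat_reg, hA, hB,
      e0, e1, e2, e3, e4, -Nat.mod_add_mod, -Nat.add_mod_mod]
  simp

/-- One row of schoolbook multiplication: add the product of the first factor and the digit `p` of the
second one to the accumulator, shifted by `p` digits. The overflow is dropped, since the product is
needed modulo `(2 ^ w) ^ (2 * N)` only. -/
lemma mulRow_run {N p A B : ℕ} {s : State w} (hA : s.R 46 = A) (hB : s.R 10 = B)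
    (hAB : A + 4 * N ≤ B) (hBw : B + 3 * N ≤ 2 ^ w) (hp : p < N) (hw : 1 < 2 ^ w) :
    ∃ s', Run (mulRow N p) s (30 * N + 5) s' ∧
      num (2 ^ w) (fun q => s'.M (B + N + q)) (2 * N) ≡
        num (2 ^ w) (fun q => s.M (B + N + q)) (2 * N) +
          s.M (B + p) * (2 ^ w) ^ p * num (2 ^ w) (fun q => s.M (A + q)) (2 * N)
        [MOD (2 ^ w) ^ (2 * N)] ∧
      ∀ a < 2 ^ w, a < B + N ∨ B + 3 * N ≤ a → s'.M a = s.M a := by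
  have hN : 0 < N := by omega
  set W := 2 ^ w with hW
  set s₁ := (Prog.const 30 p ;; .bin .add 31 10 30 ;; .load 33 31 ;; .const 34 0).eval s with hs₁
  have hrun₁ : Run (.const 30 p ;; .bin .add 31 10 30 ;; .load 33 31 ;; .const 34 0) s 4 s₁ :=
    run_eval (by simp [Prog.LoopFree]) s
  have e1 : p % 2 ^ w = p := Nat.mod_eq_of_lt (by omega)
  have e2 : (B + p) % 2 ^ w = B + p := Nat.mod_eq_of_lt (by omega)
  have hM₁ : ∀ a, s₁.M a = s.M a := fun a => rfl
  have h46 : s₁.R 46 = A := by simp [hs₁, Prog.eval, State.R_setReg, hA]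
  have h10 : s₁.R 10 = B := by simp [hs₁, Prog.eval, State.R_setReg, hB]
  have h33 : s₁.R 33 = s.M (B + p) := by
    simp [hs₁, Prog.eval, State.R_setReg, State.M_setReg, State.mem_reg, Op.eval_toNat, Op.nat,
      State.toNat_reg, hB, e1, e2]
  have h34 : s₁.R 34 = 0 := by simp [hs₁, Prog.eval, State.R_setReg]
  obtain ⟨s₂, hrun₂, -, -, -, hval, hmem⟩ := Run.rep (w := w) (f := mulStep N p)
    (fun j s' => s'.R 46 = A ∧ s'.R 10 = B ∧ s'.R 33 = s.M (B + p) ∧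
      num W (fun q => s'.M (B + N + q)) (2 * N) + s'.R 34 * W ^ (p + j) =
        num W (fun q => s.M (B + N + q)) (2 * N) +
          s.M (B + p) * W ^ p * num W (fun q => s.M (A + q)) j ∧
      ∀ a < W, a < B + N ∨ B + 3 * N ≤ a → s'.M a = s.M a) (2 * N - p) 15
    (fun s' v h => by simpa [State.R_setReg, State.M_setReg] using h)
    (fun j hj s' ⟨h1, h2, h3, h4, h5⟩ => by
      obtain ⟨s'', hrun, hv, hm⟩ := mulStep_run (p := p) (q := j) h1 h2 hAB hBw (by omega) hw
      refine ⟨s'', hrun, ?_, ?_, ?_, ?_, fun a ha ha' => (hm a ha (by omega)).trans (h5 a ha ha')⟩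
      · rw [hrun.R_eq (by simp [mulStep, Prog.Keeps]), h1]
      · rw [hrun.R_eq (by simp [mulStep, Prog.Keeps]), h2]
      · rw [hrun.R_eq (by simp [mulStep, Prog.Keeps]), h3]
      · have hu := num_update (W := W) (f := fun q => s'.M (B + N + q))
          (g := fun q => s''.M (B + N + q)) (l := 2 * N) (j := p + j) (by omega)
          (fun q hq hne => hm _ (by omega) (by omega))
        rw [h3, h5 (A + j) (by omega) (by omega), ← hW] at hv
        rw [num_succ, mul_add]
        have e : s.M (B + p) * W ^ p * (s.M (A + j) * W ^ j) = s.M (B + p) * s.M (A + j) * W ^ (p + j) := by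
          rw [pow_add]; ring
        rw [e]
        have h6 : s''.M (B + N + (p + j)) * W ^ (p + j) + s''.R 34 * W ^ (p + (j + 1)) =
            s'.M (B + N + (p + j)) * W ^ (p + j) + s.M (B + p) * s.M (A + j) * W ^ (p + j) +
              s'.R 34 * W ^ (p + j) := by
          rw [← add_assoc p, pow_succ, ← add_mul, ← add_mul, ← hv]; ring
        omega)
    (s := s₁) ⟨h46, h10, h33, by simp [num, h34, hM₁], fun a _ _ => hM₁ a⟩
  refine ⟨s₂, (hrun₁.seq hrun₂).mono ?_, ?_, hmem⟩
  · have : (2 * N - p) * 15 ≤ 2 * N * 15 := Nat.mul_le_mul_right _ (by omega)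
    omega
  · -- the digits of the parameter from `2 * N - p` on, and the last carry, do not matter
    have hsplit : W ^ p * num W (fun q => s.M (A + q)) (2 * N) ≡
        W ^ p * num W (fun q => s.M (A + q)) (2 * N - p) [MOD W ^ (2 * N)] := by
      have : num W (fun q => s.M (A + q)) (2 * N) = num W (fun q => s.M (A + q)) (2 * N - p) +
          W ^ (2 * N - p) * ∑ q ∈ Finset.range p, s.M (A + (2 * N - p + q)) * W ^ q := by
        have h2 : 2 * N = 2 * N - p + p := by omega
        conv_lhs => rw [h2, num, Finset.sum_range_add]
        rw [Finset.mul_sum]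
        congr 1
        refine Finset.sum_congr rfl fun q _ => ?_
        rw [pow_add]; ring
      rw [this, mul_add, ← mul_assoc, ← pow_add, show p + (2 * N - p) = 2 * N by omega]
      simp
    have hcarry : num W (fun q => s₂.M (B + N + q)) (2 * N) + s₂.R 34 * W ^ (p + (2 * N - p)) ≡
        num W (fun q => s₂.M (B + N + q)) (2 * N) [MOD W ^ (2 * N)] := by
      rw [show p + (2 * N - p) = 2 * N by omega]
      simp
    refine hcarry.symm.trans ?_
    rw [hval, mul_assoc, mul_assoc]
    exact (hsplit.symm.mul_left _).add_left _

lemma copyUpper_run {N B : ℕ} {s : State w} (hB : s.R 10 = B) (hBw : B + 3 * N ≤ 2 ^ w) :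
    ∃ s', Run (copyUpper N) s (6 * N + 1) s' ∧ (∀ q < N, s'.M (B + q) = s.M (B + N + (N + q))) ∧
      ∀ a < 2 ^ w, a < B ∨ B + N ≤ a → s'.M a = s.M a := by
  obtain ⟨s', h, -, h₁, h₂⟩ := Run.rep (w := w) (f := fun q =>
      .const 30 (2 * N + q) ;; .bin .add 31 10 30 ;; .load 32 31 ;;
      .const 30 q ;; .bin .add 31 10 30 ;; .store 31 32)
    (fun j s' => s'.R 10 = B ∧ (∀ q < j, s'.M (B + q) = s.M (B + N + (N + q))) ∧
      ∀ a < 2 ^ w, a < B ∨ B + j ≤ a → s'.M a = s.M a) N 6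
    (fun s' v h => by simpa [State.R_setReg, State.M_setReg] using h)
    (fun j hj s' ⟨h2, h3, h4⟩ => ⟨_, run_eval (by simp [Prog.LoopFree]) s', by
      have e1 : (2 * N + j) % 2 ^ w = 2 * N + j := Nat.mod_eq_of_lt (by omega)
      have e2 : j % 2 ^ w = j := Nat.mod_eq_of_lt (by omega)
      have e3 : (B + (2 * N + j)) % 2 ^ w = B + (2 * N + j) := Nat.mod_eq_of_lt (by omega)
      have e4 : (B + j) % 2 ^ w = B + j := Nat.mod_eq_of_lt (by omega)
      have e5 : s'.M (B + (2 * N + j)) = s.M (B + N + (N + j)) := by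
        rw [h4 _ (by omega) (by omega)]; congr 1; ring
      have hM : ∀ a < 2 ^ w, (Prog.eval (.const 30 (2 * N + j) ;; .bin .add 31 10 30 ;; .load 32 31 ;;
          .const 30 j ;; .bin .add 31 10 30 ;; .store 31 32) s').M a =
          if a = B + j then s.M (B + N + (N + j)) else s'.M a := by
        intro a ha
        simp only [Prog.eval]
        rw [State.M_setMem _ _ _ ha]
        simp [State.M_setReg, State.R_setReg, State.mem_reg, Op.eval_toNat, Op.nat, State.toNat_reg, h2,
          e1, e2, e3, e4, e5]
      refine ⟨by simp [Prog.eval, State.R_setReg, State.R_setMem, h2], fun q hq => ?_, fun a ha ha' => ?_⟩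
      · rw [hM _ (by omega)]
        split_ifs with h
        · congr 1; omega
        · exact h3 q (by omega)
      · rw [hM _ ha, if_neg (by omega)]
        exact h4 a ha (by omega)⟩)
    (s := s) ⟨hB, by simp, fun _ _ _ => rfl⟩
  exact ⟨s', h.mono (by omega), h₁, h₂⟩

/-- The program computes the hash function. -/
lemma mulShiftProg_run {N A B : ℕ} {s : State w} (hA : s.R 46 = A) (hB : s.R 10 = B)
    (hAB : A + 4 * N ≤ B) (hBw : B + 3 * N ≤ 2 ^ w) (hw : 1 < 2 ^ w)
    {a c : BitVec (2 * (N * w))} {x : BitVec (N * w)} (ha : StoredAt s A (2 * N) a)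
    (hc : StoredAt s (A + 2 * N) (2 * N) c) (hx : StoredAt s B N x) :
    ∃ s', Run (mulShiftProg N) s (30 * N * N + 30 * N + 10) s' ∧
      StoredAt s' B N (multShift a c x) ∧
      ∀ a < 2 ^ w, a < B ∨ B + 3 * N ≤ a → s'.M a = s.M a := by
  have h2N : 2 * (N * w) = 2 * N * w := by ring
  set W := 2 ^ w with hW
  have ha' := ha.num_eq h2N
  have hc' := hc.num_eq h2N
  have hx' := hx.num_eq rfl
  rw [← hW] at ha' hc' hx'
  obtain ⟨s₁, hrun₁, hcopy, hmem₁⟩ := copyParam_run hA hB hAB hBw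
  have h46 : s₁.R 46 = A := by
    rw [hrun₁.R_eq (mulShiftProg_keeps (N := N) (by omega)).1, hA]
  have h10 : s₁.R 10 = B := by
    rw [hrun₁.R_eq (mulShiftProg_keeps (N := N) (by omega)).1, hB]
  obtain ⟨s₂, hrun₂, -, h10', hval, hmem₂⟩ := Run.rep (w := w) (f := mulRow N)
    (fun p s' => s'.R 46 = A ∧ s'.R 10 = B ∧
      num W (fun q => s'.M (B + N + q)) (2 * N) ≡
        c.toNat + num W (fun q => s.M (B + q)) p * a.toNat [MOD W ^ (2 * N)] ∧
      ∀ a < W, a < B + N ∨ B + 3 * N ≤ a → s'.M a = s.M a) N (30 * N + 5)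
    (fun s' v h => by simpa [State.R_setReg, State.M_setReg] using h)
    (fun p hp s' ⟨h1, h2, h3, h4⟩ => by
      obtain ⟨s'', hrun, hv, hm⟩ := mulRow_run h1 h2 hAB hBw hp hw
      have hk : ∀ i, i < 30 ∨ 41 < i → (mulRow N p).Keeps i := fun i hi => by
        refine ⟨?_, rep_keeps (by omega) fun q => ?_⟩
        all_goals
          simp [mulStep, Prog.Keeps]
          omega
      refine ⟨s'', hrun, ?_, ?_, ?_, fun a ha ha' => (hm a ha ha').trans (h4 a ha ha')⟩
      · rw [hrun.R_eq (hk _ (by omega)), h1]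
      · rw [hrun.R_eq (hk _ (by omega)), h2]
      · refine hv.trans ?_
        rw [h4 (B + p) (by omega) (by omega), num_congr (g := fun q => s.M (A + q))
          (fun q hq => h4 (A + q) (by omega) (by omega)), ← hW, ha', num_succ, add_mul, ← add_assoc]
        exact h3.add_right _)
    (s := s₁) ⟨h46, h10, by
      rw [num_congr hcopy, hc']
      simp [num, Nat.ModEq.refl], hmem₁⟩
  obtain ⟨s₃, hrun₃, hup, hmem₃⟩ := copyUpper_run h10' hBw
  refine ⟨s₃, (hrun₁.seq (hrun₂.seq hrun₃)).mono ?_, ?_, fun b hb hb' => ?_⟩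
  · nlinarith
  · rw [storedAt_iff]
    intro q hq
    rw [hup q hq, ← hW]
    have hlt : ∀ q < 2 * N, (fun q => s₂.M (B + N + q)) q < W := fun q _ => s₂.M_lt _
    rw [← num_digit (l := 2 * N) (by omega) hlt (show N + q < 2 * N by omega)]
    have hnum : num W (fun q => s₂.M (B + N + q)) (2 * N) = (a * x.setWidth (2 * (N * w)) + c).toNat := by
      rw [← Nat.mod_eq_of_lt (num_lt hlt), hval, hx', BitVec.toNat_add, BitVec.toNat_mul,
        BitVec.toNat_setWidth, hW, ← pow_mul, Nat.mul_mod_mod, Nat.mod_add_mod, add_comm, mul_comm x.toNat]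
      congr 2
      ring
    rw [hnum, multShift, BitVec.extractLsb'_toNat, Nat.shiftRight_eq_div_pow, pow_add, ← Nat.div_div_eq_div_mul]
    have e : 2 ^ (N * w) = W ^ N := by rw [hW, ← pow_mul, mul_comm]
    have e2 : 2 ^ (N * w) = W ^ q * (W * W ^ (N - q - 1)) := by
      rw [e, ← pow_succ', ← pow_add]
      congr 1; omega
    rw [← e]
    conv_rhs => rw [e2, Nat.mod_mul_right_div_self, Nat.mod_mul_right_mod]
    rw [← e2]
  · rw [hmem₃ b hb (by omega), hmem₂ b hb (by omega)]

end

section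
variable {w : ℕ}

/-! ### The program for the generator -/

/-- Apply `h (k - 1)`, …, `h 0` in this order. -/
def descend {α : Type*} (h : ℕ → α → α) : ℕ → α → α
  | 0, x => x
  | k + 1, x => descend h k (h k x)

lemma descend_congr {α : Type*} {h h' : ℕ → α → α} : ∀ {k : ℕ}, (∀ i < k, h i = h' i) →
    ∀ x, descend h k x = descend h' k x
  | 0, _, _ => rfl
  | k + 1, hh, x => by
    rw [descend, descend, hh k (by omega), descend_congr (k := k) fun i hi => hh i (by omega)]

lemma gen_eq_descend {n b : ℕ} : ∀ {k : ℕ} (h : Fin k → Fin b → BitVec n → BitVec n) (x : BitVec n)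
    (j : Fin k → Fin b),
    gen h x j = descend (fun i y => if hi : i < k then h ⟨i, hi⟩ (j ⟨i, hi⟩) y else y) k x
  | 0, _, _, _ => rfl
  | k + 1, h, x, j => by
    rw [gen, gen_eq_descend (k := k), descend]
    simp only [Nat.lt_succ_self, dif_pos]
    refine descend_congr (fun i hi => ?_) _
    funext y
    rw [dif_pos hi, dif_pos (by omega)]
    rfl

lemma StoredAt.congr {m : ℕ} {s s' : State w} {a l : ℕ} {v : BitVec m} (h : StoredAt s a l v)
    (hM : ∀ q < l, s'.M (a + q) = s.M (a + q)) : StoredAt s' a l v := by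
  rw [storedAt_iff] at h ⊢
  exact fun q hq => (hM q hq).trans (h q hq)

/-- The seed is stored from address `6` on. -/
def SeedAt {N b k : ℕ} (s : State w) (σ : Seed (N * w) b k) : Prop :=
  StoredAt s 6 N σ.1 ∧ ∀ (i : Fin k) (j : Fin b),
    StoredAt s (6 + N + (i * b + j) * (4 * N)) (2 * N) (σ.2 i j).1 ∧
    StoredAt s (6 + N + (i * b + j) * (4 * N) + 2 * N) (2 * N) (σ.2 i j).2

lemma param_addr_le {N b k i j : ℕ} (hi : i < k) (hj : j < b) :
    6 + N + (i * b + j) * (4 * N) + 4 * N ≤ descrWords N b k := by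
  have h1 : i * b + j + 1 ≤ k * b := by
    have : (i + 1) * b ≤ k * b := Nat.mul_le_mul_right _ hi
    nlinarith
  have h2 := Nat.mul_le_mul_right (4 * N) h1
  rw [descrWords]
  nlinarith

lemma SeedAt.congr {N b k : ℕ} {s s' : State w} {σ : Seed (N * w) b k} (h : SeedAt s σ)
    (hM : ∀ a < descrWords N b k, s'.M a = s.M a) : SeedAt s' σ := by
  refine ⟨h.1.congr fun q hq => hM _ ?_, fun i j => ⟨(h.2 i j).1.congr fun q hq => hM _ ?_,
    (h.2 i j).2.congr fun q hq => hM _ ?_⟩⟩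
  · unfold descrWords; omega
  · have := param_addr_le (N := N) i.isLt j.isLt; omega
  · have := param_addr_le (N := N) i.isLt j.isLt; omega

/-- The registers `2` to `11` hold the parameters of the sketch: `d`, `t`, `r`, `b`, `k`, the
number `1`, the word size, the addresses of the table and of the free memory behind it, and
`b ^ k`. -/
structure Ready (s : State w) (N d τ r b k : ℕ) : Prop where
  reg_d : s.R 2 = d
  reg_t : s.R 3 = 2 ^ τ
  reg_r : s.R 4 = r
  reg_b : s.R 5 = b
  reg_k : s.R 6 = k
  reg_one : s.R 7 = 1
  reg_w : s.R 8 = w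
  reg_table : s.R 9 = descrWords N b k
  reg_free : s.R 10 = descrWords N b k + r * 2 ^ τ
  reg_pow : s.R 11 = b ^ k

lemma Ready.of_keeps {s s' : State w} {N d τ r b k t : ℕ} {p : Prog} (h : Ready s N d τ r b k)
    (hr : Run p s t s') (hp : ∀ i, 2 ≤ i → i ≤ 11 → p.Keeps i) : Ready s' N d τ r b k where
  reg_d := (hr.R_eq (hp _ (by omega) (by omega))).trans h.reg_d
  reg_t := (hr.R_eq (hp _ (by omega) (by omega))).trans h.reg_t
  reg_r := (hr.R_eq (hp _ (by omega) (by omega))).trans h.reg_r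
  reg_b := (hr.R_eq (hp _ (by omega) (by omega))).trans h.reg_b
  reg_k := (hr.R_eq (hp _ (by omega) (by omega))).trans h.reg_k
  reg_one := (hr.R_eq (hp _ (by omega) (by omega))).trans h.reg_one
  reg_w := (hr.R_eq (hp _ (by omega) (by omega))).trans h.reg_w
  reg_table := (hr.R_eq (hp _ (by omega) (by omega))).trans h.reg_table
  reg_free := (hr.R_eq (hp _ (by omega) (by omega))).trans h.reg_free
  reg_pow := (hr.R_eq (hp _ (by omega) (by omega))).trans h.reg_pow

/-- The numerical conditions under which the programs work: nothing overflows. -/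
structure Fits (w N d τ r b k : ℕ) : Prop where
  one_lt : 1 < 2 ^ w
  hN : 0 < N
  hb : 0 < b
  hd : 0 < d
  rd_le : r * d ≤ b ^ k
  pow_lt : b ^ k < 2 ^ w
  tau_le : τ ≤ w
  mem : descrWords N b k + r * 2 ^ τ + (3 * N + 8 * r + 64) ≤ 2 ^ w

/-- Copy the start block of the generator to the free memory. -/
def copySeed (N : ℕ) : Prog := rep N fun q =>
  .const 30 (6 + q) ;; .load 32 30 ;; .const 30 q ;; .bin .add 31 10 30 ;; .store 31 32

/-- The start block of the seed has the addresses `6` to `6 + N - 1`. -/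
lemma copySeed_run {N B : ℕ} {s : State w} (hB : s.R 10 = B) (h6 : 6 + N ≤ B) (hBw : B + N ≤ 2 ^ w) :
    ∃ s', Run (copySeed N) s (5 * N + 1) s' ∧ (∀ q < N, s'.M (B + q) = s.M (6 + q)) ∧
      ∀ a < 2 ^ w, a < B ∨ B + N ≤ a → s'.M a = s.M a := by
  obtain ⟨s', h, -, h₁, h₂⟩ := Run.rep (w := w) (f := fun q =>
      .const 30 (6 + q) ;; .load 32 30 ;; .const 30 q ;; .bin .add 31 10 30 ;; .store 31 32)
    (fun j s' => s'.R 10 = B ∧ (∀ q < j, s'.M (B + q) = s.M (6 + q)) ∧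
      ∀ a < 2 ^ w, a < B ∨ B + j ≤ a → s'.M a = s.M a) N 5
    (fun s' v h => by simpa [State.R_setReg, State.M_setReg] using h)
    (fun j hj s' ⟨h2, h3, h4⟩ => ⟨_, run_eval (by simp [Prog.LoopFree]) s', by
      have e1 : (6 + j) % 2 ^ w = 6 + j := Nat.mod_eq_of_lt (by omega)
      have e2 : j % 2 ^ w = j := Nat.mod_eq_of_lt (by omega)
      have e4 : (B + j) % 2 ^ w = B + j := Nat.mod_eq_of_lt (by omega)
      have e5 : s'.M (6 + j) = s.M (6 + j) := h4 _ (by omega) (by omega)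
      have hM : ∀ a < 2 ^ w, (Prog.eval (.const 30 (6 + j) ;; .load 32 30 ;;
          .const 30 j ;; .bin .add 31 10 30 ;; .store 31 32) s').M a =
          if a = B + j then s.M (6 + j) else s'.M a := by
        intro a ha
        simp only [Prog.eval]
        rw [State.M_setMem _ _ _ ha]
        simp [State.M_setReg, State.R_setReg, State.mem_reg, Op.eval_toNat, Op.nat, State.toNat_reg, h2,
          e1, e2, e4, e5]
      refine ⟨by simp [Prog.eval, State.R_setReg, State.R_setMem, h2], fun q hq => ?_, fun a ha ha' => ?_⟩
      · rw [hM _ (by omega)]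
        split_ifs with h
        · congr 1; omega
        · exact h3 q (by omega)
      · rw [hM _ ha, if_neg (by omega)]
        exact h4 a ha (by omega)⟩)
    (s := s) ⟨hB, by simp, fun _ _ _ => rfl⟩
  exact ⟨s', h.mono (by omega), h₁, h₂⟩

/-- Decrease the level in register `47`, and find the address of the parameters of the hash
function that the digit of `J` at this level selects. -/
def selectHash (N : ℕ) : Prog :=
  .bin .sub 47 47 7 ;; .bin .div 48 48 5 ;; .bin .div 49 15 48 ;; .bin .mod 49 49 5 ;;
  .bin .mul 50 47 5 ;; .bin .add 50 50 49 ;; .const 51 (4 * N) ;; .bin .mul 50 50 51 ;;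
  .const 51 (6 + N) ;; .bin .add 46 50 51

/-- The program that computes the block of the generator whose number is in register `15`, and
stores it at the address in register `10`. -/
def genProg (N : ℕ) : Prog :=
  copySeed N ;; (.bin .bor 47 6 6 ;; .bin .bor 48 11 11) ;; .loop 47 (selectHash N ;; mulShiftProg N)

lemma genProg_keeps {N i : ℕ} (hi : i < 30 ∨ 51 < i) : (genProg N).Keeps i := by
  refine ⟨rep_keeps (by omega) fun q => ?_, ?_, ?_, mulShiftProg_keeps (by omega)⟩
  all_goals
    simp [selectHash, Prog.Keeps]
    omega

lemma selectHash_run {N b i J : ℕ} {s : State w} (h5 : s.R 5 = b) (h7 : s.R 7 = 1)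
    (h15 : s.R 15 = J) (h47 : s.R 47 = i + 1) (h48 : s.R 48 = b ^ (i + 1)) (hb : 0 < b)
    (hA : 6 + N + (i * b + J / b ^ i % b) * (4 * N) + 4 * N < 2 ^ w) (hN : 0 < N) :
    ∃ s', Run (selectHash N) s 10 s' ∧ s'.R 47 = i ∧ s'.R 48 = b ^ i ∧
      s'.R 46 = 6 + N + (i * b + J / b ^ i % b) * (4 * N) ∧ ∀ a, s'.M a = s.M a := by
  refine ⟨_, run_eval (by simp [selectHash, Prog.LoopFree]) s, ?_, ?_, ?_, fun a => rfl⟩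
  all_goals
    have hi := s.R_lt 47
    rw [h47] at hi
    have e1 : (2 ^ w - 1 + (i + 1)) % 2 ^ w = i := by
      rw [show 2 ^ w - 1 + (i + 1) = i + 2 ^ w by omega, Nat.add_mod_right, Nat.mod_eq_of_lt (by omega)]
    have e2 : b ^ (i + 1) / b = b ^ i := by rw [pow_succ, Nat.mul_div_cancel _ hb]
    set D := J / b ^ i % b with hD
    have hle : i * b + D ≤ (i * b + D) * (4 * N) := Nat.le_mul_of_pos_right _ (by omega)
    have e3 : i * b % 2 ^ w = i * b := Nat.mod_eq_of_lt (by omega)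
    have e4 : (i * b + D) % 2 ^ w = i * b + D := Nat.mod_eq_of_lt (by omega)
    have e5 : 4 * N % 2 ^ w = 4 * N := Nat.mod_eq_of_lt (by omega)
    have e6 : (i * b + D) * (4 * N) % 2 ^ w = (i * b + D) * (4 * N) := Nat.mod_eq_of_lt (by omega)
    have e7 : (6 + N) % 2 ^ w = 6 + N := Nat.mod_eq_of_lt (by omega)
    have e8 : ((i * b + D) * (4 * N) + (6 + N)) % 2 ^ w = 6 + N + (i * b + D) * (4 * N) := by
      rw [Nat.mod_eq_of_lt (by omega)]; ring
    simp [selectHash, Prog.eval, State.R_setReg, Op.eval_toNat, Op.nat, State.toNat_reg, h5, h7, h15, h47,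
      h48, e1, e2, e3, e4, e5, e6, e7, e8, ← hD, -Nat.mod_add_mod, -Nat.add_mod_mod, -Nat.mod_mul_mod,
      -Nat.mul_mod_mod]

/-- The program computes the blocks of FastPRG. -/
lemma genProg_run {N d τ r b k J : ℕ} {s : State w} (hF : Fits w N d τ r b k)
    (hR : Ready s N d τ r b k) {σ : Seed (N * w) b k} (hσ : SeedAt s σ) (h15 : s.R 15 = J)
    (hJ : J < b ^ k) :
    ∃ s', Run (genProg N) s (k * (30 * N * N + 30 * N + 21) + 5 * N + 4) s' ∧
      StoredAt s' (descrWords N b k + r * 2 ^ τ) N (fastPRG σ J) ∧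
      ∀ a < 2 ^ w, a < descrWords N b k + r * 2 ^ τ ∨ descrWords N b k + r * 2 ^ τ + 3 * N ≤ a →
        s'.M a = s.M a := by
  have hmem := hF.mem
  have hw := hF.one_lt
  set B := descrWords N b k + r * 2 ^ τ with hBdef
  have hTB : descrWords N b k ≤ B := Nat.le_add_right _ _
  have h6N : 6 + N ≤ descrWords N b k := Nat.le_add_right _ _
  obtain ⟨s₁, hrun₁, hcopy, hmem₁⟩ :=
    copySeed_run (N := N) (B := B) hR.reg_free (by omega) (by omega)
  have hk₁ : ∀ i, i < 30 ∨ 51 < i → (copySeed N).Keeps i := fun i hi => (genProg_keeps (N := N) hi).1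
  have hR₁ := hR.of_keeps hrun₁ fun i h1 h2 => hk₁ i (by omega)
  have h15₁ : s₁.R 15 = J := by rw [hrun₁.R_eq (hk₁ 15 (by omega)), h15]
  set s₂ := (Prog.bin .bor 47 6 6 ;; .bin .bor 48 11 11).eval s₁ with hs₂
  have hrun₂ : Run (.bin .bor 47 6 6 ;; .bin .bor 48 11 11) s₁ 2 s₂ :=
    run_eval (by simp [Prog.LoopFree]) s₁
  have hR₂ := hR₁.of_keeps hrun₂ fun i h1 h2 => by simp [Prog.Keeps]; omega
  have h15₂ : s₂.R 15 = J := by rw [hrun₂.R_eq (by simp [Prog.Keeps]), h15₁]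
  have h47 : s₂.R 47 = k := by
    simp [hs₂, Prog.eval, State.R_setReg, Op.eval_toNat, Op.nat, State.toNat_reg, hR₁.reg_k]
  have h48 : s₂.R 48 = b ^ k := by
    simp [hs₂, Prog.eval, State.R_setReg, Op.eval_toNat, Op.nat, State.toNat_reg, hR₁.reg_pow]
  have hM₂ : ∀ a, s₂.M a = s₁.M a := fun a => rfl
  let H : ℕ → BitVec (N * w) → BitVec (N * w) := fun i y => if hi : i < k then
    multShift (σ.2 ⟨i, hi⟩ ⟨J / b ^ i % b, Nat.mod_lt _ hF.hb⟩).1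
      (σ.2 ⟨i, hi⟩ ⟨J / b ^ i % b, Nat.mod_lt _ hF.hb⟩).2 y else y
  have hval : fastPRG σ J = descend H k σ.1 := by
    rw [fastPRG, dif_pos hJ, gen_eq_descend]
    rfl
  obtain ⟨s₃, hrun₃, -, -, -, -, hst, hmem₃⟩ := Run.loop (w := w) (x := 47)
    (p := selectHash N ;; mulShiftProg N)
    (fun j s' => Ready s' N d τ r b k ∧ s'.R 15 = J ∧ s'.R 47 = k - j ∧ s'.R 48 = b ^ (k - j) ∧
      (∃ y, StoredAt s' B N y ∧ descend H (k - j) y = descend H k σ.1) ∧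
      ∀ a < 2 ^ w, a < B ∨ B + 3 * N ≤ a → s'.M a = s.M a) k (30 * N * N + 30 * N + 20)
    (by
      rintro j hj s' ⟨hR', h15', h47', h48', ⟨y, hy, hdesc⟩, hm'⟩
      refine ⟨by omega, ?_⟩
      obtain ⟨i, hi⟩ : ∃ i, k - j = i + 1 := ⟨k - j - 1, by omega⟩
      have hik : i < k := by omega
      rw [hi] at h47' h48' hdesc
      have hA := param_addr_le (N := N) hik (Nat.mod_lt (J / b ^ i) hF.hb)
      obtain ⟨s₄, hrun₄, g47, g48, g46, hM₄⟩ := selectHash_run (N := N) hR'.reg_b hR'.reg_one h15' h47' h48' hF.hb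
        (by omega) hF.hN
      have hks : ∀ i, i < 30 ∨ 51 < i → (selectHash N).Keeps i := fun i hi =>
        (genProg_keeps (N := N) hi).2.2.1
      have hR₄ := hR'.of_keeps hrun₄ fun i h1 h2 => hks i (by omega)
      have hσ' : SeedAt s₄ σ := hσ.congr fun a ha => by rw [hM₄, hm' a (by omega) (by omega)]
      have hpar := hσ'.2 ⟨i, hik⟩ ⟨J / b ^ i % b, Nat.mod_lt _ hF.hb⟩
      obtain ⟨s₅, hrun₅, hy', hM₅⟩ := mulShiftProg_run g46 hR₄.reg_free (by omega) (by omega) hw hpar.1 hpar.2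
        (hy.congr fun q _ => hM₄ _)
      have hkm : ∀ i, i < 30 ∨ 41 < i → (mulShiftProg N).Keeps i := fun i hi => mulShiftProg_keeps hi
      have hki : k - (j + 1) = i := by omega
      refine ⟨s₅, (hrun₄.seq hrun₅).mono (by omega), ?_, ?_, ?_, ?_, ⟨_, hy', ?_⟩, ?_⟩
      · exact hR₄.of_keeps hrun₅ fun i h1 h2 => hkm i (by omega)
      · rw [hrun₅.R_eq (hkm _ (by omega)), hrun₄.R_eq (hks _ (by omega)), h15']
      · rw [hrun₅.R_eq (hkm _ (by omega)), g47, hki]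
      · rw [hrun₅.R_eq (hkm _ (by omega)), g48, hki]
      · rw [hki, ← hdesc, descend]
        simp only [H, hik, dif_pos]
      · intro a ha ha'
        rw [hM₅ a ha ha', hM₄, hm' a ha ha'])
    (fun s' h => by rw [h.2.2.1]; omega)
    (s := s₂) ⟨hR₂, h15₂, by simpa using h47, by simpa using h48,
      ⟨σ.1, by
        rw [storedAt_iff]
        intro q hq
        rw [hM₂, hcopy q hq]
        exact (storedAt_iff _ _ _ _).1 hσ.1 q hq, by simp⟩,
      fun a ha ha' => by rw [hM₂, hmem₁ a ha (by omega)]⟩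
  obtain ⟨y, hy, hdesc⟩ := hst
  refine ⟨s₃, (hrun₁.seq (hrun₂.seq hrun₃)).mono (by nlinarith), ?_, hmem₃⟩
  rw [Nat.sub_self, descend] at hdesc
  rw [hval, ← hdesc]
  exact hy

end

section
variable {w : ℕ}

/-! ### Locating the table cell of a row -/

/-- Load the parameters from the memory into the registers. -/
def loadParams : Prog :=
  .const 30 1 ;; .load 2 30 ;; .const 30 2 ;; .load 3 30 ;; .const 30 3 ;; .load 4 30 ;;
  .const 30 4 ;; .load 5 30 ;; .const 30 5 ;; .load 6 30 ;; .const 7 1 ;; .const 30 0 ;; .load 8 30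

/-- Compute the addresses of the table and of the free memory, and initialise the computation of
`b ^ k`. -/
def loadAddrs (N : ℕ) : Prog :=
  .bin .mul 9 6 5 ;; .const 30 (4 * N) ;; .bin .mul 9 9 30 ;; .const 30 (6 + N) ;; .bin .add 9 30 9 ;;
  .bin .mul 10 4 3 ;; .bin .add 10 9 10 ;; .const 11 1 ;; .bin .bor 12 6 6

/-- Fill the registers `2` to `11`; see `Ready`. -/
def setupProg (N : ℕ) : Prog :=
  (loadParams ;; loadAddrs N) ;; .loop 12 (.bin .mul 11 11 5 ;; .bin .sub 12 12 7)

/-- The memory holds the parameters of the sketch. -/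
structure ParamsAt (s : State w) (d τ r b k : ℕ) : Prop where
  cell_w : s.M 0 = w
  cell_d : s.M 1 = d
  cell_t : s.M 2 = 2 ^ τ
  cell_r : s.M 3 = r
  cell_b : s.M 4 = b
  cell_k : s.M 5 = k

lemma sub_one_mod {w j : ℕ} (hj : j + 1 < 2 ^ w) : (2 ^ w - 1 + (j + 1)) % 2 ^ w = j := by
  rw [show 2 ^ w - 1 + (j + 1) = j + 2 ^ w by omega, Nat.add_mod_right, Nat.mod_eq_of_lt (by omega)]

lemma setupProg_keeps {N i : ℕ} (hi : i < 2 ∨ 12 < i ∧ i ≠ 30) : (setupProg N).Keeps i := by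
  simp [setupProg, loadParams, loadAddrs, Prog.Keeps]
  omega

lemma setupProg_run {N d τ r b k : ℕ} {s : State w} (hF : Fits w N d τ r b k)
    (hP : ParamsAt s d τ r b k) :
    ∃ s', Run (setupProg N) s (3 * k + 23) s' ∧ Ready s' N d τ r b k ∧ s'.mem = s.mem := by
  have hw := hF.one_lt
  have hmem := hF.mem
  have hN := hF.hN
  have hdw : descrWords N b k = 6 + N + k * b * (4 * N) := rfl
  have hkb : k * b ≤ k * b * (4 * N) := Nat.le_mul_of_pos_right _ (by omega)
  have c1 : 1 % 2 ^ w = 1 := Nat.mod_eq_of_lt hw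
  have c2 : 2 % 2 ^ w = 2 := Nat.mod_eq_of_lt (by omega)
  have c3 : 3 % 2 ^ w = 3 := Nat.mod_eq_of_lt (by omega)
  have c4 : 4 % 2 ^ w = 4 := Nat.mod_eq_of_lt (by omega)
  have c5 : 5 % 2 ^ w = 5 := Nat.mod_eq_of_lt (by omega)
  have e1 : 4 * N % 2 ^ w = 4 * N := Nat.mod_eq_of_lt (by omega)
  have e2 : (6 + N) % 2 ^ w = 6 + N := Nat.mod_eq_of_lt (by omega)
  have e3 : k * b % 2 ^ w = k * b := Nat.mod_eq_of_lt (by omega)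
  have e4 : k * b * (4 * N) % 2 ^ w = k * b * (4 * N) := Nat.mod_eq_of_lt (by omega)
  have e5 : (6 + N + k * b * (4 * N)) % 2 ^ w = descrWords N b k := by
    rw [← hdw]; exact Nat.mod_eq_of_lt (by omega)
  have e6 : r * 2 ^ τ % 2 ^ w = r * 2 ^ τ := Nat.mod_eq_of_lt (by omega)
  have e7 : (descrWords N b k + r * 2 ^ τ) % 2 ^ w = descrWords N b k + r * 2 ^ τ :=
    Nat.mod_eq_of_lt (by omega)
  obtain ⟨s₀, hrun₀, f2, f3, f4, f5, f6, f7, f8, hmem₀⟩ : ∃ s₀, Run loadParams s 13 s₀ ∧ s₀.R 2 = d ∧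
      s₀.R 3 = 2 ^ τ ∧ s₀.R 4 = r ∧ s₀.R 5 = b ∧ s₀.R 6 = k ∧ s₀.R 7 = 1 ∧ s₀.R 8 = w ∧
      s₀.mem = s.mem := by
    refine ⟨_, run_eval (by simp [loadParams, Prog.LoopFree]) s, ?_, ?_, ?_, ?_, ?_, ?_, ?_, rfl⟩ <;>
    simp [loadParams, Prog.eval, State.R_setReg, State.M_setReg, State.mem_reg, hP.cell_w, hP.cell_d,
      hP.cell_t, hP.cell_r, hP.cell_b, hP.cell_k, c1, c2, c3, c4, c5]
  obtain ⟨s₁, hrun₁, hold, g9, g10, g11, g12, hmem₁⟩ : ∃ s₁, Run (loadAddrs N) s₀ 9 s₁ ∧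
      (∀ i < 9, s₁.R i = s₀.R i) ∧ s₁.R 9 = descrWords N b k ∧
      s₁.R 10 = descrWords N b k + r * 2 ^ τ ∧ s₁.R 11 = 1 ∧ s₁.R 12 = k ∧ s₁.mem = s₀.mem := by
    have hrun := run_eval (p := loadAddrs N) (by simp [loadAddrs, Prog.LoopFree]) s₀
    refine ⟨_, hrun, fun i hi => hrun.R_eq (by simp [loadAddrs, Prog.Keeps]; omega), ?_, ?_, ?_, ?_, rfl⟩ <;>
    simp [loadAddrs, Prog.eval, State.R_setReg, Op.eval_toNat, Op.nat, State.toNat_reg, f3, f4, f5, f6,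
      c1, e1, e2, e3, e4, e5, e6, e7, -Nat.mod_add_mod, -Nat.add_mod_mod, -Nat.mod_mul_mod,
      -Nat.mul_mod_mod]
  have g2 := (hold 2 (by omega)).trans f2
  have g3 := (hold 3 (by omega)).trans f3
  have g4 := (hold 4 (by omega)).trans f4
  have g5 := (hold 5 (by omega)).trans f5
  have g6 := (hold 6 (by omega)).trans f6
  have g7 := (hold 7 (by omega)).trans f7
  have g8 := (hold 8 (by omega)).trans f8
  obtain ⟨s₂, hrun₂, hregs, hmem₂, hpow, -⟩ := Run.loop (w := w) (x := 12)
    (p := .bin .mul 11 11 5 ;; .bin .sub 12 12 7)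
    (fun j s' => (∀ i, i ≠ 11 → i ≠ 12 → s'.reg i = s₁.reg i) ∧ s'.mem = s.mem ∧ s'.R 11 = b ^ j ∧
      s'.R 12 = k - j) k 2
    (by
      rintro j hj s' ⟨h1, h2, h3, h4⟩
      obtain ⟨i, hi⟩ : ∃ i, k - j = i + 1 := ⟨k - j - 1, by omega⟩
      have hlt := s'.R_lt 12
      refine ⟨by omega, _, run_eval (by simp [Prog.LoopFree]) s', fun i hi1 hi2 => ?_, h2, ?_, ?_⟩
      · simp [Prog.eval, State.setReg, hi1, hi2, h1 i hi1 hi2]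
      · have h5 : s'.R 5 = b := by rw [State.R, h1 5 (by omega) (by omega), State.toNat_reg, g5]
        have : b ^ j * b % 2 ^ w = b ^ (j + 1) := by
          rw [← pow_succ]
          exact Nat.mod_eq_of_lt ((Nat.pow_le_pow_right hF.hb hj).trans_lt hF.pow_lt)
        simp [Prog.eval, State.R_setReg, Op.eval_toNat, Op.nat, State.toNat_reg, h3, h5, this]
      · have h7 : s'.R 7 = 1 := by rw [State.R, h1 7 (by omega) (by omega), State.toNat_reg, g7]
        have : (2 ^ w - 1 + (i + 1)) % 2 ^ w = k - (j + 1) := by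
          rw [sub_one_mod (by omega)]; omega
        simp [Prog.eval, State.R_setReg, Op.eval_toNat, Op.nat, State.toNat_reg, h4, h7, hi, this])
    (fun s' h => by rw [h.2.2.2]; omega)
    (s := s₁) ⟨fun i _ _ => rfl, hmem₁.trans hmem₀, by simpa using g11, by simpa using g12⟩
  have hreg : ∀ i, i ≠ 11 → i ≠ 12 → s₂.R i = s₁.R i := fun i h1 h2 => by
    rw [State.R, hregs i h1 h2, State.toNat_reg]
  refine ⟨s₂, ((hrun₀.seq hrun₁).seq hrun₂).mono (by omega), ⟨?_, ?_, ?_, ?_, ?_, ?_, ?_, ?_, ?_, hpow⟩, hmem₂⟩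
  all_goals
    rw [hreg _ (by omega) (by omega)]
    assumption

/-- From the block in the free memory, compute the sign bit (register `53`) and the address of the
table cell (register `55`) for the row whose number is in register `13`. -/
def readBlock (N : ℕ) : Prog :=
  .load 52 10 ;; .bin .mod 52 52 3 ;; .const 30 (N - 1) ;; .bin .add 31 10 30 ;; .load 53 31 ;;
  .bin .sub 54 8 7 ;; .bin .shr 53 53 54 ;; .bin .mul 55 13 3 ;; .bin .add 55 9 55 ;; .bin .add 55 55 52

/-- Find the sign and the table cell of coordinate `ℓ` (register `0`) in the row whose number is in
register `13`. -/
def locateProg (N : ℕ) : Prog :=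
  (.bin .mul 15 13 2 ;; .bin .add 15 15 0) ;; genProg N ;; readBlock N

lemma locateProg_keeps {N i : ℕ} (hi : i < 15 ∨ 55 < i) : (locateProg N).Keeps i := by
  refine ⟨?_, genProg_keeps (by omega), ?_⟩
  all_goals
    simp [readBlock, Prog.Keeps]
    omega

lemma locateProg_run {N d τ r b k : ℕ} {s : State w} (hF : Fits w N d τ r b k)
    (hR : Ready s N d τ r b k) {σ : Seed (N * w) b k} (hσ : SeedAt s σ) (ℓ : Fin d) (i : Fin r)
    (h0 : s.R 0 = ℓ) (h13 : s.R 13 = i) :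
    ∃ s', Run (locateProg N) s (k * (30 * N * N + 30 * N + 21) + 5 * N + 16) s' ∧
      s'.R 55 = descrWords N b k + i * 2 ^ τ + (prgHash d τ r σ i ℓ : ℕ) ∧
      s'.R 53 = (if (fastPRG σ (i * d + ℓ)).msb then 1 else 0) ∧
      ∀ a < 2 ^ w, a < descrWords N b k + r * 2 ^ τ ∨ descrWords N b k + r * 2 ^ τ + 3 * N ≤ a →
        s'.M a = s.M a := by
  have hw := hF.one_lt
  have hmem := hF.mem
  have hN := hF.hN
  have hw0 : 0 < w := by
    rcases Nat.eq_zero_or_pos w with h | h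
    · rw [h] at hw; norm_num at hw
    · exact h
  have hJ : (i : ℕ) * d + ℓ < b ^ k := by
    have h1 : ((i : ℕ) + 1) * d ≤ r * d := Nat.mul_le_mul_right _ i.isLt
    have := hF.rd_le
    have := ℓ.isLt
    nlinarith
  have hpow := hF.pow_lt
  set s₁ := (Prog.bin .mul 15 13 2 ;; .bin .add 15 15 0).eval s with hs₁
  have hrun₁ : Run (.bin .mul 15 13 2 ;; .bin .add 15 15 0) s 2 s₁ := run_eval (by simp [Prog.LoopFree]) s
  have hk₁ : ∀ i, i ≠ 15 → Prog.Keeps i (.bin .mul 15 13 2 ;; .bin .add 15 15 0) := fun i hi => ⟨hi, hi⟩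
  have h15 : s₁.R 15 = i * d + ℓ := by
    have e1 : (i : ℕ) * d % 2 ^ w = i * d := Nat.mod_eq_of_lt (by omega)
    have e2 : ((i : ℕ) * d + ℓ) % 2 ^ w = i * d + ℓ := Nat.mod_eq_of_lt (by omega)
    simp [hs₁, Prog.eval, State.R_setReg, Op.eval_toNat, Op.nat, State.toNat_reg, h0, h13, hR.reg_d,
      e1, e2, -Nat.mod_add_mod]
  have hR₁ := hR.of_keeps hrun₁ fun i h1 h2 => hk₁ i (by omega)
  obtain ⟨s₂, hrun₂, hblock, hmem₂⟩ := genProg_run hF hR₁ (hσ.congr fun a _ => rfl : SeedAt s₁ σ) h15 hJ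
  have hR₂ := hR₁.of_keeps hrun₂ fun i h1 h2 => genProg_keeps (by omega)
  have h13₂ : s₂.R 13 = i := by
    rw [hrun₂.R_eq (genProg_keeps (by omega)), hrun₁.R_eq (hk₁ _ (by omega)), h13]
  set v := fastPRG σ (i * d + ℓ) with hv
  set B := descrWords N b k + r * 2 ^ τ with hB
  have h10 : s₂.R 10 = B := hR₂.reg_free
  rw [storedAt_iff] at hblock
  have hfirst : s₂.M B % 2 ^ τ = (prgHash d τ r σ i ℓ : ℕ) := by
    have h1 := hblock 0 hN
    rw [add_zero, pow_zero, Nat.div_one] at h1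
    rw [h1, Nat.mod_mod_of_dvd _ (pow_dvd_pow 2 hF.tau_le)]
    simp [prgHash, hv]
  have hlast : s₂.M (B + (N - 1)) / 2 ^ (w - 1) = if v.msb then 1 else 0 := by
    rw [hblock (N - 1) (by omega)]
    have hNw : N * w = w * (N - 1) + w := by
      obtain ⟨m, rfl⟩ : ∃ m, N = m + 1 := ⟨N - 1, by omega⟩
      simp only [Nat.add_sub_cancel]; ring
    have hlt : v.toNat / (2 ^ w) ^ (N - 1) < 2 ^ w := by
      rw [← pow_mul, Nat.div_lt_iff_lt_mul (by positivity), ← pow_add, add_comm, ← hNw]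
      exact v.isLt
    rw [Nat.mod_eq_of_lt hlt, ← pow_mul, Nat.div_div_eq_div_mul, ← pow_add,
      show w * (N - 1) + (w - 1) = N * w - 1 by omega, BitVec.msb_eq_decide]
    have h2 : (2 : ℕ) ^ (N * w) = 2 * 2 ^ (N * w - 1) := by
      rw [← pow_succ', Nat.sub_add_cancel (Nat.mul_pos hN hw0)]
    have h3 := v.isLt
    by_cases h4 : 2 ^ (N * w - 1) ≤ v.toNat
    · simp only [h4, decide_true, if_true]
      exact Nat.div_eq_of_lt_le (by omega) (by omega)
    · simp only [h4, decide_false, Bool.false_eq_true, if_false]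
      exact Nat.div_eq_of_lt (by omega)
  set s₃ := (readBlock N).eval s₂ with hs₃
  have hrun₃ : Run (readBlock N) s₂ 10 s₃ := run_eval (by simp [readBlock, Prog.LoopFree]) s₂
  have hg := (prgHash d τ r σ i ℓ).isLt
  have hit : (i : ℕ) * 2 ^ τ + 2 ^ τ ≤ r * 2 ^ τ := by
    have := Nat.mul_le_mul_right (2 ^ τ) (Nat.succ_le_of_lt i.isLt)
    rwa [Nat.succ_mul] at this
  have hw2 : w < 2 ^ w := Nat.lt_two_pow_self
  refine ⟨s₃, (hrun₁.seq (hrun₂.seq hrun₃)).mono (by omega), ?_, ?_, fun a ha ha' => ?_⟩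
  · have e3 : (i : ℕ) * 2 ^ τ % 2 ^ w = i * 2 ^ τ := Nat.mod_eq_of_lt (by omega)
    have e4 : (descrWords N b k + i * 2 ^ τ) % 2 ^ w = descrWords N b k + i * 2 ^ τ :=
      Nat.mod_eq_of_lt (by omega)
    have e5 : (descrWords N b k + i * 2 ^ τ + (prgHash d τ r σ i ℓ : ℕ)) % 2 ^ w =
      descrWords N b k + i * 2 ^ τ + (prgHash d τ r σ i ℓ : ℕ) := Nat.mod_eq_of_lt (by omega)
    simp [hs₃, readBlock, Prog.eval, State.R_setReg, State.mem_reg, Op.eval_toNat,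
      Op.nat, State.toNat_reg, h10, hR₂.reg_t, hR₂.reg_table, h13₂, hfirst, e3, e4, e5,
      -Nat.mod_add_mod, -Nat.add_mod_mod]
  · have e6 : (N - 1) % 2 ^ w = N - 1 := Nat.mod_eq_of_lt (by omega)
    have e7 : (B + (N - 1)) % 2 ^ w = B + (N - 1) := Nat.mod_eq_of_lt (by omega)
    have e8 : (2 ^ w - 1 + w) % 2 ^ w = w - 1 := by
      obtain ⟨m, hm⟩ : ∃ m, w = m + 1 := ⟨w - 1, by omega⟩
      have := sub_one_mod (w := w) (j := m) (by omega)
      rw [← hm] at this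
      rw [this]; omega
    simp [hs₃, readBlock, Prog.eval, State.R_setReg, State.M_setReg, State.mem_reg, Op.eval_toNat,
      Op.nat, State.toNat_reg, h10, hR₂.reg_w, hR₂.reg_one, e6, e7, e8, hlast,
      -Nat.mod_add_mod, -Nat.add_mod_mod]
  · have : s₃.M a = s₂.M a := rfl
    rw [this, hmem₂ a ha ha']
    rfl

end

section
variable {w : ℕ}

/-! ### The update program -/

/-- The cells of the table hold the numbers `y`, in two's complement. -/
def TableAt (s : State w) {r τ : ℕ} (T : ℕ) (y : Fin r × Fin (2 ^ τ) → ℤ) : Prop :=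
  ∀ (i : Fin r) (j : Fin (2 ^ τ)), s.mem (BitVec.ofNat w (T + i * 2 ^ τ + j)) = BitVec.ofInt w (y (i, j))

lemma State.mem_eq_of_M {s s' : State w} {a : ℕ} (h : s'.M a = s.M a) :
    s'.mem (BitVec.ofNat w a) = s.mem (BitVec.ofNat w a) := BitVec.eq_of_toNat_eq h

lemma cell_lt {T r τ : ℕ} (i : Fin r) (j : Fin (2 ^ τ)) : T + i * 2 ^ τ + j < T + r * 2 ^ τ := by
  have := Nat.mul_le_mul_right (2 ^ τ) (Nat.succ_le_of_lt i.isLt)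
  rw [Nat.succ_mul] at this
  have := j.isLt
  omega

lemma TableAt.congr {s s' : State w} {r τ T : ℕ} {y : Fin r × Fin (2 ^ τ) → ℤ} (h : TableAt s T y)
    (hM : ∀ a, T ≤ a → a < T + r * 2 ^ τ → s'.M a = s.M a) : TableAt s' T y := fun i j => by
  rw [← h i j]
  exact State.mem_eq_of_M (hM _ (by omega) (cell_lt i j))

lemma cell_inj {T r τ w : ℕ} (hT : T + r * 2 ^ τ ≤ 2 ^ w) {i i' : Fin r} {j j' : Fin (2 ^ τ)} :
    BitVec.ofNat w (T + i * 2 ^ τ + j) = BitVec.ofNat w (T + i' * 2 ^ τ + j') ↔ i = i' ∧ j = j' := by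
  refine ⟨fun h => ?_, by rintro ⟨rfl, rfl⟩; rfl⟩
  have h1 := congrArg BitVec.toNat h
  have l1 := cell_lt (T := T) i j
  have l2 := cell_lt (T := T) i' j'
  rw [BitVec.toNat_ofNat, BitVec.toNat_ofNat, Nat.mod_eq_of_lt (by omega), Nat.mod_eq_of_lt (by omega)] at h1
  have hpos : 0 < 2 ^ τ := by positivity
  have h2 : (i : ℕ) = i' := by
    have := congrArg (· / 2 ^ τ) (show (j : ℕ) + 2 ^ τ * i = j' + 2 ^ τ * i' by
      rw [mul_comm _ (i : ℕ), mul_comm _ (i' : ℕ)]; omega)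
    simpa [Nat.add_mul_div_left _ _ hpos, Nat.div_eq_of_lt j.isLt, Nat.div_eq_of_lt j'.isLt] using this
  rw [h2] at h1
  exact ⟨Fin.ext h2, Fin.ext (by omega)⟩

/-- Add the word in register `1`, with the sign in register `53`, to the cell whose address is in
register `55`. -/
def updateCell : Prog :=
  .load 52 55 ;; .cond 53 (.bin .add 52 52 1) (.bin .sub 52 52 1) ;; .store 55 52

/-- Pass to the next row: increase the row number, decrease the number of remaining rows. -/
def nextRow : Prog := .bin .add 13 13 7 ;; .bin .sub 14 14 7

/-- Start with row `0`. -/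
def firstRow : Prog := .const 13 0 ;; .bin .bor 14 4 4

/-- The update program: add the word in register `1` to the coordinate whose number is in
register `0`. -/
def updateProg (N : ℕ) : Prog :=
  setupProg N ;; firstRow ;; .loop 14 (locateProg N ;; updateCell ;; nextRow)

lemma updateCell_run {s : State w} {y u : ℤ} {p : Prop} [Decidable p]
    (h53 : s.R 53 = if p then 1 else 0)
    (hy : s.mem (s.reg 55) = BitVec.ofInt w y) (hu : s.reg 1 = BitVec.ofInt w u) :
    ∃ s', Run updateCell s 5 s' ∧ s'.mem = Function.update s.mem (s.reg 55)
      (BitVec.ofInt w (y + (if p then 1 else -1) * u)) := by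
  refine ⟨_, run_eval (by simp [updateCell, Prog.LoopFree]) s, ?_⟩
  by_cases h : p
  · have hR : ∀ f, State.R { reg := Function.update s.reg 52 f, mem := s.mem } 53 = 1 := fun f =>
      (show _ = s.R 53 from rfl).trans (by rw [h53, if_pos h])
    simp [updateCell, Prog.eval, State.setReg, State.setMem, hR, Op.eval, hy, hu, h,
      BitVec.ofInt_add]
  · have hR : ∀ f, State.R { reg := Function.update s.reg 52 f, mem := s.mem } 53 = 0 := fun f =>
      (show _ = s.R 53 from rfl).trans (by rw [h53, if_neg h])
    simp [updateCell, Prog.eval, State.setReg, State.setMem, hR, Op.eval, hy, hu, h,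
      BitVec.ofInt_add, BitVec.ofInt_neg, BitVec.sub_eq_add_neg]

lemma nextRow_run {s : State w} {i m : ℕ} (h7 : s.R 7 = 1) (h13 : s.R 13 = i) (h14 : s.R 14 = m + 1)
    (hi : i + 1 < 2 ^ w) : ∃ s', Run nextRow s 2 s' ∧ s'.R 13 = i + 1 ∧ s'.R 14 = m ∧ s'.mem = s.mem := by
  have hm := s.R_lt 14
  rw [h14] at hm
  refine ⟨_, run_eval (by simp [nextRow, Prog.LoopFree]) s, ?_, ?_, rfl⟩
  all_goals
    simp [nextRow, Prog.eval, State.R_setReg, Op.eval_toNat, Op.nat, State.toNat_reg, h7, h13, h14,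
      sub_one_mod hm, Nat.mod_eq_of_lt hi, -Nat.add_mod_mod]

lemma firstRow_run {s : State w} :
    ∃ s', Run firstRow s 2 s' ∧ s'.R 13 = 0 ∧ s'.R 14 = s.R 4 ∧ s'.mem = s.mem := by
  refine ⟨_, run_eval (by simp [firstRow, Prog.LoopFree]) s, ?_, ?_, rfl⟩
  all_goals
    simp [firstRow, Prog.eval, State.R_setReg, Op.eval_toNat, Op.nat, State.toNat_reg]

lemma nextRow_keeps {i : ℕ} (hi : i ≠ 13) (hi' : i ≠ 14) : nextRow.Keeps i := ⟨hi, hi'⟩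

lemma firstRow_keeps {i : ℕ} (hi : i ≠ 13) (hi' : i ≠ 14) : firstRow.Keeps i := ⟨hi, hi'⟩

lemma updateCell_keeps {i : ℕ} (hi : i ≠ 52) : updateCell.Keeps i := ⟨hi, ⟨hi, hi⟩, trivial⟩

/-- The update program preserves the description of the sketch, and changes one cell in each row of the
table. -/
lemma updateProg_run {N d τ r b k : ℕ} {s : State w} (hF : Fits w N d τ r b k)
    (hP : ParamsAt s d τ r b k) {σ : Seed (N * w) b k} (hσ : SeedAt s σ)
    {y : Fin r × Fin (2 ^ τ) → ℤ} (hy : TableAt s (descrWords N b k) y) (ℓ : Fin d) (u : ℤ)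
    (h0 : s.R 0 = ℓ) (h1 : s.reg 1 = BitVec.ofInt w u) :
    ∃ s', Run (updateProg N) s
        (3 * k + 26 + r * (k * (30 * N * N + 30 * N + 21) + 5 * N + 24)) s' ∧
      (∀ a < descrWords N b k, s'.M a = s.M a) ∧
      TableAt s' (descrWords N b k) fun ij =>
        y ij + if prgHash d τ r σ ij.1 ℓ = ij.2 then prgSign d r σ ij.1 ℓ * u else 0 := by
  have hw := hF.one_lt
  have hmem := hF.mem
  have hN := hF.hN
  set T := descrWords N b k with hT
  obtain ⟨s₁, hrun₁, hR₁, hmem₁⟩ := setupProg_run hF hP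
  have hM₁ : ∀ a, s₁.M a = s.M a := fun a => by rw [State.M, hmem₁]; rfl
  obtain ⟨s₂, hrun₂, h13₂, h14₂, hmem₂⟩ := firstRow_run (s := s₁)
  have hM₂ : ∀ a, s₂.M a = s.M a := fun a => by rw [State.M, hmem₂]; exact hM₁ a
  have hR₂ := hR₁.of_keeps hrun₂ fun i h1 h2 => firstRow_keeps (by omega) (by omega)
  obtain ⟨s₃, hrun₃, -, -, -, -, -, hM₃, hy₃⟩ := Run.loop (w := w) (x := 14)
    (p := locateProg N ;; updateCell ;; nextRow)
    (fun m s' => Ready s' N d τ r b k ∧ s'.R 0 = ℓ ∧ s'.reg 1 = BitVec.ofInt w u ∧ s'.R 13 = m ∧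
      s'.R 14 = r - m ∧ (∀ a < T, s'.M a = s.M a) ∧ TableAt s' T fun ij => y ij +
        if (ij.1 : ℕ) < m ∧ prgHash d τ r σ ij.1 ℓ = ij.2 then prgSign d r σ ij.1 ℓ * u else 0) r
    (k * (30 * N * N + 30 * N + 21) + 5 * N + 23)
    (by
      rintro m hm s' ⟨hR', h0', h1', h13', h14', hM', hy'⟩
      refine ⟨by omega, ?_⟩
      obtain ⟨e, he⟩ : ∃ e, r - m = e + 1 := ⟨r - m - 1, by omega⟩
      have hσ' : SeedAt s' σ := hσ.congr hM'
      obtain ⟨s₄, hrun₄, h55, h53, hM₄⟩ := locateProg_run hF hR' hσ' ℓ ⟨m, hm⟩ h0' h13'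
      have hy₄ : TableAt s₄ T _ := hy'.congr fun a ha ha' => hM₄ a (by omega) (Or.inl ha')
      have hk₄ : ∀ i, i < 15 → s₄.reg i = s'.reg i := fun i hi =>
        hrun₄.reg_eq (locateProg_keeps (Or.inl hi))
      set j := prgHash d τ r σ ⟨m, hm⟩ ℓ with hj
      have hcell : s₄.reg 55 = BitVec.ofNat w (T + m * 2 ^ τ + j) := by
        rw [← h55, State.R, BitVec.ofNat_toNat, BitVec.setWidth_eq]
      have hyc := hy₄ ⟨m, hm⟩ j
      simp only [lt_irrefl, false_and, if_false, add_zero, ← hcell] at hyc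
      obtain ⟨s₅, hrun₅, hmem₅⟩ := updateCell_run h53 hyc ((hk₄ 1 (by omega)).trans h1')
      have hk₅ : ∀ i, i ≠ 52 → s₅.reg i = s₄.reg i := fun i hi => hrun₅.reg_eq (updateCell_keeps hi)
      have hold₅ : ∀ i, i < 15 → s₅.R i = s'.R i := fun i hi => by
        rw [State.R, State.R, hk₅ i (by omega), hk₄ i hi]
      obtain ⟨s₆, hrun₆, h13₆, h14₆, hmem₆⟩ := nextRow_run (i := m) (m := e) (s := s₅)
        ((hold₅ 7 (by omega)).trans hR'.reg_one) ((hold₅ 13 (by omega)).trans h13')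
        (by rw [hold₅ 14 (by omega), h14', he]) (by omega)
      have hk₆ : ∀ i, i ≠ 13 → i ≠ 14 → i < 15 → s₆.reg i = s'.reg i := fun i h1 h2 h3 => by
        rw [hrun₆.reg_eq (nextRow_keeps h1 h2), hk₅ i (by omega), hk₄ i h3]
      have hrun := hrun₄.seq (hrun₅.seq hrun₆)
      refine ⟨s₆, hrun.mono (by omega), ?_, ?_, ?_, h13₆, by omega, fun a ha => ?_, fun i' j' => ?_⟩
      · exact hR'.of_keeps hrun fun i h1 h2 => ⟨locateProg_keeps (by omega), updateCell_keeps (by omega),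
          nextRow_keeps (by omega) (by omega)⟩
      · rw [State.R, hk₆ 0 (by omega) (by omega) (by omega)]; exact h0'
      · rw [hk₆ 1 (by omega) (by omega) (by omega)]; exact h1'
      · have hne : BitVec.ofNat w a ≠ s₄.reg 55 := by
          rw [hcell]
          intro h
          have := congrArg BitVec.toNat h
          have := cell_lt (T := T) ⟨m, hm⟩ j
          rw [BitVec.toNat_ofNat, BitVec.toNat_ofNat, Nat.mod_eq_of_lt (by omega),
            Nat.mod_eq_of_lt (by simp only at this; omega)] at *
          omega
        rw [State.M, hmem₆, hmem₅, Function.update_of_ne hne]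
        exact (hM₄ a (by omega) (by omega)).trans (hM' a ha)
      · rw [hmem₆, hmem₅]
        by_cases hc : i' = ⟨m, hm⟩ ∧ j' = j
        · obtain ⟨rfl, rfl⟩ := hc
          rw [hcell, Function.update_self]
          simp [prgSign, ← hj]
        · have hne : BitVec.ofNat w (T + i' * 2 ^ τ + j') ≠ s₄.reg 55 := by
            rw [hcell, Ne, cell_inj (by omega) (i' := ⟨m, hm⟩)]
            exact hc
          rw [Function.update_of_ne hne, hy₄ i' j']
          congr 3
          by_cases hi : (i' : ℕ) = m
          · have hi' : i' = ⟨m, hm⟩ := Fin.ext hi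
            subst hi'
            have hjj : ¬ prgHash d τ r σ ⟨m, hm⟩ ℓ = j' := fun h => hc ⟨rfl, h.symm⟩
            simp [hjj]
          · have : (i' : ℕ) < m + 1 ↔ (i' : ℕ) < m := by omega
            simp only [this])
    (fun s' h => by rw [h.2.2.2.2.1]; omega)
    (s := s₂) ⟨hR₂, by
        rw [hrun₂.R_eq (firstRow_keeps (by omega) (by omega)), hrun₁.R_eq (setupProg_keeps (by omega)), h0],
      by rw [hrun₂.reg_eq (firstRow_keeps (by omega) (by omega)), hrun₁.reg_eq (setupProg_keeps (by omega)), h1],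
      h13₂, by rw [h14₂, hR₁.reg_r]; rfl, fun a _ => hM₂ a, by
        simpa using hy.congr fun a _ _ => hM₂ a⟩
  refine ⟨s₃, (hrun₁.seq (hrun₂.seq hrun₃)).mono (by rw [add_assoc _ 23 1]; omega), hM₃, ?_⟩
  simpa using hy₃

end

/-! ### Selection: the combinatorial facts -/

/-- The number `v` has rank `k` (counted from `0`) among `f 0, …, f (n - 1)`: at most `k` of them are
smaller, and fewer than `n - k` are greater. -/
def HasRank (f : ℕ → ℕ) (n k v : ℕ) : Prop :=
  Nat.count (fun i => f i < v) n ≤ k ∧ Nat.count (fun i => v < f i) n + k < n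

lemma count_congr {p q : ℕ → Prop} [DecidablePred p] [DecidablePred q] {n : ℕ}
    (h : ∀ i < n, p i ↔ q i) : Nat.count p n = Nat.count q n :=
  le_antisymm (Nat.count_mono_left fun i hi => (h i hi).1) (Nat.count_mono_left fun i hi => (h i hi).2)

lemma count_add_count_not (p : ℕ → Prop) [DecidablePred p] (n : ℕ) :
    Nat.count p n + Nat.count (fun i => ¬ p i) n = n := by
  induction n with
  | zero => simp
  | succ n ih =>
    rw [Nat.count_succ, Nat.count_succ]
    split_ifs <;> omega

lemma count_and_add_count_and_not (p q : ℕ → Prop) [DecidablePred p] [DecidablePred q] (n : ℕ) :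
    Nat.count (fun i => q i ∧ p i) n + Nat.count (fun i => ¬ q i ∧ p i) n = Nat.count p n := by
  induction n with
  | zero => simp
  | succ n ih =>
    simp only [Nat.count_succ]
    by_cases hp : p n <;> by_cases hq : q n <;> simp [hp, hq] <;> omega

lemma HasRank.congr {f g : ℕ → ℕ} {n k v : ℕ} (h : HasRank f n k v) (hfg : ∀ i < n, g i = f i) :
    HasRank g n k v := by
  unfold HasRank
  rw [count_congr (q := fun i => f i < v) fun i hi => by rw [hfg i hi],
    count_congr (p := fun i => v < g i) (q := fun i => v < f i) fun i hi => by rw [hfg i hi]]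
  exact h

/-- The least `v` with fewer than `n - k` greater elements has at most `k` smaller ones, so these do not
make up all `n` elements: `v` is one of them. -/
lemma exists_hasRank (f : ℕ → ℕ) {n k : ℕ} (hk : k < n) : ∃ j < n, HasRank f n k (f j) := by
  have hex : ∃ v, Nat.count (fun i => v < f i) n + k < n := by
    refine ⟨(Finset.range n).sup f, ?_⟩
    have : Nat.count (fun i => (Finset.range n).sup f < f i) n = 0 := by
      rw [Nat.count_iff_forall_not]
      intro i hi
      exact not_lt.2 (Finset.le_sup (f := f) (Finset.mem_range.2 hi))
    omega
  obtain ⟨v, hv, hmin⟩ : ∃ v, Nat.count (fun i => v < f i) n + k < n ∧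
      ∀ u < v, ¬ Nat.count (fun i => u < f i) n + k < n :=
    ⟨Nat.find hex, Nat.find_spec hex, fun u hu => Nat.find_min hex hu⟩
  have hlt : Nat.count (fun i => f i < v) n ≤ k := by
    rcases Nat.eq_zero_or_pos v with h0 | h0
    · simp [h0]
    · have h1 := hmin (v - 1) (by omega)
      have h2 := count_add_count_not (fun i => f i < v) n
      have h3 : Nat.count (fun i => ¬ f i < v) n = Nat.count (fun i => v - 1 < f i) n :=
        count_congr fun i _ => by omega
      omega
  by_contra hno
  push Not at hno
  have hne : ∀ j < n, f j ≠ v := fun j hj h => hno j hj (by rw [h]; exact ⟨hlt, hv⟩)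
  have h2 := count_add_count_not (fun i => f i < v) n
  have h3 : Nat.count (fun i => ¬ f i < v) n = Nat.count (fun i => v < f i) n :=
    count_congr fun i hi => by have := hne i hi; omega
  omega

lemma HasRank.unique {f : ℕ → ℕ} {n k u v : ℕ} (hu : HasRank f n k u) (hv : HasRank f n k v) :
    u = v := by
  have key : ∀ {u v : ℕ}, HasRank f n k u → HasRank f n k v → ¬ u < v := by
    intro u v hu hv huv
    have h1 := count_add_count_not (fun i => u < f i) n
    have h2 : Nat.count (fun i => ¬ u < f i) n ≤ Nat.count (fun i => f i < v) n :=
      Nat.count_mono_left fun i _ h => by omega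
    have := hu.2
    have := hv.1
    omega
  have := key hu hv
  have := key hv hu
  omega

/-- The smaller elements: if `k` is less than their number, then the element of rank `k` among them
has rank `k` among all elements. -/
lemma HasRank.of_less {f f' : ℕ → ℕ} {n n' k p v : ℕ}
    (hf : ∀ Q : ℕ → Prop, [DecidablePred Q] →
      Nat.count (fun i => Q (f' i)) n' = Nat.count (fun i => f i < p ∧ Q (f i)) n)
    (hn' : n' = Nat.count (fun i => f i < p) n) (h : HasRank f' n' k v) : HasRank f n k v := by
  have h1 := h.1
  have h2 := h.2
  have h3 := count_add_count_not (fun i => v < f' i) n'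
  have h4 := hf fun x => ¬ v < x
  have h5 := hf fun x => x < v
  have hvp : v ≤ p := by
    by_contra hvp
    have : Nat.count (fun i => f i < p ∧ f i < v) n = Nat.count (fun i => f i < p) n :=
      count_congr fun i _ => by omega
    omega
  have h6 : Nat.count (fun i => f i < p ∧ f i < v) n = Nat.count (fun i => f i < v) n :=
    count_congr fun i _ => by omega
  have h7 : Nat.count (fun i => f i < p ∧ ¬ v < f i) n ≤ Nat.count (fun i => ¬ v < f i) n :=
    Nat.count_mono_left fun i _ h => h.2
  have h8 := count_add_count_not (fun i => v < f i) n
  exact ⟨by omega, by omega⟩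

/-- The greater elements, correspondingly. -/
lemma HasRank.of_greater {f f' : ℕ → ℕ} {n n' k p v : ℕ}
    (hf : ∀ Q : ℕ → Prop, [DecidablePred Q] →
      Nat.count (fun i => Q (f' i)) n' = Nat.count (fun i => p < f i ∧ Q (f i)) n)
    (hn' : n' = Nat.count (fun i => p < f i) n) (hk : n ≤ n' + k)
    (h : HasRank f' n' (k - (n - n')) v) : HasRank f n k v := by
  have h1 := h.1
  have h2 := h.2
  have h4 := hf fun x => v < x
  have h5 := hf fun x => x < v
  have hle := Nat.count_le (p := fun i => p < f i) (n := n)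
  have hvp : p ≤ v := by
    by_contra hvp
    have : Nat.count (fun i => p < f i ∧ v < f i) n = Nat.count (fun i => p < f i) n :=
      count_congr fun i _ => by omega
    omega
  have h6 : Nat.count (fun i => p < f i ∧ v < f i) n = Nat.count (fun i => v < f i) n :=
    count_congr fun i _ => by omega
  have h7 := count_and_add_count_and_not (fun i => f i < v) (fun i => p < f i) n
  have h8 : Nat.count (fun i => ¬ p < f i ∧ f i < v) n ≤ Nat.count (fun i => ¬ p < f i) n :=
    Nat.count_mono_left fun i _ h => h.1
  have h9 := count_add_count_not (fun i => p < f i) n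
  exact ⟨by omega, by omega⟩

lemma HasRank.of_equal {f : ℕ → ℕ} {f' : ℕ → ℕ} {n k p v : ℕ} (hp : HasRank f n k p) (h0 : f' 0 = p)
    (h : HasRank f' 1 0 v) : HasRank f n k v := by
  have h1 := h.1
  have h2 := h.2
  simp only [Nat.count_succ, Nat.count_zero, h0] at h1 h2
  have : v = p := by
    split_ifs at h1 h2 <;> omega
  rwa [this]

lemma three_mul_count_le {p q : ℕ → Prop} [DecidablePred p] [DecidablePred q] {m : ℕ}
    (h : ∀ j < m, q j → 3 ≤ Nat.count (fun i => p (5 * j + i)) 5) :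
    3 * Nat.count q m ≤ Nat.count p (5 * m) := by
  induction m with
  | zero => simp
  | succ m ih =>
    have h1 := ih fun j hj => h j (by omega)
    have h2 := h m (by omega)
    rw [Nat.count_succ, Nat.mul_succ 5, Nat.count_add]
    split_ifs with hq
    · have := h2 hq
      omega
    · omega

/-- The median `p` of the medians of the groups of five is a good pivot. -/
lemma pivot_counts {f g : ℕ → ℕ} {n p : ℕ}
    (hg : ∀ j < n / 5, HasRank (fun i => f (5 * j + i)) 5 2 (g j))
    (hp : HasRank g (n / 5) (n / 5 / 2) p) :
    Nat.count (fun i => f i < p) n + 3 * (n / 5 - n / 5 / 2) ≤ n ∧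
      Nat.count (fun i => p < f i) n + 3 * (n / 5 / 2 + 1) ≤ n := by
  have hn : 5 * (n / 5) ≤ n := Nat.mul_div_le n 5
  constructor
  · have h1 := three_mul_count_le (m := n / 5) (p := fun i => ¬ f i < p) (q := fun j => ¬ g j < p)
      fun j hj hq => by
        have h1 : Nat.count (fun i => f (5 * j + i) < g j) 5 ≤ 2 := (hg j hj).1
        have h2 := count_add_count_not (fun i => f (5 * j + i) < g j) 5
        have h3 : Nat.count (fun i => ¬ f (5 * j + i) < g j) 5 ≤
            Nat.count (fun i => ¬ f (5 * j + i) < p) 5 := Nat.count_mono_left fun i _ h => by omega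
        omega
    have h2 := Nat.count_monotone (fun i => ¬ f i < p) hn
    have h3 := count_add_count_not (fun i => f i < p) n
    have h4 := count_add_count_not (fun j => g j < p) (n / 5)
    have h5 := hp.1
    omega
  · have h1 := three_mul_count_le (m := n / 5) (p := fun i => ¬ p < f i) (q := fun j => ¬ p < g j)
      fun j hj hq => by
        have h1 : Nat.count (fun i => g j < f (5 * j + i)) 5 + 2 < 5 := (hg j hj).2
        have h2 := count_add_count_not (fun i => g j < f (5 * j + i)) 5
        have h3 : Nat.count (fun i => ¬ g j < f (5 * j + i)) 5 ≤
            Nat.count (fun i => ¬ p < f (5 * j + i)) 5 := Nat.count_mono_left fun i _ h => by omega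
        omega
    have h2 := Nat.count_monotone (fun i => ¬ p < f i) hn
    have h3 := count_add_count_not (fun i => p < f i) n
    have h4 := count_add_count_not (fun j => p < g j) (n / 5)
    have h5 := hp.2
    omega

section
variable {w : ℕ}

/-! ### Selection: counting, brute force, and compaction -/

/-- Compare the word `v` in register `74` with the `n` cells from address `a` on; `a` is in
register `70`, and `n` is in register `71`.  Count the smaller words in register `75` and the greater
words in register `76`. -/
def countProg : Prog :=
  (.const 75 0 ;; .const 76 0 ;; .bin .bor 77 70 70 ;; .bin .bor 78 71 71) ;;
  .loop 78 (.load 79 77 ;; .bin .lt 80 79 74 ;; .bin .add 75 75 80 ;; .bin .lt 80 74 79 ;;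
    .bin .add 76 76 80 ;; .bin .add 77 77 7 ;; .bin .sub 78 78 7)

lemma countProg_keeps {i : ℕ} (hi : i < 75 ∨ 80 < i) : countProg.Keeps i := by
  simp [countProg, Prog.Keeps]
  omega

lemma countProg_run {s : State w} {a n v : ℕ} (hw : 1 < 2 ^ w) (h7 : s.R 7 = 1) (h70 : s.R 70 = a)
    (h71 : s.R 71 = n) (h74 : s.R 74 = v) (ha : a + n < 2 ^ w) :
    ∃ s', Run countProg s (8 * n + 5) s' ∧ s'.R 75 = Nat.count (fun i => s.M (a + i) < v) n ∧
      s'.R 76 = Nat.count (fun i => v < s.M (a + i)) n ∧ s'.mem = s.mem := by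
  have c1 : 1 % 2 ^ w = 1 := Nat.mod_eq_of_lt hw
  obtain ⟨s₁, hrun₁, f7, f74, f75, f76, f77, f78, hmem₁⟩ : ∃ s₁, Run (.const 75 0 ;; .const 76 0 ;;
      .bin .bor 77 70 70 ;; .bin .bor 78 71 71) s 4 s₁ ∧ s₁.R 7 = 1 ∧ s₁.R 74 = v ∧ s₁.R 75 = 0 ∧
      s₁.R 76 = 0 ∧ s₁.R 77 = a ∧ s₁.R 78 = n ∧ s₁.mem = s.mem := by
    refine ⟨_, run_eval (by simp [Prog.LoopFree]) s, ?_, ?_, ?_, ?_, ?_, ?_, rfl⟩ <;>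
    simp [Prog.eval, State.R_setReg, Op.eval_toNat, Op.nat, State.toNat_reg, h7, h70, h71, h74]
  obtain ⟨s₂, hrun₂, -, -, g75, g76, -, -, hmem₂⟩ := Run.loop (w := w) (x := 78)
    (p := .load 79 77 ;; .bin .lt 80 79 74 ;; .bin .add 75 75 80 ;; .bin .lt 80 74 79 ;;
      .bin .add 76 76 80 ;; .bin .add 77 77 7 ;; .bin .sub 78 78 7)
    (fun j s' => s'.R 7 = 1 ∧ s'.R 74 = v ∧ s'.R 75 = Nat.count (fun i => s.M (a + i) < v) j ∧
      s'.R 76 = Nat.count (fun i => v < s.M (a + i)) j ∧ s'.R 77 = a + j ∧ s'.R 78 = n - j ∧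
      s'.mem = s.mem) n 7
    (by
      rintro j hj s' ⟨h7, h74, h75, h76, h77, h78, hmem⟩
      refine ⟨by omega, _, run_eval (by simp [Prog.LoopFree]) s', ?_, ?_, ?_, ?_, ?_, ?_, hmem⟩
      all_goals
        obtain ⟨e, he⟩ : ∃ e, n - j = e + 1 := ⟨n - j - 1, by omega⟩
        have hM : s'.M (a + j) = s.M (a + j) := by rw [State.M, hmem]; rfl
        have hlt : j + 1 < 2 ^ w := by omega
        have hc := Nat.count_le (p := fun i => s.M (a + i) < v) (n := j + 1)
        have hc' := Nat.count_le (p := fun i => v < s.M (a + i)) (n := j + 1)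
        rw [Nat.count_succ] at hc hc'
        have e1 := Nat.mod_eq_of_lt (hc.trans_lt hlt)
        have e2 := Nat.mod_eq_of_lt (hc'.trans_lt hlt)
        have e3 : (a + j + 1) % 2 ^ w = a + (j + 1) := Nat.mod_eq_of_lt (by omega)
        have e4 : (2 ^ w - 1 + (e + 1)) % 2 ^ w = n - (j + 1) := by
          rw [sub_one_mod (by omega)]; omega
        simp [Prog.eval, State.R_setReg, State.mem_reg, Op.eval_toNat, Op.nat, State.toNat_reg,
          h7, h74, h75, h76, h77, h78, c1, he, hM, e1, e2, e3, e4, Nat.count_succ, -Nat.add_mod_mod,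
          -Nat.mod_add_mod])
    (fun s' h => by rw [h.2.2.2.2.2.1]; omega)
    (s := s₁) ⟨f7, f74, by simpa using f75, by simpa using f76, f77, f78, hmem₁⟩
  exact ⟨s₂, (hrun₁.seq hrun₂).mono (by omega), g75, g76, hmem₂⟩

/-- Keep the word in register `74` in register `73` if it has the rank in register `72`, according to
the counts in the registers `75` and `76`. -/
def testRank : Prog :=
  .bin .lt 80 72 75 ;; .bin .add 81 72 76 ;; .bin .lt 81 81 71 ;;
  .cond 80 (.const 80 0) (.cond 81 (.bin .bor 73 74 74) (.const 80 0))

/-- Store in register `73` the word of rank `k` (register `72`) among `n` words (register `71`) in the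
memory from address `a` (register `70`) on, by brute force. -/
def bruteProg : Prog :=
  (.bin .bor 83 70 70 ;; .bin .bor 84 71 71) ;;
  .loop 84 (.load 74 83 ;; countProg ;; testRank ;; (.bin .add 83 83 7 ;; .bin .sub 84 84 7))

lemma bruteProg_keeps {i : ℕ} (hi : i < 73 ∨ 84 < i) : bruteProg.Keeps i := by
  simp [bruteProg, countProg, testRank, Prog.Keeps]
  omega

lemma testRank_run {s : State w} {L G n k v : ℕ} (hw : 1 < 2 ^ w) (h71 : s.R 71 = n) (h72 : s.R 72 = k)
    (h74 : s.R 74 = v) (h75 : s.R 75 = L) (h76 : s.R 76 = G) (hn : k + G < 2 ^ w) :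
    ∃ s', Run testRank s 10 s' ∧ s'.R 73 = (if L ≤ k ∧ G + k < n then v else s.R 73) ∧
      s'.mem = s.mem := by
  have c1 : 1 % 2 ^ w = 1 := Nat.mod_eq_of_lt hw
  have e1 : (k + G) % 2 ^ w = k + G := Nat.mod_eq_of_lt hn
  refine ⟨_, (run_eval (by simp [testRank, Prog.LoopFree]) s).mono (by simp [testRank, Prog.size]), ?_, ?_⟩
  all_goals
    simp only [testRank, Prog.eval]
    by_cases h1 : k < L
    · simp [State.R_setReg, Op.eval_toNat, Op.nat, State.toNat_reg, h72, h75, c1, h1]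
      try rfl
    · by_cases h2 : k + G < n
      · simp [State.R_setReg, Op.eval_toNat, Op.nat, State.toNat_reg, h71, h72, h74, h75, h76, c1, e1, h1,
          h2, not_lt.1 h1, add_comm G k]
        try rfl
      · simp [State.R_setReg, Op.eval_toNat, Op.nat, State.toNat_reg, h71, h72, h75, h76, e1, h1,
          h2, add_comm G k]
        try rfl

lemma bruteProg_run {s : State w} {a n k : ℕ} (hw : 1 < 2 ^ w) (h7 : s.R 7 = 1) (h70 : s.R 70 = a)
    (h71 : s.R 71 = n) (h72 : s.R 72 = k) (ha : a + 2 * n < 2 ^ w) (hk : k < n) :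
    ∃ s', Run bruteProg s (n * (8 * n + 19) + 3) s' ∧ HasRank (fun i => s.M (a + i)) n k (s'.R 73) ∧
      s'.mem = s.mem := by
  obtain ⟨s₁, hrun₁, f83, f84, hmem₁⟩ : ∃ s₁, Run (.bin .bor 83 70 70 ;; .bin .bor 84 71 71) s 2 s₁ ∧
      s₁.R 83 = a ∧ s₁.R 84 = n ∧ s₁.mem = s.mem := by
    refine ⟨_, run_eval (by simp [Prog.LoopFree]) s, ?_, ?_, rfl⟩ <;>
    simp [Prog.eval, State.R_setReg, Op.eval_toNat, Op.nat, State.toNat_reg, h70, h71]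
  have hk₁ : ∀ i < 83, s₁.R i = s.R i := fun i hi => hrun₁.R_eq (by simp [Prog.Keeps]; omega)
  obtain ⟨s₂, hrun₂, -, -, -, -, -, -, hmem₂, hres⟩ := Run.loop (w := w) (x := 84)
    (p := .load 74 83 ;; countProg ;; testRank ;; (.bin .add 83 83 7 ;; .bin .sub 84 84 7))
    (fun j s' => s'.R 7 = 1 ∧ s'.R 70 = a ∧ s'.R 71 = n ∧ s'.R 72 = k ∧ s'.R 83 = a + j ∧
      s'.R 84 = n - j ∧ s'.mem = s.mem ∧
      ((∃ i < j, HasRank (fun i => s.M (a + i)) n k (s.M (a + i))) →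
        HasRank (fun i => s.M (a + i)) n k (s'.R 73))) n (8 * n + 18)
    (by
      rintro j hj s' ⟨h7, h70, h71, h72, h83, h84, hmem, hI⟩
      refine ⟨by omega, ?_⟩
      have hM : ∀ i, s'.M i = s.M i := fun i => by rw [State.M, hmem]; rfl
      obtain ⟨s₃, hrun₃, h74₃, hmem₃⟩ : ∃ s₃, Run (.load 74 83) s' 1 s₃ ∧ s₃.R 74 = s.M (a + j) ∧
          s₃.mem = s'.mem :=
        ⟨_, run_eval (p := .load 74 83) trivial s', by
          simp [Prog.eval, State.R_setReg, State.mem_reg, h83, hM], rfl⟩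
      have hk₃ : ∀ i, i ≠ 74 → s₃.R i = s'.R i := fun i hi => hrun₃.R_eq hi
      have hM₃ : ∀ i, s₃.M i = s.M i := fun i => by rw [State.M, hmem₃]; exact hM i
      obtain ⟨s₄, hrun₄, h75₄, h76₄, hmem₄⟩ := countProg_run hw ((hk₃ 7 (by omega)).trans h7)
        ((hk₃ 70 (by omega)).trans h70) ((hk₃ 71 (by omega)).trans h71) h74₃ (by omega)
      simp only [hM₃] at h75₄ h76₄
      have hk₄ : ∀ i, i < 75 ∨ 80 < i → s₄.R i = s₃.R i := fun i hi => hrun₄.R_eq (countProg_keeps hi)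
      have hle := Nat.count_le (p := fun i => s.M (a + j) < s.M (a + i)) (n := n)
      obtain ⟨s₅, hrun₅, h73₅, hmem₅⟩ := testRank_run hw
        ((hk₄ 71 (by omega)).trans ((hk₃ 71 (by omega)).trans h71))
        ((hk₄ 72 (by omega)).trans ((hk₃ 72 (by omega)).trans h72)) ((hk₄ 74 (by omega)).trans h74₃)
        h75₄ h76₄ (by omega)
      have hk₅ : ∀ i, i < 73 ∨ 81 < i → s₅.R i = s₄.R i := fun i hi => hrun₅.R_eq (by
        simp [testRank, Prog.Keeps]; omega)
      have hall : ∀ i, i < 73 ∨ 82 < i → s₅.R i = s'.R i := fun i hi => by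
        rw [hk₅ i (by omega), hk₄ i (by omega), hk₃ i (by omega)]
      have hrun₆ := run_eval (p := .bin .add 83 83 7 ;; .bin .sub 84 84 7) (by simp [Prog.LoopFree]) s₅
      have hk₆ : ∀ i < 83, _ := fun i (hi : i < 83) => hrun₆.R_eq (i := i) (by simp [Prog.Keeps]; omega)
      have g7 := (hall 7 (by omega)).trans h7
      have g83 := (hall 83 (by omega)).trans h83
      obtain ⟨e, he⟩ : ∃ e, n - j = e + 1 := ⟨n - j - 1, by omega⟩
      have g84 := (hall 84 (by omega)).trans (h84.trans he)
      have e3 : (a + j + 1) % 2 ^ w = a + (j + 1) := Nat.mod_eq_of_lt (by omega)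
      have e4 : (2 ^ w - 1 + (e + 1)) % 2 ^ w = n - (j + 1) := by
        rw [sub_one_mod (by omega)]; omega
      refine ⟨_, ((hrun₃.seq (hrun₄.seq (hrun₅.seq hrun₆)))).mono (by simp only [Prog.size]; omega), ?_, ?_,
        ?_, ?_, ?_, ?_, hmem₅.trans (hmem₄.trans (hmem₃.trans hmem)), ?_⟩
      · rw [hk₆ 7 (by omega), g7]
      · rw [hk₆ 70 (by omega), hall 70 (by omega), h70]
      · rw [hk₆ 71 (by omega), hall 71 (by omega), h71]
      · rw [hk₆ 72 (by omega), hall 72 (by omega), h72]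
      · simp [Prog.eval, State.R_setReg, Op.eval_toNat, Op.nat, State.toNat_reg, g7, g83, e3]
      · simp [Prog.eval, State.R_setReg, Op.eval_toNat, Op.nat, State.toNat_reg, g7, g84, e4,
          -Nat.add_mod_mod, -Nat.mod_add_mod]
      · rw [hk₆ 73 (by omega), h73₅]
        rintro ⟨i, hi, hri⟩
        split_ifs with hc
        · exact hc
        · rw [hk₄ 73 (by omega), hk₃ 73 (by omega)]
          refine hI ⟨i, ?_, hri⟩
          rcases Nat.lt_succ_iff_lt_or_eq.1 hi with h | rfl
          · exact h
          · exact (hc hri).elim)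
    (fun s' h => by rw [h.2.2.2.2.2.1]; omega)
    (s := s₁) ⟨(hk₁ 7 (by omega)).trans h7, (hk₁ 70 (by omega)).trans h70, (hk₁ 71 (by omega)).trans h71,
      (hk₁ 72 (by omega)).trans h72, f83, f84, hmem₁, by simp⟩
  exact ⟨s₂, (hrun₁.seq hrun₂).mono (by ring_nf; omega), hres (exists_hasRank _ hk), hmem₂⟩

/-- Move those of the `n` words (register `71`) in the memory from address `a` (register `70`) on for
which the word in register `x` is less than the word in register `y` to the front; the current word
is in register `79`. -/
def compactProg (x y : ℕ) : Prog :=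
  (.bin .bor 77 70 70 ;; .bin .bor 81 70 70 ;; .bin .bor 78 71 71) ;;
  .loop 78 (.load 79 77 ;; .bin .lt 80 x y ;; .store 81 79 ;; .bin .add 81 81 80 ;; .bin .add 77 77 7 ;;
    .bin .sub 78 78 7)

lemma compactProg_keeps {x y i : ℕ} (hi : i < 77 ∨ 81 < i) : (compactProg x y).Keeps i := by
  simp [compactProg, Prog.Keeps]
  omega

lemma compactProg_run {s : State w} {a n x y : ℕ} (P : ℕ → Prop) [DecidablePred P] (hw : 1 < 2 ^ w)
    (h7 : s.R 7 = 1) (h70 : s.R 70 = a) (h71 : s.R 71 = n) (ha : a + n < 2 ^ w)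
    (hP : ∀ s' : State w, s'.R 74 = s.R 74 → (s'.R x < s'.R y ↔ P (s'.R 79))) :
    ∃ s', Run (compactProg x y) s (7 * n + 4) s' ∧
      (∀ Q : ℕ → Prop, [DecidablePred Q] →
        Nat.count (fun i => Q (s'.M (a + i))) (Nat.count (fun i => P (s.M (a + i))) n) =
          Nat.count (fun i => P (s.M (a + i)) ∧ Q (s.M (a + i))) n) ∧
      ∀ i < 2 ^ w, i < a ∨ a + n ≤ i → s'.M i = s.M i := by
  have c1 : 1 % 2 ^ w = 1 := Nat.mod_eq_of_lt hw
  obtain ⟨s₁, hrun₁, f77, f81, f78, hmem₁⟩ : ∃ s₁, Run (.bin .bor 77 70 70 ;; .bin .bor 81 70 70 ;;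
      .bin .bor 78 71 71) s 3 s₁ ∧ s₁.R 77 = a ∧ s₁.R 81 = a ∧ s₁.R 78 = n ∧ s₁.mem = s.mem := by
    refine ⟨_, run_eval (by simp [Prog.LoopFree]) s, ?_, ?_, ?_, rfl⟩ <;>
    simp [Prog.eval, State.R_setReg, Op.eval_toNat, Op.nat, State.toNat_reg, h70, h71]
  have hk₁ : ∀ i < 77, s₁.R i = s.R i := fun i hi => hrun₁.R_eq (by simp [Prog.Keeps]; omega)
  have hM₁ : ∀ i, s₁.M i = s.M i := fun i => by rw [State.M, hmem₁]; rfl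
  obtain ⟨s₂, hrun₂, -, -, -, -, -, hcount, -, hframe⟩ := Run.loop (w := w) (x := 78)
    (p := .load 79 77 ;; .bin .lt 80 x y ;; .store 81 79 ;; .bin .add 81 81 80 ;; .bin .add 77 77 7 ;;
      .bin .sub 78 78 7)
    (fun j s' => s'.R 7 = 1 ∧ s'.R 74 = s.R 74 ∧ s'.R 77 = a + j ∧ s'.R 78 = n - j ∧
      s'.R 81 = a + Nat.count (fun i => P (s.M (a + i))) j ∧
      (∀ Q : ℕ → Prop, [DecidablePred Q] →
        Nat.count (fun i => Q (s'.M (a + i))) (Nat.count (fun i => P (s.M (a + i))) j) =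
          Nat.count (fun i => P (s.M (a + i)) ∧ Q (s.M (a + i))) j) ∧
      (∀ i, j ≤ i → i < n → s'.M (a + i) = s.M (a + i)) ∧
      ∀ i < 2 ^ w, i < a ∨ a + n ≤ i → s'.M i = s.M i) n 6
    (by
      rintro j hj s' ⟨h7, h74, h77, h78, h81, hQ, hrest, hframe⟩
      set c := Nat.count (fun i => P (s.M (a + i))) j with hc
      have hcj : c ≤ j := Nat.count_le _
      refine ⟨by omega, ?_⟩
      obtain ⟨s₃, hrun₃, h79, hmem₃⟩ : ∃ s₃, Run (.load 79 77) s' 1 s₃ ∧ s₃.R 79 = s.M (a + j) ∧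
          s₃.mem = s'.mem :=
        ⟨_, run_eval (p := .load 79 77) trivial s', by
          simp [Prog.eval, State.R_setReg, State.mem_reg, h77, hrest j le_rfl hj], rfl⟩
      have hk₃ : ∀ i, i ≠ 79 → s₃.R i = s'.R i := fun i hi => hrun₃.R_eq hi
      have hM₃ : ∀ i, s₃.M i = s'.M i := fun i => by rw [State.M, hmem₃]; rfl
      have hxy := hP s₃ ((hk₃ 74 (by omega)).trans h74)
      rw [h79] at hxy
      have g7 := (hk₃ 7 (by omega)).trans h7
      have g77 := (hk₃ 77 (by omega)).trans h77
      have g81 := (hk₃ 81 (by omega)).trans h81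
      obtain ⟨e, he⟩ : ∃ e, n - j = e + 1 := ⟨n - j - 1, by omega⟩
      have g78 := (hk₃ 78 (by omega)).trans (h78.trans he)
      have e3 : (a + j + 1) % 2 ^ w = a + (j + 1) := Nat.mod_eq_of_lt (by omega)
      have e4 : (2 ^ w - 1 + (e + 1)) % 2 ^ w = n - (j + 1) := by
        rw [sub_one_mod (by omega)]; omega
      have e5 : (a + c + if P (s.M (a + j)) then 1 else 0) % 2 ^ w =
          a + Nat.count (fun i => P (s.M (a + i))) (j + 1) := by
        rw [Nat.count_succ, ← hc, add_assoc]
        exact Nat.mod_eq_of_lt (by split_ifs <;> omega)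
      have hrun₄ := run_eval (p := .bin .lt 80 x y ;; .store 81 79 ;; .bin .add 81 81 80 ;;
        .bin .add 77 77 7 ;; .bin .sub 78 78 7) (by simp [Prog.LoopFree]) s₃
      set s₄ := Prog.eval (.bin .lt 80 x y ;; .store 81 79 ;; .bin .add 81 81 80 ;;
        .bin .add 77 77 7 ;; .bin .sub 78 78 7) s₃ with hs₄
      have hM₄ : ∀ i < 2 ^ w, s₄.M i = if i = a + c then s.M (a + j) else s'.M i := by
        intro i hi
        simp only [hs₄, Prog.eval, State.M_setReg]
        rw [State.M_setMem _ _ _ hi]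
        simp [State.M_setReg, State.R_setReg, State.toNat_reg, g81, h79, hM₃]
      refine ⟨s₄, (hrun₃.seq hrun₄).mono (by simp only [Prog.size]; omega), ?_, ?_, ?_, ?_, ?_, ?_, ?_, ?_⟩
      · simp [hs₄, Prog.eval, State.R_setReg, State.R_setMem, g7]
      · simp [hs₄, Prog.eval, State.R_setReg, State.R_setMem, hk₃, h74]
      · simp [hs₄, Prog.eval, State.R_setReg, State.R_setMem, Op.eval_toNat, Op.nat, State.toNat_reg, g7,
          g77, e3]
      · simp [hs₄, Prog.eval, State.R_setReg, State.R_setMem, Op.eval_toNat, Op.nat, State.toNat_reg, g7,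
          g78, e4, -Nat.add_mod_mod, -Nat.mod_add_mod]
      · simp [hs₄, Prog.eval, State.R_setReg, State.R_setMem, Op.eval_toNat, Op.nat, State.toNat_reg,
          g81, c1, hxy, e5]
      · intro Q _
        have hold : Nat.count (fun i => Q (s₄.M (a + i))) c = Nat.count (fun i => Q (s'.M (a + i))) c :=
          count_congr fun i hi => by rw [hM₄ _ (by omega), if_neg (by omega)]
        rw [Nat.count_succ (fun i => P (s.M (a + i))), Nat.count_succ (fun i => _ ∧ _), ← hc, ← hQ Q]
        by_cases hp : P (s.M (a + j))
        · rw [if_pos hp, Nat.count_succ, hold, hM₄ _ (by omega), if_pos rfl]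
          simp [hp]
        · simp [hp, hold]
      · intro i hi hin
        rw [hM₄ _ (by omega), if_neg (by omega)]
        exact hrest i (by omega) hin
      · intro i hi hia
        rw [hM₄ _ hi, if_neg (by omega)]
        exact hframe i hi hia)
    (fun s' h => by rw [h.2.2.2.1]; omega)
    (s := s₁) ⟨(hk₁ 7 (by omega)).trans h7, hk₁ 74 (by omega), f77, f78, by simpa using f81, by simp,
      fun i _ _ => hM₁ _, fun i _ _ => hM₁ _⟩
  exact ⟨s₂, (hrun₁.seq hrun₂).mono (by omega), hcount, hframe⟩

end

section
variable {w : ℕ}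

/-! ### Selection: medians of medians -/

/-- Keep only the part of the array that contains the element of rank `k`, given the pivot in
register `74`.  The array is given by its address (registers `60` and `70`), its length (registers
`61` and `71`) and `k` (registers `62` and `72`). -/
def partitionProg : Prog :=
  countProg ;; (.bin .lt 80 72 75 ;; .bin .add 81 72 76 ;; .bin .lt 81 81 71) ;;
  .cond 80 (compactProg 79 74 ;; .bin .bor 61 75 75)
    (.cond 81 (.store 60 74 ;; .const 61 1 ;; .const 62 0)
      (compactProg 74 79 ;; (.bin .sub 82 71 76 ;; .bin .sub 62 62 82 ;; .bin .bor 61 76 76)))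

lemma partitionProg_keeps {i : ℕ} (hi : i < 61 ∨ 62 < i ∧ i < 75 ∨ 82 < i) : partitionProg.Keeps i := by
  simp [partitionProg, countProg, compactProg, Prog.Keeps]
  omega

/-- After the partition, the word of the wanted rank in the new array is the one in the old array. -/
lemma partitionProg_run {s : State w} {a n k p : ℕ} (hw : 1 < 2 ^ w) (h7 : s.R 7 = 1)
    (h60 : s.R 60 = a) (h62 : s.R 62 = k) (h70 : s.R 70 = a)
    (h71 : s.R 71 = n) (h72 : s.R 72 = k) (h74 : s.R 74 = p) (ha : a + 2 * n < 2 ^ w) (hk : k < n) :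
    ∃ s' n' k', Run partitionProg s (15 * n + 20) s' ∧ s'.R 61 = n' ∧ s'.R 62 = k' ∧ k' < n' ∧
      (n' = Nat.count (fun i => s.M (a + i) < p) n ∨ n' = Nat.count (fun i => p < s.M (a + i)) n ∨
        n' = 1) ∧
      (∀ v, HasRank (fun i => s'.M (a + i)) n' k' v → HasRank (fun i => s.M (a + i)) n k v) ∧
      ∀ x < 2 ^ w, x < a ∨ a + n ≤ x → s'.M x = s.M x := by
  have c1 : 1 % 2 ^ w = 1 := Nat.mod_eq_of_lt hw
  obtain ⟨s₁, hrun₁, h75, h76, hmem₁⟩ := countProg_run hw h7 h70 h71 h74 (by omega)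
  have hM₁ : ∀ i, s₁.M i = s.M i := fun i => by rw [State.M, hmem₁]; rfl
  have hk₁ : ∀ i < 75, s₁.R i = s.R i := fun i hi => hrun₁.R_eq (countProg_keeps (by omega))
  set L := Nat.count (fun i => s.M (a + i) < p) n with hL
  set G := Nat.count (fun i => p < s.M (a + i)) n with hG
  have hLn : L ≤ n := Nat.count_le _
  have hGn : G ≤ n := Nat.count_le _
  have e1 : (k + G) % 2 ^ w = k + G := Nat.mod_eq_of_lt (by omega)
  obtain ⟨s₂, hrun₂, hk₂, h80, h81, hmem₂⟩ : ∃ s₂, Run (.bin .lt 80 72 75 ;; .bin .add 81 72 76 ;;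
      .bin .lt 81 81 71) s₁ 3 s₂ ∧ (∀ i < 80, s₂.R i = s₁.R i) ∧ s₂.R 80 = (if k < L then 1 else 0) ∧
      s₂.R 81 = (if k + G < n then 1 else 0) ∧ s₂.mem = s₁.mem := by
    have hrun := run_eval (p := .bin .lt 80 72 75 ;; .bin .add 81 72 76 ;; .bin .lt 81 81 71)
      (by simp [Prog.LoopFree]) s₁
    refine ⟨_, hrun, fun i hi => hrun.R_eq (by simp [Prog.Keeps]; omega), ?_, ?_, rfl⟩ <;>
    simp [Prog.eval, State.R_setReg, Op.eval_toNat, Op.nat, State.toNat_reg, h75, h76, hk₁, h71, h72, c1, e1]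
  have hM₂ : ∀ i, s₂.M i = s.M i := fun i => by rw [State.M, hmem₂]; exact hM₁ i
  have hold : ∀ i < 75, s₂.R i = s.R i := fun i hi => (hk₂ i (by omega)).trans (hk₁ i hi)
  have g74 := (hold 74 (by omega)).trans h74
  have g75 := (hk₂ 75 (by omega)).trans h75
  have g76 := (hk₂ 76 (by omega)).trans h76
  by_cases hkL : k < L
  · rw [if_pos hkL] at h80
    obtain ⟨s₃, hrun₃, hcount, hframe⟩ := compactProg_run (s := s₂) (x := 79) (y := 74) (· < p) hw
      ((hold 7 (by omega)).trans h7) ((hold 70 (by omega)).trans h70) ((hold 71 (by omega)).trans h71)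
      (by omega) (fun s' h => by rw [h, g74])
    simp only [hM₂, ← hL] at hcount hframe
    have hk₃ : ∀ i < 77, s₃.R i = s₂.R i := fun i hi => hrun₃.R_eq (compactProg_keeps (by omega))
    have hrun₄ := run_eval (p := .bin .bor 61 75 75) (by simp [Prog.LoopFree]) s₃
    refine ⟨_, L, k, ((hrun₁.seq (hrun₂.seq (Run.cond_pos (by omega) (hrun₃.seq hrun₄))))).mono
      (by simp only [Prog.size]; omega), ?_, ?_, hkL, Or.inl rfl, fun v hv => ?_, hframe⟩
    · simp [Prog.eval, State.R_setReg, Op.eval_toNat, Op.nat, State.toNat_reg, hk₃, g75]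
    · simp [Prog.eval, State.R_setReg, hk₃, hold, h62]
    · exact HasRank.of_less hcount hL hv
  · rw [if_neg hkL] at h80
    by_cases hkG : k + G < n
    · rw [if_pos hkG] at h81
      have hrun₃ := run_eval (p := .store 60 74 ;; .const 61 1 ;; .const 62 0) (by simp [Prog.LoopFree]) s₂
      have hM₃ : ∀ x < 2 ^ w, (Prog.eval (.store 60 74 ;; .const 61 1 ;; .const 62 0) s₂).M x =
          if x = a then p else s.M x := fun x hx => by
        simp only [Prog.eval, State.M_setReg]
        rw [State.M_setMem _ _ _ hx, State.toNat_reg, g74, hold 60 (by omega), h60, hM₂]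
      refine ⟨_, 1, 0, ((hrun₁.seq (hrun₂.seq (Run.cond_neg h80 (Run.cond_pos (by omega) hrun₃))))).mono
        (by simp only [Prog.size]; omega), ?_, ?_, one_pos, Or.inr (Or.inr rfl), fun v hv => ?_,
        fun x hx hxa => ?_⟩
      · simp [Prog.eval, State.R_setReg, c1]
      · simp [Prog.eval, State.R_setReg]
      · exact HasRank.of_equal (p := p) ⟨not_lt.1 hkL, show G + k < n by omega⟩
          (by simp only [add_zero]; rw [hM₃ _ (by omega), if_pos rfl]) hv
      · rw [hM₃ _ hx, if_neg (by omega)]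
    · rw [if_neg hkG] at h81
      obtain ⟨s₃, hrun₃, hcount, hframe⟩ := compactProg_run (s := s₂) (x := 74) (y := 79) (p < ·) hw
        ((hold 7 (by omega)).trans h7) ((hold 70 (by omega)).trans h70) ((hold 71 (by omega)).trans h71)
        (by omega) (fun s' h => by rw [h, g74])
      simp only [hM₂, ← hG] at hcount hframe
      have hk₃ : ∀ i < 77, s₃.R i = s₂.R i := fun i hi => hrun₃.R_eq (compactProg_keeps (by omega))
      have hrun₄ := run_eval (p := .bin .sub 82 71 76 ;; .bin .sub 62 62 82 ;; .bin .bor 61 76 76)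
        (by simp [Prog.LoopFree]) s₃
      have e2 : (2 ^ w - G + n) % 2 ^ w = n - G := by
        rw [show 2 ^ w - G + n = n - G + 2 ^ w by omega, Nat.add_mod_right, Nat.mod_eq_of_lt (by omega)]
      have e3 : (2 ^ w - (n - G) + k) % 2 ^ w = k - (n - G) := by
        rw [show 2 ^ w - (n - G) + k = k - (n - G) + 2 ^ w by omega, Nat.add_mod_right,
          Nat.mod_eq_of_lt (by omega)]
      refine ⟨_, G, k - (n - G), ((hrun₁.seq (hrun₂.seq (Run.cond_neg h80 (Run.cond_neg h81
        (hrun₃.seq hrun₄)))))).mono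
        (by simp only [Prog.size]; omega), ?_, ?_, by omega, Or.inr (Or.inl rfl), fun v hv => ?_, hframe⟩
      · simp [Prog.eval, State.R_setReg, Op.eval_toNat, Op.nat, State.toNat_reg, hk₃, g76]
      · simp [Prog.eval, State.R_setReg, Op.eval_toNat, Op.nat, State.toNat_reg, hk₃, g76, hold, h71, h62,
          e2, e3, -Nat.add_mod_mod, -Nat.mod_add_mod]
      · exact HasRank.of_greater hcount hG (by omega) hv

/-- Store the medians of consecutive groups of five words (from the address in register `70` on) from
the address in register `89` on.  Register `88` holds the number of groups. -/
def mediansProg : Prog :=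
  .loop 88 (bruteProg ;; (.store 89 73 ;; .bin .add 89 89 7 ;; .bin .add 70 70 71 ;; .bin .sub 88 88 7))

lemma mediansProg_run {s : State w} {a m B : ℕ} (hw : 1 < 2 ^ w) (h7 : s.R 7 = 1) (h70 : s.R 70 = a)
    (h71 : s.R 71 = 5) (h72 : s.R 72 = 2) (h88 : s.R 88 = m) (h89 : s.R 89 = B) (ha : a + 5 * m ≤ B)
    (hB : B + m + 16 < 2 ^ w) :
    ∃ s', Run mediansProg s (303 * m + 1) s' ∧
      (∀ j < m, HasRank (fun i => s.M (a + (5 * j + i))) 5 2 (s'.M (B + j))) ∧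
      ∀ x < 2 ^ w, x < B ∨ B + m ≤ x → s'.M x = s.M x := by
  obtain ⟨s₁, hrun₁, -, -, -, -, -, -, hrank, hframe⟩ := Run.loop (w := w) (x := 88)
    (p := bruteProg ;; (.store 89 73 ;; .bin .add 89 89 7 ;; .bin .add 70 70 71 ;; .bin .sub 88 88 7))
    (fun j s' => s'.R 7 = 1 ∧ s'.R 70 = a + 5 * j ∧ s'.R 71 = 5 ∧ s'.R 72 = 2 ∧ s'.R 88 = m - j ∧
      s'.R 89 = B + j ∧ (∀ i < j, HasRank (fun q => s.M (a + (5 * i + q))) 5 2 (s'.M (B + i))) ∧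
      ∀ x < 2 ^ w, x < B ∨ B + j ≤ x → s'.M x = s.M x) m 302
    (by
      rintro j hj s' ⟨h7, h70, h71, h72, h88, h89, hrank, hframe⟩
      refine ⟨by omega, ?_⟩
      obtain ⟨s₂, hrun₂, hr, hmem₂⟩ := bruteProg_run hw h7 h70 h71 h72 (by omega) (by omega)
      have hM₂ : ∀ x, s₂.M x = s'.M x := fun x => by rw [State.M, hmem₂]; rfl
      have hk₂ : ∀ i, i < 73 ∨ 84 < i → s₂.R i = s'.R i := fun i hi => hrun₂.R_eq (bruteProg_keeps hi)
      obtain ⟨e, he⟩ : ∃ e, m - j = e + 1 := ⟨m - j - 1, by omega⟩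
      have hrun₃ := run_eval (p := .store 89 73 ;; .bin .add 89 89 7 ;; .bin .add 70 70 71 ;;
        .bin .sub 88 88 7) (by simp [Prog.LoopFree]) s₂
      set s₃ := Prog.eval (.store 89 73 ;; .bin .add 89 89 7 ;; .bin .add 70 70 71 ;;
        .bin .sub 88 88 7) s₂ with hs₃
      have hM₃ : ∀ x < 2 ^ w, s₃.M x = if x = B + j then s₂.R 73 else s'.M x := fun x hx => by
        simp only [hs₃, Prog.eval, State.M_setReg]
        rw [State.M_setMem _ _ _ hx, State.toNat_reg, hk₂ 89 (by omega), h89, hM₂]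
      have e3 : (a + 5 * j + 5) % 2 ^ w = a + 5 * (j + 1) := Nat.mod_eq_of_lt (by omega)
      have e4 : (2 ^ w - 1 + (e + 1)) % 2 ^ w = m - (j + 1) := by
        rw [sub_one_mod (by omega)]; omega
      have e5 : (B + j + 1) % 2 ^ w = B + (j + 1) := Nat.mod_eq_of_lt (by omega)
      refine ⟨s₃, (hrun₂.seq hrun₃).mono (by simp only [Prog.size]; omega), ?_, ?_, ?_, ?_, ?_, ?_,
        fun i hi => ?_, fun x hx hxB => ?_⟩
      · simp [hs₃, Prog.eval, State.R_setReg, State.R_setMem, hk₂, h7]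
      · simp [hs₃, Prog.eval, State.R_setReg, State.R_setMem, Op.eval_toNat, Op.nat, State.toNat_reg, hk₂,
          h70, h71, e3]
      · simp [hs₃, Prog.eval, State.R_setReg, State.R_setMem, hk₂, h71]
      · simp [hs₃, Prog.eval, State.R_setReg, State.R_setMem, hk₂, h72]
      · simp [hs₃, Prog.eval, State.R_setReg, State.R_setMem, Op.eval_toNat, Op.nat, State.toNat_reg, hk₂,
          h7, h88, he, e4, -Nat.add_mod_mod, -Nat.mod_add_mod]
      · simp [hs₃, Prog.eval, State.R_setReg, State.R_setMem, Op.eval_toNat, Op.nat, State.toNat_reg, hk₂,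
          h7, h89, e5]
      · rw [hM₃ _ (by omega)]
        rcases Nat.lt_succ_iff_lt_or_eq.1 hi with h | rfl
        · rw [if_neg (by omega)]
          exact hrank i h
        · rw [if_pos rfl]
          refine hr.congr fun q hq => ?_
          rw [hframe _ (by omega) (by omega), add_assoc]
      · rw [hM₃ _ hx, if_neg (by omega)]
        exact hframe x hx (by omega))
    (fun s' h => by rw [h.2.2.2.2.1]; omega)
    (s := s) ⟨h7, h70, h71, h72, h88, h89, by simp, fun _ _ _ => rfl⟩
  exact ⟨s₁, hrun₁.mono (by omega), hrank, hframe⟩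

/-- Save the description of the current array behind the array. -/
def saveFrame : Prog :=
  .bin .add 85 60 61 ;; .store 85 60 ;; .bin .add 85 85 7 ;; .store 85 61 ;; .bin .add 85 85 7 ;;
  .store 85 62 ;; .bin .add 85 85 7

/-- Prepare `mediansProg`. -/
def startMedians : Prog :=
  .const 71 5 ;; .const 72 2 ;; .bin .div 86 61 71 ;; .bin .bor 88 86 86 ;; .bin .bor 70 60 60 ;;
  .bin .bor 89 85 85

/-- Make the array of the medians the current array, and increase the depth in register `64`. -/
def enterMedians : Prog :=
  .bin .bor 60 85 85 ;; .bin .bor 61 86 86 ;; .bin .shr 62 86 7 ;; .bin .add 64 64 7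

/-- Descend: the median of the medians of the groups of five is wanted next. -/
def pushProg : Prog := saveFrame ;; startMedians ;; mediansProg ;; enterMedians

lemma pushProg_keeps {i : ℕ} (hi : i < 60) : pushProg.Keeps i := by
  simp [pushProg, saveFrame, startMedians, mediansProg, enterMedians, bruteProg, countProg, testRank,
    Prog.Keeps]
  omega

lemma saveFrame_run {s : State w} {a n k : ℕ} (hw : 1 < 2 ^ w) (h7 : s.R 7 = 1) (h60 : s.R 60 = a)
    (h61 : s.R 61 = n) (h62 : s.R 62 = k) (ha : a + n + 3 < 2 ^ w) :
    ∃ s', Run saveFrame s 7 s' ∧ s'.R 85 = a + n + 3 ∧ s'.M (a + n) = a ∧ s'.M (a + n + 1) = n ∧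
      s'.M (a + n + 2) = k ∧ ∀ x < 2 ^ w, x < a + n ∨ a + n + 3 ≤ x → s'.M x = s.M x := by
  have c1 : 1 % 2 ^ w = 1 := Nat.mod_eq_of_lt hw
  have e1 : (a + n) % 2 ^ w = a + n := Nat.mod_eq_of_lt (by omega)
  have e2 : (a + n + 1) % 2 ^ w = a + n + 1 := Nat.mod_eq_of_lt (by omega)
  have e3 : (a + n + 1 + 1) % 2 ^ w = a + n + 2 := Nat.mod_eq_of_lt (by omega)
  have e4 : (a + n + 2 + 1) % 2 ^ w = a + n + 3 := Nat.mod_eq_of_lt (by omega)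
  have hM : ∀ x < 2 ^ w, (saveFrame.eval s).M x = if x = a + n + 2 then k else
      if x = a + n + 1 then n else if x = a + n then a else s.M x := fun x hx => by
    simp only [saveFrame, Prog.eval, State.M_setReg]
    rw [State.M_setMem _ _ _ hx, State.M_setReg, State.M_setMem _ _ _ hx, State.M_setReg,
      State.M_setMem _ _ _ hx, State.M_setReg]
    simp [State.R_setReg, State.R_setMem, Op.eval_toNat, Op.nat, State.toNat_reg, h7, h60, h61, h62, e1, e2,
      e3]
  refine ⟨_, run_eval (by simp [saveFrame, Prog.LoopFree]) s, ?_, ?_, ?_, ?_, fun x hx hxa => ?_⟩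
  · simp [saveFrame, Prog.eval, State.R_setReg, State.R_setMem, Op.eval_toNat, Op.nat, State.toNat_reg, h7,
      h60, h61, e1, e2, e3, e4]
  · rw [hM _ (by omega), if_neg (by omega), if_neg (by omega), if_pos rfl]
  · rw [hM _ (by omega), if_neg (by omega), if_pos rfl]
  · rw [hM _ (by omega), if_pos rfl]
  · rw [hM _ hx, if_neg (by omega), if_neg (by omega), if_neg (by omega)]

/-- Behind the array there are three cells for its description, and the medians follow them. -/
lemma pushProg_run {s : State w} {a n k D : ℕ} (hw : 1 < 2 ^ w) (h7 : s.R 7 = 1)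
    (h60 : s.R 60 = a) (h61 : s.R 61 = n) (h62 : s.R 62 = k) (h64 : s.R 64 = D)
    (ha : a + 4 * n + 64 ≤ 2 ^ w) (hn : 24 < n) (hD : D + 1 < 2 ^ w) :
    ∃ s', Run pushProg s (62 * n) s' ∧ s'.R 60 = a + n + 3 ∧ s'.R 61 = n / 5 ∧ s'.R 62 = n / 5 / 2 ∧
      s'.R 64 = D + 1 ∧ s'.M (a + n) = a ∧ s'.M (a + n + 1) = n ∧ s'.M (a + n + 2) = k ∧
      (∀ j < n / 5, HasRank (fun i => s.M (a + (5 * j + i))) 5 2 (s'.M (a + n + 3 + j))) ∧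
      ∀ x < 2 ^ w, x < a + n ∨ a + n + 3 + n / 5 ≤ x → s'.M x = s.M x := by
  have c2 : 2 % 2 ^ w = 2 := Nat.mod_eq_of_lt (by omega)
  have c5 : 5 % 2 ^ w = 5 := Nat.mod_eq_of_lt (by omega)
  obtain ⟨s₁, hrun₁, f85, fa, fn, fk, hframe₁⟩ := saveFrame_run hw h7 h60 h61 h62 (by omega)
  have hk₁ : ∀ i < 85, s₁.R i = s.R i := fun i hi => hrun₁.R_eq (by simp [saveFrame, Prog.Keeps]; omega)
  obtain ⟨s₂, hrun₂, hk₂, g70, g71, g72, g85, g86, g88, g89, hmem₂⟩ : ∃ s₂, Run startMedians s₁ 6 s₂ ∧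
      (∀ i < 70, s₂.R i = s₁.R i) ∧ s₂.R 70 = a ∧ s₂.R 71 = 5 ∧ s₂.R 72 = 2 ∧ s₂.R 85 = a + n + 3 ∧
      s₂.R 86 = n / 5 ∧ s₂.R 88 = n / 5 ∧ s₂.R 89 = a + n + 3 ∧ s₂.mem = s₁.mem := by
    have hrun := run_eval (p := startMedians) (by simp [startMedians, Prog.LoopFree]) s₁
    refine ⟨_, hrun, fun i hi => hrun.R_eq (by simp [startMedians, Prog.Keeps]; omega), ?_, ?_, ?_, ?_, ?_,
      ?_, ?_, rfl⟩ <;>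
    simp [startMedians, Prog.eval, State.R_setReg, Op.eval_toNat, Op.nat, State.toNat_reg, hk₁, h60, h61,
      f85, c2, c5]
  have hM₂ : ∀ x, s₂.M x = s₁.M x := fun x => by rw [State.M, hmem₂]; rfl
  obtain ⟨s₃, hrun₃, hrank, hframe₃⟩ := mediansProg_run hw
    ((hk₂ 7 (by omega)).trans ((hk₁ 7 (by omega)).trans h7)) g70 g71 g72 g88 g89 (by omega) (by omega)
  have hk₃ : ∀ i, i < 70 ∨ i = 85 ∨ i = 86 → s₃.R i = s₂.R i := fun i hi => hrun₃.R_eq (by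
    refine ⟨bruteProg_keeps (by omega), ?_⟩
    simp [Prog.Keeps]; omega)
  have hrun₄ := run_eval (p := enterMedians) (by simp [enterMedians, Prog.LoopFree]) s₃
  have e1 : (D + 1) % 2 ^ w = D + 1 := Nat.mod_eq_of_lt hD
  refine ⟨_, (hrun₁.seq (hrun₂.seq (hrun₃.seq hrun₄))).mono
    (by simp only [Prog.size, enterMedians]; omega), ?_, ?_, ?_, ?_, ?_, ?_, ?_, ?_, ?_⟩
  · simp [enterMedians, Prog.eval, State.R_setReg, Op.eval_toNat, Op.nat, State.toNat_reg, hk₃, g85]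
  · simp [enterMedians, Prog.eval, State.R_setReg, Op.eval_toNat, Op.nat, State.toNat_reg, hk₃, g86]
  · simp [enterMedians, Prog.eval, State.R_setReg, Op.eval_toNat, Op.nat, State.toNat_reg, hk₃, g86, hk₂,
      hk₁, h7]
  · simp [enterMedians, Prog.eval, State.R_setReg, Op.eval_toNat, Op.nat, State.toNat_reg, hk₃, hk₂,
      hk₁, h7, h64, e1]
  · exact (hframe₃ _ (by omega) (by omega)).trans ((hM₂ _).trans fa)
  · exact (hframe₃ _ (by omega) (by omega)).trans ((hM₂ _).trans fn)
  · exact (hframe₃ _ (by omega) (by omega)).trans ((hM₂ _).trans fk)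
  · intro j hj
    refine (hrank j hj).congr fun i hi => ?_
    rw [hM₂, hframe₁ _ (by omega) (by omega)]
  · intro x hx hxa
    exact (hframe₃ x hx (by omega)).trans ((hM₂ _).trans (hframe₁ x hx (by omega)))

/-- Copy the description of the current array to the input registers of `bruteProg`. -/
def copyArgs : Prog := .bin .bor 70 60 60 ;; .bin .bor 71 61 61 ;; .bin .bor 72 62 62

/-- Return to the array whose description is saved before the current array; the result for the
current array is the pivot. -/
def restoreFrame : Prog :=
  .bin .bor 74 73 73 ;; .const 85 3 ;; .bin .sub 85 60 85 ;; .load 60 85 ;; .bin .add 85 85 7 ;;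
  .load 61 85 ;; .bin .add 85 85 7 ;; .load 62 85 ;; .bin .sub 64 64 7

/-- Ascend: the current array is short; solve it by brute force, and use the result as the pivot one
level above. -/
def popProg : Prog := copyArgs ;; bruteProg ;; restoreFrame ;; copyArgs ;; partitionProg

lemma popProg_keeps {i : ℕ} (hi : i < 60) : popProg.Keeps i := by
  refine ⟨?_, bruteProg_keeps (by omega), ?_, ?_, partitionProg_keeps (by omega)⟩
  all_goals
    simp [copyArgs, restoreFrame, Prog.Keeps]
    omega

lemma copyArgs_run {s : State w} : ∃ s', Run copyArgs s 3 s' ∧ s'.R 70 = s.R 60 ∧ s'.R 71 = s.R 61 ∧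
    s'.R 72 = s.R 62 ∧ (∀ i, i < 70 ∨ 72 < i → s'.R i = s.R i) ∧ s'.mem = s.mem := by
  have hrun := run_eval (p := copyArgs) (by simp [copyArgs, Prog.LoopFree]) s
  refine ⟨_, hrun, ?_, ?_, ?_, fun i hi => hrun.R_eq (by simp [copyArgs, Prog.Keeps]; omega), rfl⟩ <;>
  simp [copyArgs, Prog.eval, State.R_setReg, Op.eval_toNat, Op.nat, State.toNat_reg]

/-- The hypotheses `fa`, `fn`, `fk` say what `pushProg` has saved for the array one level above. -/
lemma popProg_run {s : State w} {a n k D a' m k' : ℕ} (hw : 1 < 2 ^ w) (h7 : s.R 7 = 1)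
    (h60 : s.R 60 = a') (h61 : s.R 61 = m) (h62 : s.R 62 = k') (h64 : s.R 64 = D + 1)
    (ha' : a' = a + n + 3) (fa : s.M (a + n) = a) (fn : s.M (a + n + 1) = n) (fk : s.M (a + n + 2) = k)
    (ha : a + 4 * n + 64 ≤ 2 ^ w) (hm : m ≤ 24) (hk' : k' < m) (hk : k < n) :
    ∃ s' p n' k'', Run popProg s (15 * n + 5110) s' ∧ HasRank (fun i => s.M (a' + i)) m k' p ∧
      s'.R 60 = a ∧ s'.R 61 = n' ∧ s'.R 62 = k'' ∧ s'.R 64 = D ∧ k'' < n' ∧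
      (n' = Nat.count (fun i => s.M (a + i) < p) n ∨ n' = Nat.count (fun i => p < s.M (a + i)) n ∨
        n' = 1) ∧
      (∀ v, HasRank (fun i => s'.M (a + i)) n' k'' v → HasRank (fun i => s.M (a + i)) n k v) ∧
      ∀ x < 2 ^ w, x < a ∨ a + n ≤ x → s'.M x = s.M x := by
  obtain ⟨s₁, hrun₁, f70, f71, f72, hk₁, hmem₁⟩ := copyArgs_run (s := s)
  have hM₁ : ∀ x, s₁.M x = s.M x := fun x => by rw [State.M, hmem₁]; rfl
  have hlt := s.R_lt 64
  obtain ⟨s₂, hrun₂, hrank, hmem₂⟩ := bruteProg_run hw ((hk₁ 7 (by omega)).trans h7) (f70.trans h60)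
    (f71.trans h61) (f72.trans h62) (by omega) hk'
  simp only [hM₁] at hrank
  have hM₂ : ∀ x, s₂.M x = s.M x := fun x => by rw [State.M, hmem₂]; exact hM₁ x
  have hk₂ : ∀ i < 70, s₂.R i = s.R i := fun i hi =>
    (hrun₂.R_eq (bruteProg_keeps (by omega))).trans (hk₁ i (by omega))
  set p := s₂.R 73 with hp
  have c3 : 3 % 2 ^ w = 3 := Nat.mod_eq_of_lt (by omega)
  have e1 : (2 ^ w - 3 + (a + n + 3)) % 2 ^ w = a + n := by
    rw [show 2 ^ w - 3 + (a + n + 3) = a + n + 2 ^ w by omega, Nat.add_mod_right, Nat.mod_eq_of_lt (by omega)]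
  have e2 : (a + n + 1) % 2 ^ w = a + n + 1 := Nat.mod_eq_of_lt (by omega)
  have e3 : (a + n + 1 + 1) % 2 ^ w = a + n + 2 := Nat.mod_eq_of_lt (by omega)
  have e4 : (2 ^ w - 1 + (D + 1)) % 2 ^ w = D := sub_one_mod (by omega)
  obtain ⟨s₃, hrun₃, g7, g74, g60, g61, g62, g64, hmem₃⟩ : ∃ s₃, Run restoreFrame s₂ 9 s₃ ∧
      s₃.R 7 = 1 ∧ s₃.R 74 = p ∧ s₃.R 60 = a ∧ s₃.R 61 = n ∧ s₃.R 62 = k ∧ s₃.R 64 = D ∧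
      s₃.mem = s₂.mem := by
    refine ⟨_, run_eval (by simp [restoreFrame, Prog.LoopFree]) s₂, ?_, ?_, ?_, ?_, ?_, ?_, rfl⟩ <;>
    simp [restoreFrame, Prog.eval, State.R_setReg, State.M_setReg, State.mem_reg, Op.eval_toNat, Op.nat,
      State.toNat_reg, ← hp, hk₂, hM₂, h7, h60, h64, ha', fa, fn, fk, c3, e1, e2, e3, e4,
      -Nat.add_mod_mod, -Nat.mod_add_mod]
  obtain ⟨s₄, hrun₄, i70, i71, i72, hk₄, hmem₄⟩ := copyArgs_run (s := s₃)
  have hM₄ : ∀ x, s₄.M x = s.M x := fun x => by rw [State.M, hmem₄, hmem₃]; exact hM₂ x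
  obtain ⟨s₅, n', k'', hrun₅, h61₅, h62₅, hkn, hsize, hred, hframe⟩ := partitionProg_run (p := p) hw
    ((hk₄ 7 (by omega)).trans g7) ((hk₄ 60 (by omega)).trans g60) ((hk₄ 62 (by omega)).trans g62)
    (i70.trans g60) (i71.trans g61) (i72.trans g62) ((hk₄ 74 (by omega)).trans g74) (by omega) hk
  simp only [hM₄] at hsize hred hframe
  have hk₅ : ∀ i, i = 60 ∨ i = 64 → s₅.R i = s₄.R i := fun i hi =>
    hrun₅.R_eq (partitionProg_keeps (by omega))
  have ht : m * (8 * m + 19) ≤ 24 * (8 * 24 + 19) := Nat.mul_le_mul hm (by omega)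
  refine ⟨s₅, p, n', k'', (hrun₁.seq (hrun₂.seq (hrun₃.seq (hrun₄.seq hrun₅)))).mono (by omega), hrank, ?_,
    h61₅, h62₅, ?_, hkn, hsize, hred, hframe⟩
  · rw [hk₅ 60 (by omega), hk₄ 60 (by omega), g60]
  · rw [hk₅ 64 (by omega), hk₄ 64 (by omega), g64]

/-- Register `65` tells whether the current array is long, and register `66` whether the loop goes
on. -/
def updateFlags : Prog := .const 85 24 ;; .bin .lt 65 85 61 ;; .bin .add 66 65 64

/-- One round of the selection algorithm. -/
def selectRound : Prog := .cond 65 pushProg popProg ;; updateFlags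

/-- The selection algorithm: store in register `73` the word of rank `k` (register `62`) among `n`
words (register `61`) in the memory from address `a` (register `60`) on. -/
def selectProg : Prog :=
  (.const 64 0 ;; updateFlags) ;; .loop 66 selectRound ;; copyArgs ;; bruteProg

lemma selectProg_keeps {i : ℕ} (hi : i < 60) : selectProg.Keeps i := by
  refine ⟨?_, ⟨⟨pushProg_keeps hi, popProg_keeps hi⟩, ?_⟩, ?_, bruteProg_keeps (by omega)⟩
  all_goals
    simp [copyArgs, updateFlags, Prog.Keeps]
    omega

/-- The state of the selection algorithm between two rounds: the element of rank `k` of the `n` words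
from address `a` on is wanted, at depth `D` of the recursion. -/
structure Level (s : State w) (a n k D : ℕ) : Prop where
  one : s.R 7 = 1
  addr : s.R 60 = a
  len : s.R 61 = n
  rank : s.R 62 = k
  depth : s.R 64 = D
  big : s.R 65 = if 24 < n then 1 else 0
  guard : s.R 66 = (if 24 < n then 1 else 0) + D

lemma updateFlags_run {s : State w} {a n k D : ℕ} (h7 : s.R 7 = 1)
    (h60 : s.R 60 = a) (h61 : s.R 61 = n) (h62 : s.R 62 = k) (h64 : s.R 64 = D) (hw : 24 < 2 ^ w)
    (hD : D + 1 < 2 ^ w) : ∃ s', Run updateFlags s 3 s' ∧ Level s' a n k D ∧ s'.mem = s.mem := by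
  have hrun := run_eval (p := updateFlags) (by simp [updateFlags, Prog.LoopFree]) s
  have c1 : 1 % 2 ^ w = 1 := Nat.mod_eq_of_lt (by omega)
  have c24 : 24 % 2 ^ w = 24 := Nat.mod_eq_of_lt hw
  have e1 : ((if 24 < n then 1 else 0) + D) % 2 ^ w = (if 24 < n then 1 else 0) + D :=
    Nat.mod_eq_of_lt (by split_ifs <;> omega)
  refine ⟨_, hrun, ⟨?_, ?_, ?_, ?_, ?_, ?_, ?_⟩, rfl⟩ <;>
  simp [updateFlags, Prog.eval, State.R_setReg, Op.eval_toNat, Op.nat, State.toNat_reg, h7, h60, h61, h62,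
    h64, c1, c24, e1]

/-- Some rounds of the loop `while x ≠ 0 do p` lead from `s` to `s'`, in time `t`. -/
def Rounds (x : ℕ) (p : Prog) (s : State w) (t : ℕ) (s' : State w) : Prop :=
  ∀ t' s'', Run (.loop x p) s' t' s'' → Run (.loop x p) s (t + t') s''

lemma Rounds.refl {x : ℕ} {p : Prog} {s : State w} {t : ℕ} : Rounds x p s t s :=
  fun _ _ h => h.mono (by omega)

lemma Rounds.trans {x : ℕ} {p : Prog} {s s₁ s₂ : State w} {t₁ t₂ t : ℕ} (h₁ : Rounds x p s t₁ s₁)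
    (h₂ : Rounds x p s₁ t₂ s₂) (ht : t₁ + t₂ ≤ t) : Rounds x p s t s₂ :=
  fun t' s'' h => (h₁ _ _ (h₂ _ _ h)).mono (by omega)

lemma Rounds.single {x : ℕ} {p : Prog} {s s' : State w} {t : ℕ} (hx : s.R x ≠ 0) (h : Run p s t s') :
    Rounds x p s (t + 1) s' :=
  fun t' s'' h' => (Run.loop_step hx h h').mono (by omega)

/-- In linear time, the algorithm replaces the current array by a short one whose element of the
wanted rank is the same.  The array of the medians and the part of the array that remains after the
partition have together at most `19 / 20` of the original length. -/
lemma selectRound_rounds {n : ℕ} : ∀ {s : State w} {a k D : ℕ}, Level s a n k D → k < n →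
    a + 4 * n + 64 ≤ 2 ^ w → D + n < 2 ^ w → ∃ s' n' k', Level s' a n' k' D ∧ n' ≤ 24 ∧ k' < n' ∧
      Rounds 66 selectRound s (8000 * n) s' ∧
      (∀ v, HasRank (fun i => s'.M (a + i)) n' k' v → HasRank (fun i => s.M (a + i)) n k v) ∧
      ∀ x < 2 ^ w, x < a ∨ a + 4 * n ≤ x → s'.M x = s.M x := by
  induction n using Nat.strong_induction_on with
  | _ n ih =>
    intro s a k D hL hk ha hD
    by_cases hn : n ≤ 24
    · exact ⟨s, n, k, hL, hn, hk, Rounds.refl, fun v hv => hv, fun _ _ _ => rfl⟩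
    have hw : 1 < 2 ^ w := by omega
    have hn' : 24 < n := by omega
    obtain ⟨s₁, hrun₁, f60, f61, f62, f64, fa, fn, fk, hmed, hframe₁⟩ := pushProg_run hw hL.one hL.addr
      hL.len hL.rank hL.depth ha hn' (by omega)
    obtain ⟨s₂, hrun₂, hL₂, hmem₂⟩ := updateFlags_run ((hrun₁.R_eq (pushProg_keeps (by omega))).trans hL.one)
      f60 f61 f62 f64 (by omega) (by omega)
    have hM₂ : ∀ x, s₂.M x = s₁.M x := fun x => by rw [State.M, hmem₂]; rfl
    have hround₁ : Rounds 66 selectRound s (62 * n + 5) s₂ := by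
      have := Rounds.single (x := 66) (by rw [hL.guard, if_pos hn']; omega)
        ((Run.cond_pos (q := popProg) (x := 65) (by rw [hL.big, if_pos hn']; omega) hrun₁).seq hrun₂)
      exact this.trans (Rounds.refl (t := 0)) (by omega)
    obtain ⟨s₃, m', k', hL₃, hm', hk', hround₂, hred₃, hframe₃⟩ := ih (n / 5) (by omega) hL₂ (by omega)
      (by omega) (by omega)
    have harr₃ : ∀ x, x < a + n + 3 → s₃.M x = s₁.M x := fun x hx =>
      (hframe₃ x (by omega) (by omega)).trans (hM₂ x)
    obtain ⟨s₄, p, n₁, k₁, hrun₄, hp, g60, g61, g62, g64, hk₁, hsize, hred₄, hframe₄⟩ :=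
      popProg_run (a := a) (n := n) (k := k) hw hL₃.one hL₃.addr hL₃.len hL₃.rank hL₃.depth rfl
        ((harr₃ _ (by omega)).trans fa) ((harr₃ _ (by omega)).trans fn) ((harr₃ _ (by omega)).trans fk)
        ha hm' hk' hk
    obtain ⟨s₅, hrun₅, hL₅, hmem₅⟩ := updateFlags_run
      ((hrun₄.R_eq (popProg_keeps (by omega))).trans hL₃.one) g60 g61 g62 g64 (by omega) (by omega)
    have hM₅ : ∀ x, s₅.M x = s₄.M x := fun x => by rw [State.M, hmem₅]; rfl
    have hround₃ : Rounds 66 selectRound s₃ (15 * n + 5115) s₅ := by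
      have := Rounds.single (x := 66) (by rw [hL₃.guard, if_neg (by omega)]; omega)
        ((Run.cond_neg (p := pushProg) (x := 65) (by rw [hL₃.big, if_neg (by omega)]) hrun₄).seq hrun₅)
      exact this.trans (Rounds.refl (t := 0)) (by omega)
    have harr : ∀ i < n, s₃.M (a + i) = s.M (a + i) := fun i hi =>
      (harr₃ _ (by omega)).trans (hframe₁ _ (by omega) (by omega))
    have hpm : HasRank (fun j => s₁.M (a + n + 3 + j)) (n / 5) (n / 5 / 2) p :=
      (hred₃ p hp).congr fun i _ => (hM₂ _).symm
    have hpiv := pivot_counts (f := fun i => s.M (a + i)) hmed hpm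
    have hsize' : n / 5 + n₁ ≤ 19 * n / 20 := by
      have h1 : Nat.count (fun i => s₃.M (a + i) < p) n = Nat.count (fun i => s.M (a + i) < p) n :=
        count_congr fun i hi => by rw [harr i hi]
      have h2 : Nat.count (fun i => p < s₃.M (a + i)) n = Nat.count (fun i => p < s.M (a + i)) n :=
        count_congr fun i hi => by rw [harr i hi]
      rw [h1, h2] at hsize
      rcases hsize with h | h | h <;> omega
    obtain ⟨s₆, n₂, k₂, hL₆, hn₂, hk₂, hround₄, hred₆, hframe₆⟩ := ih n₁ (by omega) hL₅ hk₁ (by omega)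
      (by omega)
    refine ⟨s₆, n₂, k₂, hL₆, hn₂, hk₂,
      hround₁.trans (hround₂.trans (hround₃.trans hround₄ le_rfl) le_rfl) (by omega), fun v hv => ?_,
      fun x hx hxa => ?_⟩
    · have h1 := (hred₆ v hv).congr (g := fun i => s₄.M (a + i)) fun i _ => (hM₅ _).symm
      exact (hred₄ v h1).congr fun i hi => (harr i hi).symm
    · rw [hframe₆ x hx (by omega), hM₅, hframe₄ x hx (by omega), hframe₃ x hx (by omega), hM₂,
        hframe₁ x hx (by omega)]

/-- Selection in linear time. -/
lemma selectProg_run {s : State w} {a n k : ℕ} (h7 : s.R 7 = 1) (h60 : s.R 60 = a) (h61 : s.R 61 = n)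
    (h62 : s.R 62 = k) (ha : a + 4 * n + 64 ≤ 2 ^ w) (hk : k < n) :
    ∃ s', Run selectProg s (8000 * n + 5100) s' ∧ HasRank (fun i => s.M (a + i)) n k (s'.R 73) ∧
      ∀ x < 2 ^ w, x < a ∨ a + 4 * n ≤ x → s'.M x = s.M x := by
  obtain ⟨s₁, hrun₁, f64, hk₁, hmem₁⟩ : ∃ s₁, Run (.const 64 0) s 1 s₁ ∧ s₁.R 64 = 0 ∧
      (∀ i, i ≠ 64 → s₁.R i = s.R i) ∧ s₁.mem = s.mem := by
    have hrun := run_eval (p := .const 64 0) (by simp [Prog.LoopFree]) s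
    exact ⟨_, hrun, by simp [Prog.eval, State.R_setReg], fun i hi => hrun.R_eq hi, rfl⟩
  obtain ⟨s₂, hrun₂, hL₂, hmem₂⟩ := updateFlags_run ((hk₁ 7 (by omega)).trans h7)
    ((hk₁ 60 (by omega)).trans h60) ((hk₁ 61 (by omega)).trans h61) ((hk₁ 62 (by omega)).trans h62) f64
    (by omega) (by omega)
  have hM₂ : ∀ x, s₂.M x = s.M x := fun x => by rw [State.M, hmem₂, hmem₁]; rfl
  obtain ⟨s₃, n', k', hL₃, hn', hk', hround, hred, hframe⟩ := selectRound_rounds hL₂ hk ha (by omega)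
  have hrun₃ := hround 1 s₃ (Run.loop_stop (by rw [hL₃.guard, if_neg (by omega)]))
  obtain ⟨s₄, hrun₄, g70, g71, g72, hk₄, hmem₄⟩ := copyArgs_run (s := s₃)
  have hM₄ : ∀ x, s₄.M x = s₃.M x := fun x => by rw [State.M, hmem₄]; rfl
  obtain ⟨s₅, hrun₅, hrank, hmem₅⟩ := bruteProg_run (by omega) ((hk₄ 7 (by omega)).trans hL₃.one)
    (g70.trans hL₃.addr) (g71.trans hL₃.len) (g72.trans hL₃.rank) (by omega) hk'
  have hM₅ : ∀ x, s₅.M x = s₄.M x := fun x => by rw [State.M, hmem₅]; rfl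
  have ht : n' * (8 * n' + 19) ≤ 24 * (8 * 24 + 19) := Nat.mul_le_mul hn' (by omega)
  refine ⟨s₅, ((hrun₁.seq hrun₂).seq (hrun₃.seq (hrun₄.seq hrun₅))).mono (by omega), ?_, fun x hx hxa => ?_⟩
  · simp only [hM₄] at hrank
    exact (hred _ hrank).congr fun i _ => (hM₂ _).symm
  · rw [hM₅, hM₄, hframe x hx hxa, hM₂]

end

section
variable {w : ℕ}

/-! ### The query program -/

lemma count_eq_card_fin (p : ℕ → Prop) [DecidablePred p] (n : ℕ) :
    Nat.count p n = (Finset.univ.filter fun i : Fin n => p i).card := by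
  rw [Nat.count_eq_card_filter_range, ← Nat.Iio_eq_range, ← Fin.map_valEmbedding_univ, Finset.filter_map,
    Finset.card_map]
  rfl

/-- The median has the middle rank, also after a shift that makes all numbers nonnegative. -/
lemma hasRank_median {r : ℕ} (hr : 0 < r) (e : Fin r → ℤ) (c : ℤ) (f : ℕ → ℕ)
    (hf : ∀ i : Fin r, f i = (e i + c).toNat) : HasRank f r (r / 2) (median e + c).toNat := by
  set m : Fin r := ⟨r / 2, Nat.div_lt_self hr one_lt_two⟩ with hm
  have hmed : median e = e (Tuple.sort e m) := by rw [median, dif_pos hr]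
  have hmono := Tuple.monotone_sort e
  have h1 : Nat.count (fun i => f i < (median e + c).toNat) r ≤ r / 2 := by
    rw [count_eq_card_fin]
    calc _ ≤ (Finset.Iio m).card := by
          refine Finset.card_le_card_of_injOn (Tuple.sort e).symm (fun i hi => ?_)
            (Equiv.injective _).injOn
          simp only [Finset.coe_filter, Finset.mem_univ, true_and, Set.mem_ofPred_eq, hf] at hi
          rw [Finset.coe_Iio, Set.mem_Iio]
          by_contra hlt
          have h := hmono (not_lt.1 hlt)
          simp only [Function.comp_apply, Equiv.apply_symm_apply] at h
          rw [hmed] at hi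
          omega
      _ = r / 2 := by rw [Fin.card_Iio]
  have h2 : Nat.count (fun i => (median e + c).toNat < f i) r ≤ r - 1 - r / 2 := by
    rw [count_eq_card_fin]
    calc _ ≤ (Finset.Ioi m).card := by
          refine Finset.card_le_card_of_injOn (Tuple.sort e).symm (fun i hi => ?_)
            (Equiv.injective _).injOn
          simp only [Finset.coe_filter, Finset.mem_univ, true_and, Set.mem_ofPred_eq, hf] at hi
          rw [Finset.coe_Ioi, Set.mem_Ioi]
          by_contra hlt
          have h := hmono (not_lt.1 hlt)
          simp only [Function.comp_apply, Equiv.apply_symm_apply] at h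
          rw [hmed] at hi
          omega
      _ = r - 1 - r / 2 := by rw [Fin.card_Ioi]
  exact ⟨h1, by omega⟩

/-- Prepare the query: start with row `0`, find the address of the array for the row estimates, and
compute the shift `2 ^ (w - 1)`. -/
def startQuery (N : ℕ) : Prog :=
  .const 56 (3 * N) ;; .bin .add 56 10 56 ;; .bin .bor 58 56 56 ;; .bin .sub 57 8 7 ;; .bin .shl 57 7 57

/-- Load the table cell of the row, and multiply by the sign. -/
def loadSigned : Prog := .load 52 55 ;; .cond 53 (.const 30 0) (.const 30 0 ;; .bin .sub 52 30 52)

/-- Shift the estimate of the row by `2 ^ (w - 1)`, and store it. -/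
def storeShifted : Prog := .bin .add 52 52 57 ;; .store 56 52 ;; .bin .add 56 56 7

/-- Prepare the selection of the median. -/
def startSelect : Prog := .bin .bor 60 58 58 ;; .bin .bor 61 4 4 ;; .bin .shr 62 4 7

/-- The query program: estimate the coordinate whose number is in register `0`. -/
def queryProg (N : ℕ) : Prog :=
  setupProg N ;; firstRow ;; startQuery N ;; .loop 14 (locateProg N ;; loadSigned ;; storeShifted ;; nextRow) ;;
  startSelect ;; selectProg ;; .bin .sub 0 73 57

lemma startQuery_run {N B : ℕ} {s : State w} (hw : 1 < 2 ^ w) (hB : B + 3 * N < 2 ^ w) (h7 : s.R 7 = 1)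
    (h8 : s.R 8 = w) (h10 : s.R 10 = B) :
    ∃ s', Run (startQuery N) s 5 s' ∧ s'.R 56 = B + 3 * N ∧ s'.R 58 = B + 3 * N ∧
      s'.R 57 = 2 ^ (w - 1) ∧ s'.mem = s.mem := by
  have hw0 : 0 < w := by
    rcases Nat.eq_zero_or_pos w with h | h
    · rw [h] at hw; norm_num at hw
    · exact h
  have e1 : 3 * N % 2 ^ w = 3 * N := Nat.mod_eq_of_lt (by omega)
  have e2 : (B + 3 * N) % 2 ^ w = B + 3 * N := Nat.mod_eq_of_lt hB
  have e3 : (2 ^ w - 1 + w) % 2 ^ w = w - 1 := by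
    have hlt : w < 2 ^ w := Nat.lt_two_pow_self
    obtain ⟨m, hm⟩ : ∃ m, w = m + 1 := ⟨w - 1, by omega⟩
    have := sub_one_mod (w := w) (j := m) (by omega)
    rw [← hm] at this
    rw [this]; omega
  have e4 : 2 ^ (w - 1) % 2 ^ w = 2 ^ (w - 1) :=
    Nat.mod_eq_of_lt (Nat.pow_lt_pow_right one_lt_two (by omega))
  refine ⟨_, run_eval (by simp [startQuery, Prog.LoopFree]) s, ?_, ?_, ?_, rfl⟩ <;>
  simp [startQuery, Prog.eval, State.R_setReg, Op.eval_toNat, Op.nat, State.toNat_reg, h7, h8, h10, e1, e2,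
    e3, e4, Nat.shiftLeft_eq, -Nat.add_mod_mod, -Nat.mod_add_mod]

lemma loadSigned_run {s : State w} {y : ℤ} {p : Prop} [Decidable p]
    (h53 : s.R 53 = if p then 1 else 0) (hy : s.mem (s.reg 55) = BitVec.ofInt w y) :
    ∃ s', Run loadSigned s 5 s' ∧ s'.reg 52 = BitVec.ofInt w ((if p then 1 else -1) * y) ∧
      s'.mem = s.mem := by
  have hR : ∀ f, State.R { reg := Function.update s.reg 52 f, mem := s.mem } 53 = if p then 1 else 0 :=
    fun f => h53
  refine ⟨_, (run_eval (by simp [loadSigned, Prog.LoopFree]) s).mono (by simp [loadSigned, Prog.size]),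
    ?_, ?_⟩
  all_goals
    by_cases h : p <;>
    simp [loadSigned, Prog.eval, State.setReg, hR, h, Op.eval, hy, BitVec.ofInt_neg]

lemma loadSigned_keeps {i : ℕ} (hi : i ≠ 30) (hi' : i ≠ 52) : loadSigned.Keeps i :=
  ⟨hi', hi, hi, hi'⟩

lemma storeShifted_run {s : State w} {z : ℤ} {B : ℕ} (hw : 0 < w) (h7 : s.R 7 = 1)
    (h52 : s.reg 52 = BitVec.ofInt w z) (hz : |z| < 2 ^ (w - 1)) (h57 : s.R 57 = 2 ^ (w - 1))
    (h56 : s.R 56 = B) (hB : B + 1 < 2 ^ w) :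
    ∃ s', Run storeShifted s 3 s' ∧ s'.R 56 = B + 1 ∧ ∀ a < 2 ^ w, s'.M a =
      if a = B then (z + 2 ^ (w - 1)).toNat else s.M a := by
  have h57' : s.reg 57 = BitVec.ofInt w (2 ^ (w - 1)) := by
    rw [show ((2 : ℤ) ^ (w - 1)) = ((2 ^ (w - 1) : ℕ) : ℤ) by push_cast; rfl, BitVec.ofInt_natCast, ← h57,
      State.R, BitVec.ofNat_toNat, BitVec.setWidth_eq]
  have hpow : (2 : ℤ) ^ w = 2 * 2 ^ (w - 1) := by rw [← pow_succ', Nat.sub_add_cancel hw]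
  have hword : ((s.reg 52 + s.reg 57).toNat : ℕ) = (z + 2 ^ (w - 1)).toNat := by
    have hz' := abs_lt.1 hz
    rw [h52, h57', ← BitVec.ofInt_add, BitVec.toNat_ofInt]
    congr 1
    push_cast
    exact Int.emod_eq_of_lt (by omega) (by omega)
  have e1 : (B + 1) % 2 ^ w = B + 1 := Nat.mod_eq_of_lt hB
  refine ⟨_, run_eval (by simp [storeShifted, Prog.LoopFree]) s, ?_, fun a ha => ?_⟩
  · simp [storeShifted, Prog.eval, State.R_setReg, State.R_setMem, Op.eval_toNat, Op.nat, State.toNat_reg, h56,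
      h7, e1]
  · simp only [storeShifted, Prog.eval, State.M_setReg]
    rw [State.M_setMem _ _ _ ha, State.toNat_reg, ← hword]
    simp only [State.R_setReg, State.M_setReg, Op.eval]
    simp [h56]

lemma storeShifted_keeps {i : ℕ} (hi : i ≠ 52) (hi' : i ≠ 56) : storeShifted.Keeps i :=
  ⟨hi, trivial, hi'⟩

lemma startSelect_run {s : State w} (h7 : s.R 7 = 1) : ∃ s', Run startSelect s 3 s' ∧
    s'.R 60 = s.R 58 ∧ s'.R 61 = s.R 4 ∧ s'.R 62 = s.R 4 / 2 ∧ (∀ i < 60, s'.R i = s.R i) ∧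
    s'.mem = s.mem := by
  have hrun := run_eval (p := startSelect) (by simp [startSelect, Prog.LoopFree]) s
  refine ⟨_, hrun, ?_, ?_, ?_, fun i hi => hrun.R_eq (by simp [startSelect, Prog.Keeps]; omega), rfl⟩ <;>
  simp [startSelect, Prog.eval, State.R_setReg, Op.eval_toNat, Op.nat, State.toNat_reg, h7]

lemma startQuery_keeps {N i : ℕ} (hi : i < 56 ∨ 58 < i) : (startQuery N).Keeps i := by
  simp [startQuery, Prog.Keeps]
  omega

/-- The query program does not touch the data structure. Words are compared as unsigned numbers, so
the estimates are shifted by `2 ^ (w - 1)` before the selection, and shifted back at the end. -/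
lemma queryProg_run {N d τ r b k : ℕ} {s : State w} (hF : Fits w N d τ r b k) (hr : 0 < r)
    (hP : ParamsAt s d τ r b k) {σ : Seed (N * w) b k} (hσ : SeedAt s σ)
    {y : Fin r × Fin (2 ^ τ) → ℤ} (hy : TableAt s (descrWords N b k) y)
    (hlt : ∀ ij, |y ij| < 2 ^ (w - 1)) (ℓ : Fin d) (h0 : s.R 0 = ℓ) :
    ∃ s', Run (queryProg N) s
        (3 * k + 5150 + r * (k * (30 * N * N + 30 * N + 21) + 5 * N + 8030)) s' ∧
      (∀ a < descrWords N b k + r * 2 ^ τ, s'.M a = s.M a) ∧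
      s'.reg 0 = BitVec.ofInt w (csEstimate (prgHash d τ r σ) (prgSign d r σ) y ℓ) := by
  have hw := hF.one_lt
  have hmem := hF.mem
  have hN := hF.hN
  have hw0 : 0 < w := by
    rcases Nat.eq_zero_or_pos w with h | h
    · rw [h] at hw; norm_num at hw
    · exact h
  set T := descrWords N b k with hT
  set B := T + r * 2 ^ τ with hB
  set e : Fin r → ℤ := fun i => prgSign d r σ i ℓ * y (i, prgHash d τ r σ i ℓ) with he
  have habs : ∀ i, |e i| < 2 ^ (w - 1) := fun i => by
    have : |e i| = |y (i, prgHash d τ r σ i ℓ)| := by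
      simp only [he, prgSign]
      split_ifs <;> simp
    rw [this]
    exact hlt _
  obtain ⟨s₁, hrun₁, hR₁, hmem₁⟩ := setupProg_run hF hP
  have hM₁ : ∀ a, s₁.M a = s.M a := fun a => by rw [State.M, hmem₁]; rfl
  obtain ⟨s₂, hrun₂, h13₂, h14₂, hmem₂⟩ := firstRow_run (s := s₁)
  have hM₂ : ∀ a, s₂.M a = s.M a := fun a => by rw [State.M, hmem₂]; exact hM₁ a
  have hR₂ := hR₁.of_keeps hrun₂ fun i h1 h2 => firstRow_keeps (by omega) (by omega)
  obtain ⟨s₃, hrun₃, h56₃, h58₃, h57₃, hmem₃⟩ :=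
    startQuery_run (N := N) hw (by omega) hR₂.reg_one hR₂.reg_w hR₂.reg_free
  have hM₃ : ∀ a, s₃.M a = s.M a := fun a => by rw [State.M, hmem₃]; exact hM₂ a
  have hR₃ := hR₂.of_keeps hrun₃ fun i h1 h2 => startQuery_keeps (by omega)
  have hk₃ : ∀ i, i < 56 → s₃.R i = s₂.R i := fun i hi => hrun₃.R_eq (startQuery_keeps (by omega))
  obtain ⟨s₄, hrun₄, hR₄, -, -, -, -, h57₄, h58₄, harr₄, hM₄⟩ := Run.loop (w := w) (x := 14)
    (p := locateProg N ;; loadSigned ;; storeShifted ;; nextRow)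
    (fun m s' => Ready s' N d τ r b k ∧ s'.R 0 = ℓ ∧ s'.R 13 = m ∧ s'.R 14 = r - m ∧
      s'.R 56 = B + 3 * N + m ∧ s'.R 57 = 2 ^ (w - 1) ∧ s'.R 58 = B + 3 * N ∧
      (∀ i : Fin r, (i : ℕ) < m → s'.M (B + 3 * N + i) = (e i + 2 ^ (w - 1)).toNat) ∧
      ∀ a < B, s'.M a = s.M a) r
    (k * (30 * N * N + 30 * N + 21) + 5 * N + 26)
    (by
      rintro m hm s' ⟨hR', h0', h13', h14', h56', h57', h58', harr', hM'⟩
      refine ⟨by omega, ?_⟩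
      obtain ⟨q, hq⟩ : ∃ q, r - m = q + 1 := ⟨r - m - 1, by omega⟩
      have hσ' : SeedAt s' σ := hσ.congr fun a ha => hM' a (by omega)
      obtain ⟨s₅, hrun₅, h55, h53, hM₅⟩ := locateProg_run hF hR' hσ' ℓ ⟨m, hm⟩ h0' h13'
      have hy₅ : TableAt s₅ T y := hy.congr fun a ha ha' =>
        (hM₅ a (by omega) (Or.inl ha')).trans (hM' a ha')
      have hk₅ : ∀ i, i < 15 ∨ 55 < i → s₅.R i = s'.R i := fun i hi => hrun₅.R_eq (locateProg_keeps hi)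
      set j := prgHash d τ r σ ⟨m, hm⟩ ℓ with hj
      have hcell : s₅.reg 55 = BitVec.ofNat w (T + m * 2 ^ τ + j) := by
        rw [← h55, State.R, BitVec.ofNat_toNat, BitVec.setWidth_eq]
      have hyc := hy₅ ⟨m, hm⟩ j
      simp only [← hcell] at hyc
      obtain ⟨s₆, hrun₆, h52₆, hmem₆⟩ := loadSigned_run h53 hyc
      have hM₆ : ∀ a, s₆.M a = s₅.M a := fun a => by rw [State.M, hmem₆]; rfl
      have hk₆ : ∀ i, i < 15 ∨ 55 < i → s₆.R i = s'.R i := fun i hi =>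
        (hrun₆.R_eq (loadSigned_keeps (by omega) (by omega))).trans (hk₅ i hi)
      obtain ⟨s₇, hrun₇, h56₇, hM₇⟩ := storeShifted_run hw0 ((hk₆ 7 (by omega)).trans hR'.reg_one) h52₆
        (habs ⟨m, hm⟩) ((hk₆ 57 (by omega)).trans h57') ((hk₆ 56 (by omega)).trans h56') (by omega)
      have hk₇ : ∀ i, (i < 15 ∨ 55 < i) ∧ i ≠ 56 → s₇.R i = s'.R i := fun i hi =>
        (hrun₇.R_eq (storeShifted_keeps (by omega) hi.2)).trans (hk₆ i hi.1)
      obtain ⟨s₈, hrun₈, h13₈, h14₈, hmem₈⟩ := nextRow_run (i := m) (m := q) (s := s₇)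
        ((hk₇ 7 (by omega)).trans hR'.reg_one) ((hk₇ 13 (by omega)).trans h13')
        (by rw [hk₇ 14 (by omega), h14', hq]) (by omega)
      have hM₈ : ∀ a, s₈.M a = s₇.M a := fun a => by rw [State.M, hmem₈]; rfl
      have hk₈ : ∀ i, i ≠ 13 → i ≠ 14 → s₈.R i = s₇.R i := fun i h1 h2 => hrun₈.R_eq (nextRow_keeps h1 h2)
      have hrun := hrun₅.seq (hrun₆.seq (hrun₇.seq hrun₈))
      refine ⟨s₈, hrun.mono (by omega), ?_, ?_, h13₈, by omega, ?_, ?_, ?_, fun i hi => ?_, fun a ha => ?_⟩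
      · exact hR'.of_keeps hrun fun i h1 h2 => ⟨locateProg_keeps (by omega),
          loadSigned_keeps (by omega) (by omega), storeShifted_keeps (by omega) (by omega),
          nextRow_keeps (by omega) (by omega)⟩
      · rw [hk₈ 0 (by omega) (by omega), hk₇ 0 (by omega), h0']
      · rw [hk₈ 56 (by omega) (by omega), h56₇, add_assoc]
      · rw [hk₈ 57 (by omega) (by omega), hk₇ 57 (by omega), h57']
      · rw [hk₈ 58 (by omega) (by omega), hk₇ 58 (by omega), h58']
      · have hi' := i.isLt
        rw [hM₈, hM₇ _ (by omega)]
        by_cases him : (i : ℕ) = m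
        · have : i = ⟨m, hm⟩ := Fin.ext him
          subst this
          rw [if_pos rfl]
          rfl
        · rw [if_neg (by omega), hM₆, hM₅ _ (by omega) (Or.inr (by omega))]
          exact harr' i (by omega)
      · rw [hM₈, hM₇ _ (by omega), if_neg (by omega), hM₆, hM₅ _ (by omega) (Or.inl ha)]
        exact hM' a ha)
    (fun s' h => by rw [h.2.2.2.1]; omega)
    (s := s₃) ⟨hR₃, by
        rw [hk₃ 0 (by omega), hrun₂.R_eq (firstRow_keeps (by omega) (by omega)),
          hrun₁.R_eq (setupProg_keeps (by omega)), h0],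
      (hk₃ 13 (by omega)).trans h13₂, by rw [hk₃ 14 (by omega), h14₂, hR₁.reg_r]; rfl, h56₃, h57₃, h58₃,
      by simp, fun a _ => hM₃ a⟩
  obtain ⟨s₅, hrun₅, h60₅, h61₅, h62₅, hk₅, hmem₅⟩ := startSelect_run hR₄.reg_one
  have hM₅ : ∀ a, s₅.M a = s₄.M a := fun a => by rw [State.M, hmem₅]; rfl
  rw [h58₄] at h60₅
  rw [hR₄.reg_r] at h61₅ h62₅
  obtain ⟨s₆, hrun₆, hrank, hM₆⟩ := selectProg_run ((hk₅ 7 (by omega)).trans hR₄.reg_one) h60₅ h61₅ h62₅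
    (by omega) (Nat.div_lt_self hr one_lt_two)
  have hres : s₆.R 73 = (median e + 2 ^ (w - 1)).toNat :=
    hrank.unique (hasRank_median hr e _ _ fun i => (hM₅ _).trans (harr₄ i i.isLt))
  have h57₆ : s₆.R 57 = 2 ^ (w - 1) := by
    rw [hrun₆.R_eq (selectProg_keeps (by omega)), hk₅ 57 (by omega), h57₄]
  have hmed : 0 ≤ median e + 2 ^ (w - 1) := by
    rw [median, dif_pos hr]
    have := abs_lt.1 (habs (Tuple.sort e ⟨r / 2, Nat.div_lt_self hr one_lt_two⟩))
    omega
  have hrun₇ := run_eval (p := .bin .sub 0 73 57) trivial s₆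
  refine ⟨_, (hrun₁.seq (hrun₂.seq (hrun₃.seq (hrun₄.seq (hrun₅.seq (hrun₆.seq hrun₇)))))).mono ?_,
    fun a ha => ?_, ?_⟩
  · simp only [Prog.size]
    have : r * (k * (30 * N * N + 30 * N + 21) + 5 * N + 8030) =
      r * (k * (30 * N * N + 30 * N + 21) + 5 * N + 26 + 1) + 8003 * r := by ring
    omega
  · exact (hM₆ a (by omega) (by omega)).trans ((hM₅ a).trans (hM₄ a ha))
  · have g73 : s₆.reg 73 = BitVec.ofInt w (median e + 2 ^ (w - 1)) := by
      rw [← Int.toNat_of_nonneg hmed, ← hres, BitVec.ofInt_natCast, State.R, BitVec.ofNat_toNat,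
        BitVec.setWidth_eq]
    have g57 : s₆.reg 57 = BitVec.ofInt w (2 ^ (w - 1)) := by
      rw [show ((2 : ℤ) ^ (w - 1)) = ((2 ^ (w - 1) : ℕ) : ℤ) by push_cast; rfl, BitVec.ofInt_natCast, ← h57₆,
        State.R, BitVec.ofNat_toNat, BitVec.setWidth_eq]
    simp only [Prog.eval, State.setReg, Function.update_self, Op.eval, g73, g57]
    rw [BitVec.ofInt_add, BitVec.add_sub_cancel]
    rfl

end

/-! ### The data structure -/

section
variable {w N b k d τ r : ℕ}

lemma abs_prgSketch_le {n M : ℕ} (σ : Seed n b k) (x : Fin d → ℤ) (hx : ∀ i, |x i| ≤ M)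
    (ij : Fin r × Fin (2 ^ τ)) : |prgSketch d τ r σ x ij| ≤ (d * M : ℕ) := by
  rw [show ij = (ij.1, ij.2) from rfl, prgSketch_apply]
  refine (Finset.abs_sum_le_sum_abs _ _).trans ?_
  calc _ ≤ ∑ _ρ : Fin d, (M : ℤ) := Finset.sum_le_sum fun ρ _ => by
        rw [abs_mul]
        have h1 : |if prgHash d τ r σ ij.1 ρ = ij.2 then prgSign d r σ ij.1 ρ else 0| ≤ 1 := by
          simp only [prgSign]
          split_ifs <;> simp
        calc _ ≤ 1 * (M : ℤ) := mul_le_mul h1 (hx ρ) (abs_nonneg _) zero_le_one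
          _ = M := one_mul _
    _ = (d * M : ℕ) := by simp

lemma prgSketch_add_single {n : ℕ} (σ : Seed n b k) (x : Fin d → ℤ) (ℓ : Fin d) (u : ℤ) :
    prgSketch d τ r σ (x + Pi.single ℓ u) = fun ij => prgSketch d τ r σ x ij +
      if prgHash d τ r σ ij.1 ℓ = ij.2 then prgSign d r σ ij.1 ℓ * u else 0 := by
  funext ij
  rw [prgSketch, Matrix.mulVec_add, Matrix.mulVec_single, Pi.add_apply]
  simp [csMatrix, prgSketch]

lemma Holds.seedAt {s : State w} {σ : Seed (N * w) b k} {y : Fin r × Fin (2 ^ τ) → ℤ}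
    (h : Holds s d τ r σ y) : SeedAt s σ := ⟨h.2.2.2.2.2.2.1, h.2.2.2.2.2.2.2.1⟩

lemma Holds.tableAt {s : State w} {σ : Seed (N * w) b k} {y : Fin r × Fin (2 ^ τ) → ℤ}
    (h : Holds s d τ r σ y) : TableAt s (descrWords N b k) y := h.2.2.2.2.2.2.2.2

lemma Holds.paramsAt {s : State w} {σ : Seed (N * w) b k} {y : Fin r × Fin (2 ^ τ) → ℤ}
    (h : Holds s d τ r σ y) (hd : d < 2 ^ w) (hτ : 2 ^ τ < 2 ^ w) (hr : r < 2 ^ w) (hb : b < 2 ^ w)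
    (hk : k < 2 ^ w) : ParamsAt s d τ r b k := by
  obtain ⟨h0, h1, h2, h3, h4, h5, -⟩ := h
  have key : ∀ {a v : ℕ}, s.mem (BitVec.ofNat w a) = BitVec.ofNat w v → v < 2 ^ w → s.M a = v :=
    fun h hv => by rw [State.M, h, BitVec.toNat_ofNat, Nat.mod_eq_of_lt hv]
  exact ⟨key h0 Nat.lt_two_pow_self, key h1 hd, key h2 hτ, key h3 hr, key h4 hb, key h5 hk⟩

lemma Holds.of_frame {s s' : State w} {σ : Seed (N * w) b k} {y y' : Fin r × Fin (2 ^ τ) → ℤ}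
    (h : Holds s d τ r σ y) (hM : ∀ a < descrWords N b k, s'.M a = s.M a)
    (hy : TableAt s' (descrWords N b k) y') : Holds s' d τ r σ y' := by
  have hσ := h.seedAt.congr hM
  have hlt : 6 ≤ descrWords N b k := by rw [descrWords]; omega
  have key : ∀ a < 6, s'.mem (BitVec.ofNat w a) = s.mem (BitVec.ofNat w a) := fun a ha =>
    State.mem_eq_of_M (hM _ (by omega))
  obtain ⟨h0, h1, h2, h3, h4, h5, -⟩ := h
  exact ⟨(key 0 (by omega)).trans h0, (key 1 (by omega)).trans h1, (key 2 (by omega)).trans h2,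
    (key 3 (by omega)).trans h3, (key 4 (by omega)).trans h4, (key 5 (by omega)).trans h5, hσ.1, hσ.2, hy⟩

end

/-! ### The choice of the constants -/

/-- The constant `c₀` is `3 * e`. -/
lemma pow_mul_le_of_pow_three_mul_le {X Y Z e w : ℕ} (hX : X ^ (3 * e) ≤ 2 ^ w)
    (hY : Y ^ (3 * e) ≤ 2 ^ w) (hZ : Z ^ (3 * e) ≤ 2 ^ w) : (X * Y * Z) ^ e ≤ 2 ^ w := by
  refine le_of_pow_le_pow_left₀ (n := 3) (by omega) (by positivity) ?_
  calc ((X * Y * Z) ^ e) ^ 3 = X ^ (3 * e) * Y ^ (3 * e) * Z ^ (3 * e) := by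
        rw [← pow_mul, mul_comm e 3, mul_pow, mul_pow]
    _ ≤ 2 ^ w * 2 ^ w * 2 ^ w := by gcongr
    _ = (2 ^ w) ^ 3 := by ring

lemma depth_le {d r b K : ℕ} (hb : 2 ≤ b) (hr : r ≤ d ^ K) :
    depth d r b ≤ (K + 1) * Nat.clog b d := by
  refine Nat.clog_le_of_le_pow ?_
  calc r * d ≤ d ^ K * d := Nat.mul_le_mul_right _ hr
    _ = d ^ (K + 1) := (pow_succ _ _).symm
    _ ≤ (b ^ Nat.clog b d) ^ (K + 1) := Nat.pow_le_pow_left (Nat.le_pow_clog (by omega) d) _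
    _ = b ^ ((K + 1) * Nat.clog b d) := by rw [← pow_mul, mul_comm]

lemma pow_depth_le {d r b : ℕ} (hd : 2 ≤ d) (hb : 2 ≤ b) (hr : 0 < r) :
    b ^ depth d r b ≤ b * (r * d) := by
  have h1 : 1 < r * d := lt_of_lt_of_le hd (Nat.le_mul_of_pos_left d hr)
  have h2 := Nat.pow_pred_clog_lt_self (b := b) (by omega) h1
  have h3 : 0 < Nat.clog b (r * d) := Nat.clog_pos (by omega) h1
  calc b ^ depth d r b = b * b ^ (Nat.clog b (r * d)).pred := by
        rw [← pow_succ', depth, ← Nat.succ_eq_add_one, Nat.succ_pred_eq_of_pos h3]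
    _ ≤ b * (r * d) := Nat.mul_le_mul_left _ h2.le

/-- A bound for all sizes, by a power of `U = d * M * 2 ^ τ * b`: the basic estimates. -/
lemma size_bounds {d M τ r b K : ℕ} (hd : 2 ≤ d) (hM : 1 ≤ M) (hτ : 1 ≤ τ) (hr : 0 < r) (hb : 2 ≤ b)
    (hrd : r ≤ d ^ K) {U : ℕ} (hU : U = d * M * 2 ^ τ * b) :
    8 ≤ U ∧ 4 * (d * M) ≤ U ∧ 2 * 2 ^ τ ≤ U ∧ b ≤ U ∧ d ≤ U ∧ r ≤ U ^ K ∧ b ^ depth d r b ≤ U ^ (K + 2) := by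
  have h2τ : 2 ≤ 2 ^ τ := Nat.le_self_pow (by omega) 2
  have hdM : d ≤ d * M := Nat.le_mul_of_pos_right _ hM
  have h1 : d * M * 2 * 2 ≤ U := by rw [hU]; gcongr
  have h2 : 2 * 2 ^ τ * 2 ≤ U := by rw [hU]; gcongr; omega
  have h3 : 2 * 2 * b ≤ U := by rw [hU]; gcongr; omega
  have hdU : d ≤ U := by omega
  have hrU : r ≤ U ^ K := hrd.trans (Nat.pow_le_pow_left hdU K)
  refine ⟨by omega, by omega, by omega, by omega, hdU, hrU, (pow_depth_le hd hb hr).trans ?_⟩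
  calc b * (r * d) ≤ U * (U ^ K * U) := by gcongr; omega
    _ = U ^ (K + 2) := by ring

/-- Every address, counter and table size is at most a fixed multiple of a power of `U` with exponent
at most `N + K + 6`. -/
lemma fits_of_pow_le {d M τ r b K N w : ℕ} (hd : 2 ≤ d) (hM : 1 ≤ M) (hτ : 1 ≤ τ) (hr : 0 < r)
    (hb : 2 ≤ b) (hrd : r ≤ d ^ K) (hN : 0 < N) {U : ℕ} (hU : U = d * M * 2 ^ τ * b)
    (hw : U ^ (N + 2 * K + 8) ≤ 2 ^ w) : Fits w N d τ r b (depth d r b) := by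
  obtain ⟨h8, hX, hY, hbU, hdU, hrU, hpow⟩ := size_bounds hd hM hτ hr hb hrd hU
  set k := depth d r b with hk
  have hU0 : 0 < U := by omega
  have hmono : ∀ {i j : ℕ}, i ≤ j → U ^ i ≤ U ^ j := fun h => Nat.pow_le_pow_right hU0 h
  have hkU : k ≤ U ^ (K + 2) := (Nat.lt_pow_self (by omega : 1 < b)).le.trans hpow
  have hNU : N ≤ U ^ N := (Nat.lt_pow_self (by omega : 1 < U)).le
  have hbig : 8 * U ^ (N + K + 6) ≤ 2 ^ w := by
    calc 8 * U ^ (N + K + 6) ≤ U * U ^ (N + K + 6) := Nat.mul_le_mul_right _ h8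
      _ = U ^ (N + K + 7) := by ring
      _ ≤ 2 ^ w := (hmono (by omega)).trans hw
  have hone : ∀ i, 1 ≤ U ^ i := fun i => Nat.one_le_pow _ _ hU0
  have i1 : U ≤ U ^ (N + K + 6) := (Nat.le_self_pow (by omega) U)
  have i2 : N ≤ U ^ (N + K + 6) := hNU.trans (hmono (by omega))
  have i3 : k * b * (4 * N) ≤ U ^ (N + K + 6) := by
    calc k * b * (4 * N) ≤ U ^ (K + 2) * U * (U * U ^ N) := by gcongr; omega
      _ = U ^ (N + K + 4) := by ring
      _ ≤ _ := hmono (by omega)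
  have i4 : r * 2 ^ τ ≤ U ^ (N + K + 6) := by
    calc r * 2 ^ τ ≤ U ^ K * U := by gcongr; omega
      _ = U ^ (K + 1) := by ring
      _ ≤ _ := hmono (by omega)
  have i5 : 3 * N ≤ U ^ (N + K + 6) := by
    calc 3 * N ≤ U * U ^ N := by gcongr; omega
      _ = U ^ (N + 1) := by ring
      _ ≤ _ := hmono (by omega)
  have i6 : 8 * r ≤ U ^ (N + K + 6) := by
    calc 8 * r ≤ U * U ^ K := by gcongr
      _ = U ^ (K + 1) := by ring
      _ ≤ _ := hmono (by omega)
  have i7 : 64 ≤ U ^ (N + K + 6) := by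
    calc 64 ≤ U ^ 2 := by nlinarith
      _ ≤ _ := hmono (by omega)
  have i8 : b ^ k ≤ U ^ (N + K + 6) := hpow.trans (hmono (by omega))
  refine ⟨by omega, hN, by omega, by omega, Nat.le_pow_clog (by omega) _, by omega, ?_, ?_⟩
  · exact (Nat.pow_le_pow_iff_right (by omega : 1 < 2)).1 (by omega : 2 ^ τ ≤ 2 ^ w)
  · rw [descrWords]
    omega

/-- The error of the generator is small: the block size exceeds the logarithm of the number of states
by a constant factor. -/
lemma prg_error_lt {d M τ r b K N w : ℕ} {C : ℝ} (hd : 2 ≤ d) (hM : 1 ≤ M) (hτ : 1 ≤ τ) (hr : 0 < r)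
    (hb : 2 ≤ b) (hrd : r ≤ d ^ K) (hN : C + 1 < N) {U : ℕ} (hU : U = d * M * 2 ^ τ * b)
    (hw : U ^ (2 * K + 8) ≤ 2 ^ w) (hw0 : 0 < w) :
    2 * ((b ^ depth d r b : ℕ) * ((r + 1) * (2 * 2 ^ τ) * (2 * (d * M) + 1) : ℕ) *
      √(1 / ((2 : ℝ) ^ (2 * N * w)))) < (2 : ℝ) ^ (-(C * w)) := by
  obtain ⟨h8, hX, hY, hbU, hdU, hrU, hpow⟩ := size_bounds hd hM hτ hr hb hrd hU
  have hsqrt : √(1 / ((2 : ℝ) ^ (2 * N * w))) = (2 : ℝ) ^ (-((N : ℝ) * w)) := by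
    rw [Real.rpow_neg (by norm_num), ← one_div, Real.sqrt_eq_iff_mul_self_eq (by positivity) (by positivity),
      div_mul_div_comm, one_mul, ← Real.rpow_add (by norm_num), ← Real.rpow_natCast]
    congr 2
    push_cast
    ring
  have hone : 1 ≤ U ^ K := Nat.one_le_pow _ _ (by omega)
  have hsize : 2 * (b ^ depth d r b * ((r + 1) * (2 * 2 ^ τ) * (2 * (d * M) + 1))) ≤ 2 ^ w := by
    have hr1 : r + 1 ≤ U * U ^ K := by nlinarith
    calc _ ≤ U * (U ^ (K + 2) * ((U * U ^ K) * U * U)) := by gcongr <;> omega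
      _ = U ^ (2 * K + 6) := by ring
      _ ≤ U ^ (2 * K + 8) := Nat.pow_le_pow_right (by omega) (by omega)
      _ ≤ 2 ^ w := hw
  have hsize' : (2 : ℝ) * ((b ^ depth d r b : ℕ) * ((r + 1) * (2 * 2 ^ τ) * (2 * (d * M) + 1) : ℕ)) ≤
      (2 : ℝ) ^ (w : ℝ) := by
    rw [Real.rpow_natCast]
    exact_mod_cast hsize
  rw [hsqrt, ← mul_assoc]
  calc _ ≤ (2 : ℝ) ^ (w : ℝ) * 2 ^ (-((N : ℝ) * w)) := by gcongr
    _ = 2 ^ (w - (N : ℝ) * w) := by rw [← Real.rpow_add (by norm_num)]; rfl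
    _ < 2 ^ (-(C * w)) := by
      refine Real.rpow_lt_rpow_of_exponent_lt (by norm_num) ?_
      have : (0 : ℝ) < w := by exact_mod_cast hw0
      nlinarith

lemma descrWords_le {N b k K L : ℕ} (hk : k ≤ (K + 1) * L) (hb : 2 ≤ b) (hL : 0 < L) :
    descrWords N b k ≤ (6 + N + 4 * N * (K + 1)) * (b * L) := by
  have h1 : 1 ≤ b * L := Nat.mul_pos (by omega) hL
  calc descrWords N b k ≤ (6 + N) * (b * L) + (K + 1) * L * b * (4 * N) := by
        rw [descrWords]
        gcongr
        exact Nat.le_mul_of_pos_right _ h1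
    _ = _ := by ring

lemma time_le {k K L r Q S : ℕ} (hk : k ≤ (K + 1) * L) (hL : 0 < L) (hr : 0 < r) :
    3 * k + S + r * (k * Q + S) ≤ (3 * (K + 1) + 2 * S + (K + 1) * Q) * (r * L) := by
  have h1 : 1 ≤ r * L := Nat.mul_pos hr hL
  have h2 : L ≤ r * L := Nat.le_mul_of_pos_left _ hr
  have h3 : r ≤ r * L := Nat.le_mul_of_pos_right _ hL
  calc 3 * k + S + r * (k * Q + S) = 3 * k + S * 1 + r * k * Q + S * r := by ring
    _ ≤ 3 * ((K + 1) * (r * L)) + S * (r * L) + r * ((K + 1) * L) * Q + S * (r * L) := by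
        gcongr
        exact hk.trans (Nat.mul_le_mul_left _ h2)
    _ = _ := by ring

end FastCS

theorem mainTheorem4 :
    -- the constant of the exponent is absolute
    ∃ c : ℝ, 0 < c ∧
    -- the other constants and the two programs depend on `C` and `K` only
    ∀ (C : ℝ) (K : ℕ), 0 < C → ∃ (N c₀ A : ℕ) (update query : Prog),
    ∀ d M τ r b w : ℕ, 2 ≤ d → 1 ≤ M → 1 ≤ τ → Odd r → 2 ≤ b →
      -- `r` is polynomial in `d`; `w ≥ c₀ (log d + log M)`, `w ≥ c₀ log t`, `w ≥ c₀ log b`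
      r ≤ d ^ K → (d * M) ^ c₀ ≤ 2 ^ w → (2 ^ τ) ^ c₀ ≤ 2 ^ w → b ^ c₀ ≤ 2 ^ w →
      -- space, in words: the parameters, and the whole data structure in the `2 ^ w` memory cells
      descrWords N b (depth d r b) ≤ A * (b * Nat.clog b d) ∧
      descrWords N b (depth d r b) + r * 2 ^ τ ≤ 2 ^ w ∧
      -- the entries of the sketch are signed words
      (∀ (σ : Seed (N * w) b (depth d r b)) (x : Fin d → ℤ), (∀ i, |x i| ≤ M) →
        ∀ ij, |prgSketch d τ r σ x ij| < 2 ^ (w - 1)) ∧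
      -- updates
      (∀ (σ : Seed (N * w) b (depth d r b)) (x : Fin d → ℤ) (ℓ : Fin d) (u : ℤ),
        (∀ i, |x i| ≤ M) → (∀ i, |(x + Pi.single ℓ u : Fin d → ℤ) i| ≤ (M : ℤ)) →
        ∀ s : State w, Holds s d τ r σ (prgSketch d τ r σ x) →
          s.reg 0 = BitVec.ofNat w ℓ → s.reg 1 = BitVec.ofInt w u →
          ∃ (T : ℕ) (s' : State w), Exec update s T s' ∧ T ≤ A * (r * Nat.clog b d) ∧
            Holds s' d τ r σ (prgSketch d τ r σ (x + Pi.single ℓ u))) ∧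
      -- queries
      (∀ (σ : Seed (N * w) b (depth d r b)) (x : Fin d → ℤ) (ℓ : Fin d), (∀ i, |x i| ≤ M) →
        ∀ s : State w, Holds s d τ r σ (prgSketch d τ r σ x) →
          s.reg 0 = BitVec.ofNat w ℓ →
          ∃ (T : ℕ) (s' : State w), Exec query s T s' ∧ T ≤ A * (r * Nat.clog b d) ∧
            Holds s' d τ r σ (prgSketch d τ r σ x) ∧
            s'.reg 0 = BitVec.ofInt w (prgEstimate d τ r σ x ℓ)) ∧
      -- estimation error
      (∀ x : Fin d → ℤ, (∀ i, |x i| ≤ M) → ∀ α : ℝ, 0 ≤ α → α ≤ 1 → ∀ ℓ : Fin d,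
        prob {σ : Seed (N * w) b (depth d r b) |
            α * errScale (2 ^ τ) x < |(prgEstimate d τ r σ x ℓ : ℝ) - (x ℓ : ℝ)|}
          < 2 * Real.exp (-(c * α ^ 2 * r)) + (2 : ℝ) ^ (-(C * w))) := by
  refine ⟨1 / 25600, by norm_num, fun C K hC => ?_⟩
  -- The error of FastPRG is `2 ^ (-(N * w) / 2)`, up to a factor that is at most `2 ^ w`; `N` is even,
  -- so that the exponent is an integer.
  set N₀ := ⌈C⌉₊ + 2 with hN₀
  have hCN : C + 1 < N₀ := by
    have := Nat.le_ceil C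
    rw [hN₀]
    push_cast
    linarith
  set N := 2 * N₀ with hN
  set Q := 30 * N * N + 30 * N + 21 with hQ
  set S := 5 * N + 8030 with hS
  -- `U` below bounds all sizes polynomially, and is a product of three factors; hence the `3` in `c₀`.
  refine ⟨N, 3 * (N + 2 * K + 8), (6 + N + 4 * N * (K + 1)) + (3 * (K + 1) + 2 * S + (K + 1) * Q),
    updateProg N, queryProg N, fun d M τ r b w hd hM hτ hr hb hrd hX hY hZ => ?_⟩
  have hr0 : 0 < r := hr.pos
  have hw := pow_mul_le_of_pow_three_mul_le hX hY hZ
  set U := d * M * 2 ^ τ * b with hU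
  obtain ⟨h8, hXU, -⟩ := size_bounds hd hM hτ hr0 hb hrd hU
  have hF := fits_of_pow_le hd hM hτ hr0 hb hrd (by omega) hU hw
  have hU1 : U ≤ U ^ (N + 2 * K + 8) := Nat.le_self_pow (by omega) U
  have hw0 : 0 < w := by
    rcases Nat.eq_zero_or_pos w with h | h
    · rw [h, pow_zero] at hw
      omega
    · exact h
  have hpow : 2 ^ w = 2 * 2 ^ (w - 1) := by rw [← pow_succ', Nat.sub_add_cancel hw0]
  have hsketch : ∀ (σ : Seed (N * w) b (depth d r b)) (x : Fin d → ℤ), (∀ i, |x i| ≤ M) →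
      ∀ ij, |prgSketch d τ r σ x ij| < 2 ^ (w - 1) := fun σ x hx ij => by
    refine (abs_prgSketch_le σ x hx ij).trans_lt ?_
    exact_mod_cast (by omega : d * M < 2 ^ (w - 1))
  have hL : 0 < Nat.clog b d := Nat.clog_pos (by omega) (by omega)
  have hk := depth_le hb hrd
  have hdM : d ≤ d * M := Nat.le_mul_of_pos_right _ hM
  have hmem := hF.mem
  have hparams : ∀ {s : State w} {σ : Seed (N * w) b (depth d r b)} {y : Fin r × Fin (2 ^ τ) → ℤ},
      Holds s d τ r σ y → ParamsAt s d τ r b (depth d r b) := fun h => by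
    have h1 : r ≤ r * 2 ^ τ := Nat.le_mul_of_pos_right _ (by positivity)
    have h2 : 2 ^ τ ≤ r * 2 ^ τ := Nat.le_mul_of_pos_left _ hr0
    have h3 : d ≤ r * d := Nat.le_mul_of_pos_left _ hr0
    have h4 := hF.rd_le
    have h5 := hF.pow_lt
    have h6 : depth d r b < b ^ depth d r b := Nat.lt_pow_self (by omega)
    have h7 : b ≤ U := by
      rw [hU]
      exact Nat.le_mul_of_pos_left _ (by positivity)
    have h8 : 2 * U ≤ U ^ (N + 2 * K + 8) :=
      calc 2 * U ≤ U * U := Nat.mul_le_mul_right _ (by omega)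
        _ = U ^ 2 := (sq U).symm
        _ ≤ _ := Nat.pow_le_pow_right (by omega) (by omega)
    exact h.paramsAt (by omega) (by omega) (by omega) (by omega) (by omega)
  have htime := time_le (Q := Q) (S := S) hk hL hr0
  refine ⟨?_, by omega, hsketch, ?_, ?_, ?_⟩
  · exact (descrWords_le hk hb hL).trans (Nat.mul_le_mul_right _ (Nat.le_add_right _ _))
  · intro σ x ℓ u hx hx' s hs h0 h1
    have hℓ : s.R 0 = ℓ := by
      rw [State.R, h0, BitVec.toNat_ofNat]
      have := ℓ.isLt
      exact Nat.mod_eq_of_lt (by omega)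
    obtain ⟨s', ⟨T, hT, hE⟩, hframe, htable⟩ :=
      updateProg_run hF (hparams hs) hs.seedAt hs.tableAt ℓ u hℓ h1
    refine ⟨T, s', hE, ?_, ?_⟩
    · rw [add_mul]
      rw [← hQ] at hT
      have : r * (depth d r b * Q + 5 * N + 24) ≤ r * (depth d r b * Q + S) :=
        Nat.mul_le_mul_left _ (by omega)
      omega
    · rw [prgSketch_add_single]
      exact hs.of_frame hframe htable
  · intro σ x ℓ hx s hs h0
    have hℓ : s.R 0 = ℓ := by
      rw [State.R, h0, BitVec.toNat_ofNat]
      have := ℓ.isLt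
      exact Nat.mod_eq_of_lt (by omega)
    obtain ⟨s', ⟨T, hT, hE⟩, hframe, hres⟩ :=
      queryProg_run hF hr0 (hparams hs) hs.seedAt hs.tableAt (hsketch σ x hx) ℓ hℓ
    refine ⟨T, s', hE, ?_, ?_, hres⟩
    · rw [add_mul]
      rw [← hQ] at hT
      have : r * (depth d r b * Q + 5 * N + 8030) = r * (depth d r b * Q + S) := by rw [hS, add_assoc]
      omega
    · exact hs.of_frame (fun a ha => hframe a (by omega))
        (hs.tableAt.congr fun a _ ha => hframe a ha)
  · intro x hx α hα hα1 ℓ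
    have hτw : τ < N * w := by
      have h1 := hF.tau_le
      have h2 : 2 * w ≤ N * w := Nat.mul_le_mul_right _ (by omega)
      omega
    refine (prob_error_le hb hF.rd_le hτw hτ hr x hx ℓ hα hα1).trans_lt ?_
    have hw' : U ^ (2 * K + 8) ≤ 2 ^ w := (Nat.pow_le_pow_right (by omega) (by omega)).trans hw
    have := prg_error_lt hd hM hτ hr0 hb hrd hCN hU hw' hw0
    exact (add_lt_add_iff_left _).2 this
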